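/- For $\epsilon,\delta>0$ and $n\in\mathbb Z$ let $D_{Rn}$ and $D_{Ln}$ be the open unit disks in $\mathbb R^2$ with centres $(1+\frac\epsilon2,\,n(2+\delta))$ and $(-1-\frac\epsilon2,\,n(2+\delta))$, and let $E=\mathbb R^2\setminus\overline{\bigcup_{n\in\mathbb Z}(D_{Ln}\cup D_{Rn})}$. Put $\Omega=\mathbb R\times(-1-\frac\delta2,\,1+\frac\delta2)$, $\Omega_4=\{(x,y)\in\Omega: |x|<4\}$, $$N_v=\Big\{(x,y): |x|<1+\tfrac\epsilon2-\sqrt{1-y^2},\ |y|<\tfrac{\sqrt3}2\Big\},$$ $$N_h=\Big\{(x,y): \big|y-1-\tfrac\delta2\big|<1+\tfrac\delta2-\sqrt{1-(x-1-\tfrac\epsilon2)^2},\ \big|x-1-\tfrac\epsilon2\big|<\tfrac{\sqrt3}2\Big\},$$ $$S(x,y)=-2\sqrt\delta\,\frac{(x-1-\frac\epsilon2)(y-1-\frac\delta2)}{\big((x-1-\frac\epsilon2)^2+\delta\big)^2}.$$ There are constants $C\ge 0$ and $r>0$ such that the following holds for all $\epsilon,\delta\in(0,r)$. Let $H$ be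 a harmonic function on $\mathbb R^2$ with $\nabla H(x,y)=\nabla H(x,y+2+\delta)$ for all $(x,y)$. Let $u$ be continuous on $\mathbb R^2\setminus\bigcup_n(D_{Ln}\cup D_{Rn})$ and harmonic in $E$, such that $u$ is constant on $\partial D_{L0}$ and constant on $\partial D_{R0}$; the normal derivative $\partial_\nu u$ (taken from outside the disks, $\nu$ being the unit normal pointing into the disk) satisfies $$\int_{\partial D_{L0}}\partial_\nu u\,ds=\int_{\partial D_{R0}}\partial_\nu u\,ds=0;$$ $$\int_{\Omega\setminus\overline{D_{L0}\cup D_{R0}}}|\nabla(u-H)|^2\,dx\,dy<\infty;$$ and $\nabla u(x,y)=\nabla u(x,y+2+\delta)$ for all $(x,y)\in E$. Then there exist constants $\lambda,\mu\in\mathbb R$ and vector fields $R_1,R_2$ such that $$\nabla u(x,y)=\lambda\left(\frac{1}{\delta+(x-1-\frac\epsilon2)^2}(0,1)+\frac1{\sqrt\delta}S(x,y)(1,0)\right)+R_1(x,y)\quad\text{for all }(x,y)\in N_h,$$ $$\nabla u(x,y)=\mu\,\frac{\sqrt\epsilon}{\epsilon+y^2}(1,0)+R_2(x,y)\quad\text{for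 all }(x,y)\in N_v,$$ where $\lambda=H(0,1)-H(0,-1)$, $|\mu|\le C\|H\|_{L^\infty(\Omega_4)}$, $\|S\|_{L^\infty(N_h)}\le2$, $S(1+\frac\epsilon2,1+\frac\delta2)=0$, and $$\|R_1\|_{L^\infty(N_h)}+\|R_2\|_{L^\infty(N_v)}\le C\|H\|_{L^\infty(\Omega_4)}.$$ -/

import Mathlib

open MeasureTheory Set
open scoped ENNReal NNReal

noncomputable section

namespace TwoRows

/-- The plane `ℝ²` with its Euclidean structure. -/
abbrev Plane : Type := EuclideanSpace ℝ (Fin 2)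

/-- The centre of the disk `D_{Rn}`. -/
def centerR (ε δ : ℝ) (n : ℤ) : Plane := !₂[1 + ε / 2, n * (2 + δ)]

/-- The centre of the disk `D_{Ln}`. -/
def centerL (ε δ : ℝ) (n : ℤ) : Plane := !₂[-1 - ε / 2, n * (2 + δ)]

/-- The open unit disk `D_{Rn}`. -/
def diskR (ε δ : ℝ) (n : ℤ) : Set Plane := Metric.ball (centerR ε δ n) 1

/-- The open unit disk `D_{Ln}`. -/
def diskL (ε δ : ℝ) (n : ℤ) : Set Plane := Metric.ball (centerL ε δ n) 1

/-- The union of all the open disks. -/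
def inclusions (ε δ : ℝ) : Set Plane := ⋃ n : ℤ, diskL ε δ n ∪ diskR ε δ n

/-- The exterior domain: the complement of the closure of the union of the disks. -/
def exterior (ε δ : ℝ) : Set Plane := (closure (inclusions ε δ))ᶜ

/-- The horizontal strip `Ω = ℝ × (-1 - δ/2, 1 + δ/2)`. -/
def strip (δ : ℝ) : Set Plane := {p | -1 - δ / 2 < p 1 ∧ p 1 < 1 + δ / 2}

/-- The truncated strip `Ω_m = {(x, y) ∈ Ω : |x| < m}`. -/
def stripTrunc (δ m : ℝ) : Set Plane := {p | p ∈ strip δ ∧ |p 0| < m}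

/-- The vertical translation vector `(0, 2 + δ)`. -/
def period (δ : ℝ) : Plane := !₂[0, 2 + δ]

/-- `H` is harmonic on `ℝ²` and `∇H` has period `2 + δ` in the `y` direction. -/
structure IsBackground (δ : ℝ) (H : Plane → ℝ) : Prop where
  harmonic : InnerProductSpace.HarmonicOnNhd H univ
  periodic : ∀ p, gradient H p = gradient H (p + period δ)

/-- The unit vector `(cos θ, sin θ)`. -/
def circleVec (θ : ℝ) : Plane := !₂[Real.cos θ, Real.sin θ]

/-- The one-sided derivative of `u` at the boundary point `p` in the direction `ν`, taken along
`p + t ν` with `t ≤ 0`. For `ν` pointing into a disk, it is taken from outside the disk. -/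
def HasNormalDeriv (u : Plane → ℝ) (p ν : Plane) (g : ℝ) : Prop :=
  HasDerivWithinAt (fun t : ℝ => u (p + t • ν)) g (Iic 0) 0

/-- `∫ ∂_ν u ds = 0` over the boundary of the unit disk with centre `c`, where `ν` is the unit
normal pointing toward the inside of the disk; `θ` is the arc length parameter. -/
def ZeroFlux (u : Plane → ℝ) (c : Plane) : Prop :=
  ∃ g : ℝ → ℝ,
    (∀ θ, HasNormalDeriv u (c + circleVec θ) (-circleVec θ) (g θ)) ∧
    IntervalIntegrable g volume 0 (2 * Real.pi) ∧
    ∫ θ in (0 : ℝ)..(2 * Real.pi), g θ = 0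

/-- `u` solves the perfect conductor problem for the background `H`. Only the values of `u`
outside the open disks matter; the boundary values are attained continuously from outside. -/
structure IsSolution (ε δ : ℝ) (H u : Plane → ℝ) : Prop where
  harmonic : InnerProductSpace.HarmonicOnNhd u (exterior ε δ)
  continuousOn : ContinuousOn u (inclusions ε δ)ᶜ
  const_left : ∃ cL : ℝ, ∀ p ∈ frontier (diskL ε δ 0), u p = cL
  const_right : ∃ cR : ℝ, ∀ p ∈ frontier (diskR ε δ 0), u p = cR
  flux_left : ZeroFlux u (centerL ε δ 0)
  flux_right : ZeroFlux u (centerR ε δ 0)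
  energy : ∫⁻ p in strip δ \ closure (diskL ε δ 0 ∪ diskR ε δ 0),
    ‖gradient (fun q => u q - H q) p‖ₑ ^ 2 < ∞
  periodic : ∀ p ∈ exterior ε δ, gradient u p = gradient u (p + period δ)

/-- The narrow region `N_v` between `D_{L0}` and `D_{R0}`. -/
def gapV (ε : ℝ) : Set Plane :=
  {p | |p 0| < 1 + ε / 2 - √(1 - p 1 ^ 2) ∧ |p 1| < √3 / 2}

/-- The narrow region `N_h` between `D_{R0}` and `D_{R1}`. -/
def gapH (ε δ : ℝ) : Set Plane :=
  {p | |p 1 - 1 - δ / 2| < 1 + δ / 2 - √(1 - (p 0 - 1 - ε / 2) ^ 2) ∧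
    |p 0 - 1 - ε / 2| < √3 / 2}

/-- The function `S`. -/
def S (ε δ : ℝ) (p : Plane) : ℝ :=
  -2 * √δ * ((p 0 - 1 - ε / 2) * (p 1 - 1 - δ / 2) / ((p 0 - 1 - ε / 2) ^ 2 + δ) ^ 2)

/-- The norm of `L^∞(s)` for Lebesgue measure, as an extended nonnegative real. -/
def LinftyNorm {F : Type*} [NormedAddCommGroup F] (f : Plane → F) (s : Set Plane) : ℝ≥0∞ :=
  eLpNorm f ∞ (volume.restrict s)

end TwoRows

end

/-! Write `M` for the sup of `|H|` on the truncated cell, and identify the plane with `ℂ`. In a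
narrow gap `∇u` is large only because the potential differs on the two circles. So the proof
identifies the two potential differences and shows that everything else is `O(M)`, uniformly in the
gap widths.

Gap analysis. For two unit disks with centres `±b`, the function `log |ζ + a| - log |ζ - a|` with
`a² = b² - 1` is constant on each circle. Normalised to `±1/2`, it is `profile b`. Subtracting from
`u` the affine function of the profile with the same boundary values leaves a harmonic function that
vanishes on both circles. A logarithmic barrier bounds it by the distance to either disk. The
interior gradient estimate, on balls of radius comparable to that distance, then bounds its gradient
independently of the gap width (`VanishesNear.norm_fderiv_le`). The gradient of the profile is
explicit, and `norm_profileDeriv_sub_le` expands it up to `O(1)`: a main term `1 / (e + y²)` and a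
cross term `2xy / (e + y²)²`, which becomes `S`.

Horizontal gaps. Periodic gradients make `u` and `H` change by constants over a period. Finite
energy forces `∇(u - H) → 0` at infinity, so the two constants agree (`exists_common_jump`). The
difference of potential between `D_{R0}` and `D_{R1}` is therefore the jump `κ` of `H`, which is `λ
+ O(δM)`. The error `δM` times a gradient of size at most `1/δ` is harmless.

Vertical gap. The potential difference `cR - cL` is found from the flux. For `u(z) + u(z̄)` the
jumps `±κ` cancel, so its normal derivative on `∂D_{R0}` is `O(M + |cR - cL|)` apart from the
explicit contribution of the vertical gap, whose integral is at least `|cR - cL| / √ε` in absolute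
value. Zero flux gives `|cR - cL| = O(√ε M)` (`BoundedSolution.abs_sub_le`), and `μ = (cR - cL) /
√ε`.

The bound on `u` that feeds these estimates comes from a maximum principle for the periodic,
sublinear function `u - H`, with `log |sinh|` as barrier at infinity (`le_of_sublinear`). -/

namespace TwoRows

open InnerProductSpace Metric Filter Topology
open Laplacian

/-! ### Harmonic functions in the plane -/

/-- Harmonicity is invariant under linear isometries of the source. -/
theorem harmonicAt_comp_isometry {E E' : Type*} [NormedAddCommGroup E] [InnerProductSpace ℝ E]
    [FiniteDimensional ℝ E] [NormedAddCommGroup E'] [InnerProductSpace ℝ E']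
    [FiniteDimensional ℝ E'] (e : E ≃ₗᵢ[ℝ] E') {f : E' → ℝ} {x : E}
    (hf : HarmonicAt f (e x)) : HarmonicAt (f ∘ e) x := by
  have hc : ∀ᶠ y in 𝓝 x, HarmonicAt f (e y) :=
    e.continuous.continuousAt.eventually hf.eventually
  refine ⟨hf.1.comp x e.contDiff.contDiffAt, ?_⟩
  filter_upwards [hc] with y hy
  have h0 : Δ f (e y) = 0 := hy.2.self_of_nhds
  have h1 := hy.1
  -- The Laplacian of `f` is computed in the image under `e` of the basis used for `f ∘ e`, so that
  -- the two sums agree term by term.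
  rw [laplacian_eq_iteratedFDeriv_orthonormalBasis f ((stdOrthonormalBasis ℝ E).map e)] at h0
  rw [laplacian_eq_iteratedFDeriv_orthonormalBasis (f ∘ e) (stdOrthonormalBasis ℝ E)]
  rw [Pi.zero_apply, ← h0]
  refine Finset.sum_congr rfl fun i _ => ?_
  obtain ⟨s, hs, hfs⟩ := h1.contDiffOn le_rfl (by simp)
  obtain ⟨t, hts, hto, hyt⟩ := _root_.mem_nhds_iff.mp (by simpa using hs)
  have hft : ContDiffOn ℝ 2 f t := hfs.mono hts
  have hpre : IsOpen (e ⁻¹' t) := hto.preimage e.continuous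
  have key := (e.toContinuousLinearEquiv : E →L[ℝ] E').iteratedFDerivWithin_comp_right
    hft hto.uniqueDiffOn hpre.uniqueDiffOn (x := y) hyt (i := 2) le_rfl
  have e1 := iteratedFDerivWithin_of_isOpen (𝕜 := ℝ) (f := f) 2 hto hyt
  have e2 := iteratedFDerivWithin_of_isOpen (𝕜 := ℝ) (f := f ∘ e) 2 hpre hyt
  have e3 : iteratedFDeriv ℝ 2 (f ∘ e) y = (iteratedFDeriv ℝ 2 f (e y)).compContinuousLinearMap
      (fun _ => (e.toContinuousLinearEquiv : E →L[ℝ] E')) := by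
    rw [← e1, ← e2]; exact key
  rw [e3, ContinuousMultilinearMap.compContinuousLinearMap_apply]
  congr 1
  ext j
  fin_cases j <;> simp

/-- A harmonic function is locally constant near a local maximum. -/
theorem eventually_eq_of_isLocalMax_harmonic {f : ℂ → ℝ} {z : ℂ} (hf : HarmonicAt f z)
    (hm : IsLocalMax f z) : ∀ᶠ w in 𝓝 z, f w = f z := by
  obtain ⟨r, hr, hball⟩ := Metric.eventually_nhds_iff_ball.mp hf.eventually
  obtain ⟨F, hF, hFf⟩ := HarmonicOnNhd.exists_analyticOnNhd_ball_re_eq (f := f) (z := z) (R := r)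
    (fun w hw => hball w hw)
  have hz : z ∈ ball z r := mem_ball_self hr
  have hmem : ∀ᶠ w in 𝓝 z, w ∈ ball z r := isOpen_ball.mem_nhds hz
  -- Near `z`, `f = Re F` and `|exp F| = exp f`, so the maximum modulus principle applies to `exp
  -- F`.
  have h1 : ∀ᶠ w in 𝓝 z, DifferentiableAt ℂ (fun w => Complex.exp (F w)) w := by
    filter_upwards [hmem] with w hw using (hF w hw).differentiableAt.cexp
  have h2 : IsLocalMax (norm ∘ fun w => Complex.exp (F w)) z := by
    filter_upwards [hmem, hm] with w hw hmw
    simp only [Function.comp, Complex.norm_exp, Real.exp_le_exp]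
    rw [show (F w).re = f w from hFf hw, show (F z).re = f z from hFf hz]
    exact hmw
  filter_upwards [hmem, Complex.eventually_eq_of_isLocalMax_norm h1 h2] with w hw hw2
  have h3 := congrArg norm hw2
  simp only [Complex.norm_exp, Real.exp_eq_exp] at h3
  rw [← show (F w).re = f w from hFf hw, ← show (F z).re = f z from hFf hz, h3]

/-- A form of the maximum principle. Every point of the compact set `K` outside the part `T` of its
boundary may be moved vertically, with no change of `w`, to a point interior to `K` at which `w` is
harmonic. -/
theorem maximum_principle {K T : Set ℂ} {w : ℂ → ℝ} {m : ℝ} (hK : IsCompact K)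
    (hw : ContinuousOn w K) (hT : ∀ q ∈ K, q ∈ T → w q ≤ m)
    (hi : ∀ q ∈ K, q ∉ T → ∃ q', w q' = w q ∧ q'.re = q.re ∧ HarmonicAt w q' ∧ K ∈ 𝓝 q') :
    ∀ q ∈ K, w q ≤ m := by
  intro q hq
  obtain ⟨q₀, hq₀, hmax⟩ := hK.exists_isMaxOn ⟨q, hq⟩ hw
  have hS : IsCompact (K ∩ w ⁻¹' {w q₀}) := by
    obtain ⟨u, hu, huK⟩ := continuousOn_iff_isClosed.mp hw {w q₀} isClosed_singleton
    rw [inter_comm, huK, inter_comm]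
    exact hK.inter_right hu
  -- Among the maximum points, take one with the largest real part. Vertical moves keep the real
  -- part, so constancy of `w` near `q'` would produce a maximum point strictly further to the
  -- right.
  obtain ⟨q₁, hq₁, hre⟩ := hS.exists_isMaxOn ⟨q₀, hq₀, rfl⟩ Complex.continuous_re.continuousOn
  have hw1 : w q₁ = w q₀ := hq₁.2
  refine (hmax hq).trans ?_
  rw [← hw1]
  by_contra hlt
  have hq1T : q₁ ∉ T := fun h => hlt (hT q₁ hq₁.1 h)
  obtain ⟨q', hwq, hreq, hharm, hKn⟩ := hi q₁ hq₁.1 hq1T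
  have hloc : IsLocalMax w q' := by
    filter_upwards [hKn] with x hx
    rw [hwq, hw1]; exact hmax hx
  have hev := (eventually_eq_of_isLocalMax_harmonic hharm hloc).and hKn
  obtain ⟨r, hr, hball⟩ := Metric.eventually_nhds_iff_ball.mp hev
  have hx : q' + ((r / 2 : ℝ) : ℂ) ∈ ball q' r := by
    rw [mem_ball, dist_eq_norm, add_sub_cancel_left, Complex.norm_real, Real.norm_eq_abs,
      abs_of_pos (by positivity)]
    linarith
  obtain ⟨h1, h2⟩ := hball _ hx
  have h3 := hre (show q' + ((r / 2 : ℝ) : ℂ) ∈ K ∩ w ⁻¹' {w q₀} from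
    ⟨h2, by rw [mem_preimage, mem_singleton_iff, h1, hwq, hw1]⟩)
  simp only [mem_ofPred_eq, Complex.add_re, Complex.ofReal_re] at h3
  linarith

/-- The complex gradient `f_x - i f_y` has the norm of the differential. -/
theorem norm_complex_partial (L : ℂ →L[ℝ] ℝ) :
    ‖((L 1 : ℝ) : ℂ) - Complex.I * ((L Complex.I : ℝ) : ℂ)‖ = ‖L‖ := by
  set g : ℂ := ((L 1 : ℝ) : ℂ) - Complex.I * ((L Complex.I : ℝ) : ℂ) with hg
  have hgre : g.re = L 1 := by simp [hg]
  have hgim : g.im = -L Complex.I := by simp [hg]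
  have hL : ∀ w : ℂ, L w = (g * w).re := by
    intro w
    have : w = w.re • (1 : ℂ) + w.im • Complex.I := by simp
    conv_lhs => rw [this, map_add, map_smul, map_smul]
    simp only [smul_eq_mul, Complex.mul_re, hgre, hgim]; ring
  apply le_antisymm
  · rcases eq_or_ne g 0 with h0 | h0
    · rw [h0, norm_zero]; positivity
    · have hgn : 0 < ‖g‖ := norm_pos_iff.mpr h0
      -- Since `L w = Re (g w)`, the vector conjugate to `g` is extremal: `L` takes the value `|g|²`
      -- there.
      have h1 := L.le_opNorm ((starRingEnd ℂ) g)
      rw [hL, Complex.mul_conj, Complex.ofReal_re, RCLike.norm_conj, Complex.normSq_eq_norm_sq,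
        Real.norm_eq_abs, abs_of_nonneg (by positivity), sq] at h1
      exact le_of_mul_le_mul_right h1 hgn
  · refine L.opNorm_le_bound (norm_nonneg _) fun w => ?_
    rw [hL, Real.norm_eq_abs, ← norm_mul]
    exact Complex.abs_re_le_norm _

/-- The differential of the real part of a holomorphic function. -/
theorem fderiv_of_re_eventuallyEq {f : ℂ → ℝ} {F : ℂ → ℂ} {F' z : ℂ} (hF : HasDerivAt F F' z)
    (hf : f =ᶠ[𝓝 z] fun w => (F w).re) (w : ℂ) : fderiv ℝ f z w = (F' * w).re := by
  rw [hf.fderiv_eq]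
  have h1 : HasFDerivAt (𝕜 := ℝ) F ((F' • (1 : ℂ →L[ℝ] ℂ))) z := hF.complexToReal_fderiv
  have h2 := (Complex.reCLM.hasFDerivAt (x := F z)).comp z h1
  have h3 : fderiv ℝ (fun w => (F w).re) z = _ := h2.fderiv
  rw [h3]
  simp

/-- Interior gradient estimate. -/
theorem norm_fderiv_le_of_harmonicOn_ball {f : ℂ → ℝ} {z : ℂ} {r M : ℝ} (hr : 0 < r)
    (hf : HarmonicOnNhd f (ball z r)) (hM : ∀ w ∈ ball z r, |f w| ≤ M) :
    ‖fderiv ℝ f z‖ ≤ 4 * M / r := by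
  have hz : z ∈ ball z r := mem_ball_self hr
  have hM0 : 0 ≤ M := (abs_nonneg _).trans (hM z hz)
  obtain ⟨F, hF, hFf⟩ := hf.exists_analyticOnNhd_ball_re_eq
  -- The strict inequality keeps the denominator `4N - (F w - F z)` away from zero even when `M =
  -- 0`; then let `N → M`.
  suffices h : ∀ N, M < N → ‖deriv F z‖ ≤ 4 * N / r by
    have hd : ‖fderiv ℝ f z‖ ≤ ‖deriv F z‖ := by
      refine ContinuousLinearMap.opNorm_le_bound _ (norm_nonneg _) fun w => ?_
      rw [fderiv_of_re_eventuallyEq (hF z hz).differentiableAt.hasDerivAt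
        (by filter_upwards [isOpen_ball.mem_nhds hz] with w hw using (hFf hw).symm),
        Real.norm_eq_abs, ← norm_mul]
      exact Complex.abs_re_le_norm _
    refine hd.trans ?_
    have : ∀ᶠ N in 𝓝[>] M, ‖deriv F z‖ ≤ 4 * N / r := by
      filter_upwards [self_mem_nhdsWithin] with N hN using h N hN
    refine ge_of_tendsto ?_ this
    refine Tendsto.mono_left ?_ nhdsWithin_le_nhds
    exact (by fun_prop : Continuous fun N : ℝ => 4 * N / r).tendsto M
  intro N hN
  have hN0 : 0 < N := hM0.trans_lt hN
  -- Borel–Carathéodory: `a ↦ a / (4N - a)` maps the half-plane `Re a ≤ 2N` into the unit disk and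
  -- has derivative `1 / (4N)` at `0`, so the Schwarz lemma bounds `F'(z)` by `4N / r`.
  set G : ℂ → ℂ := fun w => (F w - F z) / (4 * N - (F w - F z)) with hG
  have hre : ∀ w ∈ ball z r, (F w - F z).re ≤ 2 * M := by
    intro w hw
    rw [Complex.sub_re, show (F w).re = f w from hFf hw, show (F z).re = f z from hFf hz]
    have := abs_le.mp (hM w hw); have := abs_le.mp (hM z hz); linarith
  have hne : ∀ w ∈ ball z r, (4 * N - (F w - F z) : ℂ) ≠ 0 := by
    intro w hw h
    have := congrArg Complex.re h
    have h2 := hre w hw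
    rw [Complex.sub_re, Complex.mul_re] at this
    simp only [Complex.re_ofNat, Complex.ofReal_re, Complex.im_ofNat, Complex.ofReal_im, mul_zero,
      sub_zero, Complex.zero_re] at this
    linarith
  have hGd : DifferentiableOn ℂ G (ball z r) := fun w hw =>
    (((hF w hw).differentiableAt.sub_const _).div
      ((differentiableAt_const _).sub ((hF w hw).differentiableAt.sub_const _))
      (hne w hw)).differentiableWithinAt
  have hGz : G z = 0 := by simp [hG]
  have hmaps : MapsTo G (ball z r) (closedBall (G z) 1) := by
    intro w hw
    rw [hGz, mem_closedBall, dist_zero_right, hG]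
    simp only
    rw [norm_div, div_le_one (norm_pos_iff.mpr (hne w hw))]
    have h2 := hre w hw
    set a : ℂ := F w - F z
    rw [← sq_le_sq₀ (norm_nonneg _) (norm_nonneg _), ← Complex.normSq_eq_norm_sq,
      ← Complex.normSq_eq_norm_sq, Complex.normSq_apply, Complex.normSq_apply]
    simp only [Complex.sub_re, Complex.sub_im, Complex.mul_re, Complex.mul_im, Complex.re_ofNat,
      Complex.ofReal_re, Complex.im_ofNat, Complex.ofReal_im, mul_zero, zero_mul, sub_zero,
      add_zero, zero_sub]
    nlinarith
  have hder : HasDerivAt G (deriv F z / (4 * N)) z := by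
    have h1 := ((hF z hz).differentiableAt.hasDerivAt.sub_const (F z))
    have h2 := h1.div (h1.const_sub (4 * (N : ℂ))) (hne z hz)
    refine HasDerivAt.congr_deriv (f := G) h2 ?_
    have : (N : ℂ) ≠ 0 := by exact_mod_cast hN0.ne'
    simp only [sub_self, sub_zero, zero_mul]
    field_simp
  have h := Complex.norm_deriv_le_div_of_mapsTo_ball hGd hmaps hr
  rw [hder.deriv, norm_div, div_le_iff₀ (norm_pos_iff.mpr (by
    have : (N : ℂ) ≠ 0 := by exact_mod_cast hN0.ne'
    simpa using this))] at h
  refine h.trans (le_of_eq ?_)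
  rw [norm_mul, Complex.norm_real, Real.norm_eq_abs, abs_of_pos hN0]
  norm_num
  ring

end TwoRows

/-! ### Pointwise gradient bounds from the energy -/

namespace TwoRows

open InnerProductSpace Metric Filter Topology

/-- The mean value inequality over disks for a holomorphic function. -/
theorem pi_mul_enorm_le_lintegral_ball {g : ℂ → ℂ} {p : ℂ}
    (hg : DifferentiableOn ℂ g (ball p 1)) :
    ENNReal.ofReal Real.pi * ‖g p‖ₑ ≤ ∫⁻ z in ball p 1, ‖g z‖ₑ := by
  -- Mean value over each circle, with the angle in `(-π, π)` to match polar coordinates;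
  -- integration against `r dr` turns `2π` into `π`.
  have hcirc : ∀ r ∈ Ioo (0 : ℝ) 1, ENNReal.ofReal (2 * Real.pi) * ‖g p‖ₑ ≤
      ∫⁻ θ in Ioo (-Real.pi) Real.pi, ‖g (circleMap p r θ)‖ₑ := by
    intro r hr
    have hd : DiffContOnCl ℂ g (ball p |r|) := by
      apply DifferentiableOn.diffContOnCl
      refine hg.mono (closure_ball_subset_closedBall.trans ?_)
      rw [abs_of_pos hr.1]
      exact closedBall_subset_ball hr.2
    have h1 := hd.circleAverage
    rw [Real.circleAverage_def] at h1
    have h2 : ∫ θ in (0 : ℝ)..2 * Real.pi, g (circleMap p r θ) = (2 * Real.pi) • g p := by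
      rw [← h1, smul_smul, mul_inv_cancel₀ (by positivity), one_smul]
    have h3 : Function.Periodic (fun θ => g (circleMap p r θ)) (2 * Real.pi) := fun θ => by
      simp only [periodic_circleMap p r θ]
    have h4 := h3.intervalIntegral_add_eq 0 (-Real.pi)
    rw [zero_add, h2, show -Real.pi + 2 * Real.pi = Real.pi by ring,
      intervalIntegral.integral_of_le (by linarith [Real.pi_pos]),
      integral_Ioc_eq_integral_Ioo] at h4
    calc ENNReal.ofReal (2 * Real.pi) * ‖g p‖ₑ = ‖(2 * Real.pi) • g p‖ₑ := by
          rw [enorm_smul, Real.enorm_eq_ofReal (by positivity)]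
      _ ≤ _ := by rw [h4]; exact enorm_integral_le_lintegral_enorm _
  have hpolar : ∫⁻ z in ball p 1, ‖g z‖ₑ = ∫⁻ q in polarCoord.target,
      ENNReal.ofReal q.1 • (ball p 1).indicator (fun z => ‖g z‖ₑ)
        (p + Complex.polarCoord.symm q) := by
    rw [← lintegral_indicator measurableSet_ball,
      ← lintegral_add_left_eq_self _ p, ← Complex.lintegral_comp_polarCoord_symm]
  set s : Set (ℝ × ℝ) := Ioo (0 : ℝ) 1 ×ˢ Ioo (-Real.pi) Real.pi with hs
  have hsub : s ⊆ polarCoord.target := by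
    rw [polarCoord_target]
    exact prod_mono (fun x hx => hx.1) subset_rfl
  have hmap : ∀ q : ℝ × ℝ, p + Complex.polarCoord.symm q = circleMap p q.1 q.2 := by
    intro q
    rw [Complex.polarCoord_symm_apply, circleMap, Complex.exp_mul_I]
    simp
  have hmem : ∀ q ∈ s, circleMap p q.1 q.2 ∈ ball p 1 := by
    intro q hq
    rw [mem_ball, dist_eq_norm, circleMap_sub_center, norm_circleMap_zero, abs_of_pos hq.1.1]
    exact hq.1.2
  have hmeas : AEMeasurable (fun q : ℝ × ℝ => ENNReal.ofReal q.1 * ‖g (circleMap p q.1 q.2)‖ₑ)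
      (volume.restrict s) := by
    refine (measurable_fst.ennreal_ofReal.aemeasurable).mul ?_
    refine ContinuousOn.aemeasurable ?_ (measurableSet_Ioo.prod measurableSet_Ioo)
    refine continuous_enorm.comp_continuousOn (hg.continuousOn.comp ?_ hmem)
    have : Continuous fun q : ℝ × ℝ => circleMap p q.1 q.2 := by
      unfold circleMap; fun_prop
    exact this.continuousOn
  rw [hpolar]
  calc ENNReal.ofReal Real.pi * ‖g p‖ₑ
      = ∫⁻ r in Ioo (0 : ℝ) 1, ENNReal.ofReal r * (ENNReal.ofReal (2 * Real.pi) * ‖g p‖ₑ) := by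
        rw [lintegral_mul_const' _ _ (by finiteness),
          ← ofReal_integral_eq_lintegral_ofReal, ← integral_Ioc_eq_integral_Ioo,
          ← intervalIntegral.integral_of_le zero_le_one, integral_id, ← mul_assoc,
          ← ENNReal.ofReal_mul (by norm_num)]
        · congr 2; ring
        · exact (continuous_id.integrableOn_Icc (a := (0 : ℝ)) (b := 1)).mono_set Ioo_subset_Icc_self
        · filter_upwards [ae_restrict_mem measurableSet_Ioo] with r hr using hr.1.le
    _ ≤ ∫⁻ r in Ioo (0 : ℝ) 1, ENNReal.ofReal r *
          ∫⁻ θ in Ioo (-Real.pi) Real.pi, ‖g (circleMap p r θ)‖ₑ := by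
        refine setLIntegral_mono' measurableSet_Ioo fun r hr => ?_
        gcongr
        exact hcirc r hr
    _ = ∫⁻ q in s, ENNReal.ofReal q.1 * ‖g (circleMap p q.1 q.2)‖ₑ := by
        rw [hs, Measure.volume_eq_prod, ← Measure.prod_restrict, lintegral_prod]
        · refine lintegral_congr fun r => ?_
          rw [lintegral_const_mul' _ _ ENNReal.ofReal_ne_top]
        · rw [Measure.prod_restrict, ← Measure.volume_eq_prod]
          exact hmeas
    _ = ∫⁻ q in s, ENNReal.ofReal q.1 • (ball p 1).indicator (fun z => ‖g z‖ₑ)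
        (p + Complex.polarCoord.symm q) := by
        refine setLIntegral_congr_fun (measurableSet_Ioo.prod measurableSet_Ioo) fun q hq => ?_
        simp only [hmap, smul_eq_mul]
        rw [indicator_of_mem (hmem q hq)]
    _ ≤ _ := lintegral_mono_set hsub

/-- A harmonic function with small energy on a disk has small gradient at its centre. -/
theorem norm_fderiv_le_of_energy_le {f : ℂ → ℝ} {p : ℂ} {s : ℝ} (hs : 0 < s)
    (hf : HarmonicOnNhd f (ball p 1))
    (hE : ∫⁻ z in ball p 1, ‖fderiv ℝ f z‖ₑ ^ 2 ≤ ENNReal.ofReal (s ^ 2)) :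
    ‖fderiv ℝ f p‖ ≤ 2 * s := by
  set g : ℂ → ℂ := fun z => ((fderiv ℝ f z 1 : ℝ) : ℂ) - Complex.I * ((fderiv ℝ f z Complex.I : ℝ) : ℂ)
  have hgn : ∀ z, ‖g z‖ₑ = ‖fderiv ℝ f z‖ₑ := fun z => by
    rw [← ofReal_norm, ← ofReal_norm, norm_complex_partial]
  have hg : DifferentiableOn ℂ g (ball p 1) := fun z hz =>
    (HarmonicAt.differentiableAt_complex_partial (hf z hz)).differentiableWithinAt
  have h1 := pi_mul_enorm_le_lintegral_ball hg
  simp only [hgn] at h1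
  -- The elementary inequality `t ≤ s + t² / s` takes the place of Cauchy–Schwarz in passing from
  -- the `L¹` mean value bound to the energy.
  have h2 : ∀ z, ‖fderiv ℝ f z‖ₑ ≤ ENNReal.ofReal s + ENNReal.ofReal s⁻¹ * ‖fderiv ℝ f z‖ₑ ^ 2 := by
    intro z
    rw [← ofReal_norm, ← ENNReal.ofReal_pow (norm_nonneg _), ← ENNReal.ofReal_mul (by positivity),
      ← ENNReal.ofReal_add (by positivity) (by positivity)]
    apply ENNReal.ofReal_le_ofReal
    set a := ‖fderiv ℝ f z‖
    have h3 : a * s ≤ s ^ 2 + a ^ 2 := by nlinarith [sq_nonneg (a - s), sq_nonneg (a + s)]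
    have h4 : s + s⁻¹ * a ^ 2 = (s ^ 2 + a ^ 2) / s := by field_simp
    rw [h4, le_div_iff₀ hs]; exact h3
  have h5 : ENNReal.ofReal Real.pi * ‖fderiv ℝ f p‖ₑ ≤ ENNReal.ofReal (s * Real.pi + s) := by
    calc _ ≤ _ := h1
      _ ≤ ∫⁻ z in ball p 1, (ENNReal.ofReal s + ENNReal.ofReal s⁻¹ * ‖fderiv ℝ f z‖ₑ ^ 2) :=
          lintegral_mono fun z => h2 z
      _ = ENNReal.ofReal s * volume (ball p 1) +
          ENNReal.ofReal s⁻¹ * ∫⁻ z in ball p 1, ‖fderiv ℝ f z‖ₑ ^ 2 := by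
          rw [lintegral_add_left measurable_const, lintegral_const_mul' _ _ ENNReal.ofReal_ne_top]
          simp
      _ ≤ ENNReal.ofReal s * ENNReal.ofReal Real.pi + ENNReal.ofReal s⁻¹ * ENNReal.ofReal (s ^ 2) := by
          gcongr
          rw [Complex.volume_ball]
          simp [ENNReal.ofReal, Real.toNNReal_of_nonneg Real.pi_pos.le]
          rfl
      _ = ENNReal.ofReal (s * Real.pi + s) := by
          rw [← ENNReal.ofReal_mul hs.le, ← ENNReal.ofReal_mul (by positivity),
            ← ENNReal.ofReal_add (by positivity) (by positivity)]
          congr 2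
          field_simp
  rw [← ofReal_norm, ← ENNReal.ofReal_mul (by positivity),
    ENNReal.ofReal_le_ofReal_iff (by positivity)] at h5
  nlinarith [Real.pi_gt_three, norm_nonneg (fderiv ℝ f p)]

end TwoRows

namespace TwoRows

open InnerProductSpace Metric Filter Topology

/-! ### Functions vanishing on the boundary of two unit disks -/

/-- Near `p`, the function `v` is bounded by `M`, harmonic outside the closed unit disks with centres
`c₁`, `c₂`, continuous up to their boundary, and zero there. -/
structure VanishesNear (c₁ c₂ p : ℂ) (ρ M : ℝ) (v : ℂ → ℝ) : Prop where
  harmonic : ∀ q ∈ ball p ρ, 1 < ‖q - c₁‖ → 1 < ‖q - c₂‖ → HarmonicAt v q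
  cont : ContinuousOn v {q | q ∈ closedBall p ρ ∧ 1 ≤ ‖q - c₁‖ ∧ 1 ≤ ‖q - c₂‖}
  zero : ∀ q ∈ closedBall p ρ, 1 ≤ ‖q - c₁‖ → 1 ≤ ‖q - c₂‖ → ‖q - c₁‖ = 1 ∨ ‖q - c₂‖ = 1 → v q = 0
  bound : ∀ q ∈ closedBall p ρ, 1 ≤ ‖q - c₁‖ → 1 ≤ ‖q - c₂‖ → |v q| ≤ M

namespace VanishesNear

variable {c₁ c₂ p : ℂ} {ρ M : ℝ} {v : ℂ → ℝ}

theorem neg (h : VanishesNear c₁ c₂ p ρ M v) : VanishesNear c₁ c₂ p ρ M (-v) where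
  harmonic q hq h1 h2 := (h.harmonic q hq h1 h2).neg
  cont := h.cont.neg
  zero q hq h1 h2 h3 := by simp [h.zero q hq h1 h2 h3]
  bound q hq h1 h2 := by simpa using h.bound q hq h1 h2

theorem swap (h : VanishesNear c₁ c₂ p ρ M v) : VanishesNear c₂ c₁ p ρ M v where
  harmonic q hq h1 h2 := h.harmonic q hq h2 h1
  cont := h.cont.mono fun _ hq => ⟨hq.1, hq.2.2, hq.2.1⟩
  zero q hq h1 h2 h3 := h.zero q hq h2 h1 h3.symm
  bound q hq h1 h2 := h.bound q hq h2 h1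

theorem shrink (h : VanishesNear c₁ c₂ p ρ M v) {q : ℂ} (hq : q ∈ closedBall p (ρ / 2)) :
    VanishesNear c₁ c₂ q (ρ / 2) M v := by
  have hsub : closedBall q (ρ / 2) ⊆ closedBall p ρ :=
    closedBall_subset_closedBall' (by rw [mem_closedBall] at hq; linarith)
  have hsub' : ball q (ρ / 2) ⊆ ball p ρ :=
    ball_subset_ball' (by rw [mem_closedBall] at hq; linarith)
  exact ⟨fun x hx => h.harmonic x (hsub' hx), h.cont.mono fun x hx => ⟨hsub hx.1, hx.2⟩,
    fun x hx => h.zero x (hsub hx), fun x hx => h.bound x (hsub hx)⟩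

/-- The upper half of `VanishesNear.abs_le`. -/
theorem le_mul_dist (h : VanishesNear c₁ c₂ p ρ M v) (hρ : 0 < ρ) (hρ1 : ρ ≤ 1)
    (hp₁ : 1 ≤ ‖p - c₁‖) (hp₂ : 1 ≤ ‖p - c₂‖) : v p ≤ 16 * M / ρ ^ 2 * (‖p - c₁‖ - 1) := by
  have hpp : p ∈ closedBall p ρ := mem_closedBall_self hρ.le
  have hM : 0 ≤ M := (abs_nonneg _).trans (h.bound p hpp hp₁ hp₂)
  have hvp : v p ≤ M := (abs_le.mp (h.bound p hpp hp₁ hp₂)).2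
  set d : ℝ := ‖p - c₁‖ - 1 with hd
  have hd0 : 0 ≤ d := by linarith
  -- At distance at least `ρ / 2` from the disk the trivial bound `v p ≤ M` already suffices.
  rcases le_or_gt (ρ / 2) d with hcase | hcase
  · have : M ≤ 16 * M / ρ ^ 2 * d := by
      rw [div_mul_eq_mul_div, le_div_iff₀ (by positivity)]
      nlinarith [mul_nonneg hM hρ.le, mul_nonneg hM hd0, mul_nonneg (mul_nonneg hM hρ.le) (sub_nonneg.mpr hρ1)]
    linarith
  set e : ℂ := (p - c₁) / (‖p - c₁‖ : ℂ) with he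
  have hn0 : (0 : ℝ) < ‖p - c₁‖ := by linarith
  have hn0' : (‖p - c₁‖ : ℂ) ≠ 0 := by exact_mod_cast hn0.ne'
  have hen : ‖e‖ = 1 := by
    rw [he, norm_div, Complex.norm_real, Real.norm_eq_abs, abs_norm, div_self hn0.ne']
  have hpe : p - c₁ = ((1 + d : ℝ) : ℂ) * e := by
    rw [he, hd, show (1 + (‖p - c₁‖ - 1) : ℝ) = ‖p - c₁‖ by ring]
    field_simp
  -- The barrier has its pole at `c₁ + e / 2`, inside the disk, where `e` points from `c₁` to `p`.
  -- By the parallelogram law `|2(q - c₁) - e|² ≥ 1 + 2|q - c₁ - e|²` outside the disk. So `B` is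
  -- nonnegative there, of order at least `ρ²` on the circle of radius `ρ` about `p`, and yet only
  -- `log (1 + 2d)` at `p`.
  set B : ℂ → ℝ := fun q => Real.log ‖2 * (q - c₁) - e‖ with hB
  have hsq : ∀ q, ‖2 * (q - c₁) - e‖ ^ 2 = 2 * ‖q - c₁‖ ^ 2 + 2 * ‖q - c₁ - e‖ ^ 2 - 1 := by
    intro q
    have := parallelogram_law_with_norm ℝ (q - c₁) (q - c₁ - e)
    rw [show q - c₁ - (q - c₁ - e) = e by ring, hen,
      show q - c₁ + (q - c₁ - e) = 2 * (q - c₁) - e by ring] at this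
    linarith
  have hge : ∀ q, 1 ≤ ‖q - c₁‖ → 1 ≤ ‖2 * (q - c₁) - e‖ := by
    intro q hq
    have := hsq q
    rw [← one_le_sq_iff₀ (norm_nonneg _)]
    nlinarith [sq_nonneg ‖q - c₁ - e‖]
  have hBnn : ∀ q, 1 ≤ ‖q - c₁‖ → 0 ≤ B q := fun q hq => Real.log_nonneg (hge q hq)
  have hBbig : ∀ q, 1 ≤ ‖q - c₁‖ → ‖q - p‖ = ρ → ρ ^ 2 / 8 ≤ B q := by
    intro q hq hqp
    have h1 : ρ / 2 ≤ ‖q - c₁ - e‖ := by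
      have h2 : q - c₁ - e = (q - p) + (d : ℂ) * e := by
        have : q - c₁ - e = (q - p) + (p - c₁) - e := by ring
        rw [this, hpe]; push_cast; ring
      have h3 : ‖(d : ℂ) * e‖ = d := by
        rw [norm_mul, hen, Complex.norm_real, Real.norm_eq_abs, abs_of_nonneg hd0, mul_one]
      have h4 := norm_sub_le_norm_add (q - p) ((d : ℂ) * e)
      rw [h2]; linarith
    have h5 : 1 + ρ ^ 2 / 2 ≤ ‖2 * (q - c₁) - e‖ ^ 2 := by
      rw [hsq]; nlinarith
    have h6 : 2 * B q = Real.log (‖2 * (q - c₁) - e‖ ^ 2) := by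
      rw [Real.log_pow]; push_cast; rfl
    have h7 : Real.log (1 + ρ ^ 2 / 2) ≤ 2 * B q := by
      rw [h6]; exact Real.log_le_log (by positivity) h5
    have h8 := Real.one_sub_inv_le_log_of_pos (x := 1 + ρ ^ 2 / 2) (by positivity)
    have h9 : ρ ^ 2 / 4 ≤ 1 - (1 + ρ ^ 2 / 2)⁻¹ := by
      have h10 : ρ ^ 2 ≤ 1 := by nlinarith
      rw [le_sub_comm, inv_le_iff_one_le_mul₀ (by positivity)]
      nlinarith [sq_nonneg ρ]
    linarith
  have hBp : B p ≤ 2 * d := by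
    have : 2 * (p - c₁) - e = ((1 + 2 * d : ℝ) : ℂ) * e := by
      rw [hpe]; push_cast; ring
    simp only [hB]
    rw [this, norm_mul, hen, mul_one, Complex.norm_real, Real.norm_eq_abs,
      abs_of_nonneg (by positivity)]
    have := Real.log_le_sub_one_of_pos (x := 1 + 2 * d) (by positivity)
    linarith
  have hBharm : ∀ q, 1 ≤ ‖q - c₁‖ → HarmonicAt B q := by
    intro q hq
    refine AnalyticAt.harmonicAt_log_norm (f := fun q => 2 * (q - c₁) - e) (by fun_prop) ?_
    rw [← norm_pos_iff]; linarith [hge q hq]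
  -- Chosen so that `k • B ≥ M` on the circle of radius `ρ` about `p`.
  set k : ℝ := 8 * M / ρ ^ 2 with hk
  have hk0 : 0 ≤ k := by positivity
  have hclosed : IsClosed {q : ℂ | 1 ≤ ‖q - c₁‖ ∧ 1 ≤ ‖q - c₂‖} :=
    IsClosed.inter (s₁ := {q : ℂ | 1 ≤ ‖q - c₁‖}) (s₂ := {q : ℂ | 1 ≤ ‖q - c₂‖})
      (isClosed_le continuous_const (by fun_prop)) (isClosed_le continuous_const (by fun_prop))
  have hmax := maximum_principle (K := {q | q ∈ closedBall p ρ ∧ 1 ≤ ‖q - c₁‖ ∧ 1 ≤ ‖q - c₂‖})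
    (T := {q | ‖q - p‖ = ρ ∨ ‖q - c₁‖ = 1 ∨ ‖q - c₂‖ = 1}) (w := v - k • B) (m := 0)
    ((isCompact_closedBall p ρ).inter_right hclosed)
    (h.cont.sub (ContinuousOn.const_smul
      (fun q hq => (hBharm q hq.2.1).1.continuousAt.continuousWithinAt) k)) ?_ ?_ p ⟨hpp, hp₁, hp₂⟩
  · simp only [Pi.sub_apply, Pi.smul_apply, smul_eq_mul] at hmax
    have h1 : k * B p ≤ k * (2 * d) := mul_le_mul_of_nonneg_left hBp hk0
    have h2 : k * (2 * d) = 16 * M / ρ ^ 2 * d := by rw [hk]; ring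
    linarith
  · rintro q ⟨hq, hq1, hq2⟩ hT
    simp only [Pi.sub_apply, Pi.smul_apply, smul_eq_mul]
    rcases hT with hT | hT
    · have h1 := mul_le_mul_of_nonneg_left (hBbig q hq1 hT) hk0
      have h2 : k * (ρ ^ 2 / 8) = M := by rw [hk]; field_simp
      have h3 := (abs_le.mp (h.bound q hq hq1 hq2)).2
      linarith
    · rw [h.zero q hq hq1 hq2 hT]
      have := mul_nonneg hk0 (hBnn q hq1)
      linarith
  · rintro q ⟨hq, hq1, hq2⟩ hT
    simp only [mem_ofPred_eq, not_or] at hT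
    have hlt1 : 1 < ‖q - c₁‖ := lt_of_le_of_ne hq1 (Ne.symm hT.2.1)
    have hlt2 : 1 < ‖q - c₂‖ := lt_of_le_of_ne hq2 (Ne.symm hT.2.2)
    have hqb : q ∈ ball p ρ := by
      rw [mem_closedBall, dist_eq_norm] at hq
      rw [mem_ball, dist_eq_norm]; exact lt_of_le_of_ne hq hT.1
    refine ⟨q, rfl, rfl, (h.harmonic q hqb hlt1 hlt2).sub ((hBharm q hq1).const_smul), ?_⟩
    have ho : IsOpen (ball p ρ ∩ {q : ℂ | 1 < ‖q - c₁‖} ∩ {q : ℂ | 1 < ‖q - c₂‖}) :=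
      (isOpen_ball.inter (isOpen_lt continuous_const (by fun_prop))).inter
        (isOpen_lt continuous_const (by fun_prop))
    exact mem_of_superset (ho.mem_nhds ⟨⟨hqb, hlt1⟩, hlt2⟩)
      fun x hx => ⟨ball_subset_closedBall hx.1.1, hx.1.2.le, hx.2.le⟩

/-- Linear growth away from the disks. -/
theorem abs_le (h : VanishesNear c₁ c₂ p ρ M v) (hρ : 0 < ρ) (hρ1 : ρ ≤ 1)
    (hp₁ : 1 ≤ ‖p - c₁‖) (hp₂ : 1 ≤ ‖p - c₂‖) : |v p| ≤ 16 * M / ρ ^ 2 * (‖p - c₁‖ - 1) := by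
  have h1 := h.le_mul_dist hρ hρ1 hp₁ hp₂
  have h2 := h.neg.le_mul_dist hρ hρ1 hp₁ hp₂
  rw [Pi.neg_apply] at h2
  exact _root_.abs_le.mpr ⟨by linarith, h1⟩

/-- Gradient estimate, uniform up to the boundary of the disks. -/
theorem norm_fderiv_le (h : VanishesNear c₁ c₂ p ρ M v) (hρ : 0 < ρ) (hρ1 : ρ ≤ 1)
    (hp₁ : 1 < ‖p - c₁‖) (hp₂ : 1 < ‖p - c₂‖) : ‖fderiv ℝ v p‖ ≤ 512 * M / ρ ^ 2 := by
  have hpp : p ∈ closedBall p ρ := mem_closedBall_self hρ.le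
  have hM : 0 ≤ M := (abs_nonneg _).trans (h.bound p hpp hp₁.le hp₂.le)
  -- On the ball of radius `d` the distance to the nearest disk is at most `2d`, so linear growth
  -- gives `|v| ≤ C d`. The interior estimate divides by `d` again. The cap `ρ / 2` handles points
  -- far from both disks.
  set d : ℝ := min (min (‖p - c₁‖ - 1) (‖p - c₂‖ - 1)) (ρ / 2) with hd
  have hd0 : 0 < d := lt_min (lt_min (by linarith) (by linarith)) (by linarith)
  have hd1 : d ≤ ‖p - c₁‖ - 1 := (min_le_left _ _).trans (min_le_left _ _)
  have hd2 : d ≤ ‖p - c₂‖ - 1 := (min_le_left _ _).trans (min_le_right _ _)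
  have hd3 : d ≤ ρ / 2 := min_le_right _ _
  have hdist : ∀ q ∈ ball p d, ∀ c : ℂ, ‖p - c‖ - d < ‖q - c‖ ∧ ‖q - c‖ < ‖p - c‖ + d := by
    intro q hq c
    rw [mem_ball, dist_eq_norm] at hq
    have h1 := norm_sub_norm_le (q - c) (p - c)
    have h2 := norm_sub_norm_le (p - c) (q - c)
    rw [sub_sub_sub_cancel_right] at h1 h2
    rw [norm_sub_rev p q] at h2
    constructor <;> linarith
  have hq1 : ∀ q ∈ ball p d, 1 < ‖q - c₁‖ := fun q hq => by linarith [(hdist q hq c₁).1]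
  have hq2 : ∀ q ∈ ball p d, 1 < ‖q - c₂‖ := fun q hq => by linarith [(hdist q hq c₂).1]
  have hqρ : ∀ q ∈ ball p d, q ∈ closedBall p (ρ / 2) := fun q hq =>
    (mem_ball.mp hq).le.trans hd3
  have hharm : HarmonicOnNhd v (ball p d) := fun q hq =>
    h.harmonic q ((mem_ball.mp hq).trans_le (by linarith)) (hq1 q hq) (hq2 q hq)
  suffices hb : ∀ q ∈ ball p d, |v q| ≤ 128 * M / ρ ^ 2 * d by
    refine (norm_fderiv_le_of_harmonicOn_ball hd0 hharm hb).trans (le_of_eq ?_)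
    ring_nf; field_simp
  intro q hq
  have hs := h.shrink (hqρ q hq)
  have hmul : 16 * M / (ρ / 2) ^ 2 * (2 * d) = 128 * M / ρ ^ 2 * d := by ring
  have hpos : 0 ≤ 16 * M / (ρ / 2) ^ 2 := by positivity
  rcases min_choice (min (‖p - c₁‖ - 1) (‖p - c₂‖ - 1)) (ρ / 2) with h3 | h3
  · rcases min_choice (‖p - c₁‖ - 1) (‖p - c₂‖ - 1) with h4 | h4
    · refine (hs.abs_le (by linarith) (by linarith) (hq1 q hq).le (hq2 q hq).le).trans ?_
      rw [← hmul]
      refine mul_le_mul_of_nonneg_left ?_ hpos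
      have : d = ‖p - c₁‖ - 1 := by rw [hd, h3, h4]
      linarith [(hdist q hq c₁).2]
    · refine (hs.swap.abs_le (by linarith) (by linarith) (hq2 q hq).le (hq1 q hq).le).trans ?_
      rw [← hmul]
      refine mul_le_mul_of_nonneg_left ?_ hpos
      have : d = ‖p - c₂‖ - 1 := by rw [hd, h3, h4]
      linarith [(hdist q hq c₂).2]
  · refine (h.bound q ((mem_ball.mp hq).le.trans (by linarith)) (hq1 q hq).le (hq2 q hq).le).trans ?_
    have hdρ : d = ρ / 2 := by rw [hd, h3]
    rw [hdρ, div_mul_eq_mul_div, le_div_iff₀ (by positivity)]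
    nlinarith [mul_nonneg hM hρ.le, mul_nonneg (mul_nonneg hM hρ.le) (sub_nonneg.mpr hρ1)]

end VanishesNear

end TwoRows

namespace TwoRows

open InnerProductSpace Metric Filter Topology

/-! ### The geometry of the two rows of disks, in the complex plane -/

/-- The centre of `D_{Rn}` as a complex number. -/
noncomputable def ctrR (ε δ : ℝ) (n : ℤ) : ℂ := ⟨1 + ε / 2, n * (2 + δ)⟩

/-- The centre of `D_{Ln}` as a complex number. -/
noncomputable def ctrL (ε δ : ℝ) (n : ℤ) : ℂ := ⟨-1 - ε / 2, n * (2 + δ)⟩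

/-- The vertical period as a complex number. -/
def per (δ : ℝ) : ℂ := ⟨0, 2 + δ⟩

/-- The complement of the closed disks. -/
def openExt (ε δ : ℝ) : Set ℂ := {z | ∀ n : ℤ, 1 < ‖z - ctrL ε δ n‖ ∧ 1 < ‖z - ctrR ε δ n‖}

/-- The complement of the open disks. -/
def closedExt (ε δ : ℝ) : Set ℂ := {z | ∀ n : ℤ, 1 ≤ ‖z - ctrL ε δ n‖ ∧ 1 ≤ ‖z - ctrR ε δ n‖}

theorem openExt_subset_closedExt (ε δ : ℝ) : openExt ε δ ⊆ closedExt ε δ :=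
  fun _ hz n => ⟨(hz n).1.le, (hz n).2.le⟩

theorem one_lt_norm_iff (z : ℂ) : 1 < ‖z‖ ↔ 1 < z.re ^ 2 + z.im ^ 2 := by
  rw [← one_lt_sq_iff₀ (norm_nonneg z), ← Complex.normSq_eq_norm_sq, Complex.normSq_apply, sq, sq]

theorem one_le_norm_iff (z : ℂ) : 1 ≤ ‖z‖ ↔ 1 ≤ z.re ^ 2 + z.im ^ 2 := by
  rw [← one_le_sq_iff₀ (norm_nonneg z), ← Complex.normSq_eq_norm_sq, Complex.normSq_apply, sq, sq]

theorem norm_eq_one_iff (z : ℂ) : ‖z‖ = 1 ↔ z.re ^ 2 + z.im ^ 2 = 1 := by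
  rw [← sq_eq_sq₀ (norm_nonneg z) zero_le_one, ← Complex.normSq_eq_norm_sq, Complex.normSq_apply,
    one_pow, sq, sq]

variable {ε δ : ℝ}

theorem ctrR_add_one (n : ℤ) : ctrR ε δ (n + 1) = ctrR ε δ n + per δ := by
  apply Complex.ext <;> simp [ctrR, per]; ring

theorem ctrL_add_one (n : ℤ) : ctrL ε δ (n + 1) = ctrL ε δ n + per δ := by
  apply Complex.ext <;> simp [ctrL, per]; ring

theorem add_per_mem_openExt {z : ℂ} : z + per δ ∈ openExt ε δ ↔ z ∈ openExt ε δ := by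
  constructor
  · intro h n
    have := h (n + 1)
    rwa [ctrR_add_one, ctrL_add_one, add_sub_add_right_eq_sub, add_sub_add_right_eq_sub] at this
  · intro h n
    have := h (n - 1)
    rw [← sub_add_cancel n 1, ctrR_add_one, ctrL_add_one, add_sub_add_right_eq_sub,
      add_sub_add_right_eq_sub]
    exact this

theorem add_per_mem_closedExt {z : ℂ} : z + per δ ∈ closedExt ε δ ↔ z ∈ closedExt ε δ := by
  constructor
  · intro h n
    have := h (n + 1)
    rwa [ctrR_add_one, ctrL_add_one, add_sub_add_right_eq_sub, add_sub_add_right_eq_sub] at this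
  · intro h n
    have := h (n - 1)
    rw [← sub_add_cancel n 1, ctrR_add_one, ctrL_add_one, add_sub_add_right_eq_sub,
      add_sub_add_right_eq_sub]
    exact this

/-- Rows are `2 + δ` apart, so a height within half a spacing of one row is at least `(2 + δ) / 2 >
1` away from every other. -/
theorem abs_int_mul_sub_gt (hδ : 0 < δ) {y : ℝ} {n m : ℤ} (hy : |y - n * (2 + δ)| ≤ (2 + δ) / 2)
    (hnm : m ≠ n) : 1 < |y - m * (2 + δ)| := by
  have h1 : (1 : ℝ) ≤ |(n : ℝ) - m| := by
    have : (1 : ℤ) ≤ |n - m| := Int.one_le_abs (sub_ne_zero.mpr hnm.symm)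
    exact_mod_cast this
  have h2 : |(n : ℝ) - m| * (2 + δ) = |(n : ℝ) * (2 + δ) - m * (2 + δ)| := by
    rw [← sub_mul, abs_mul, abs_of_pos (show (0 : ℝ) < 2 + δ by linarith)]
  have h3 : |(n : ℝ) * (2 + δ) - m * (2 + δ)| ≤ |y - n * (2 + δ)| + |y - m * (2 + δ)| := by
    rw [abs_sub_comm y (n * (2 + δ))]
    exact abs_sub_le _ _ _
  nlinarith

theorem one_lt_norm_of_im {z c : ℂ} (h : 1 < |z.im - c.im|) : 1 < ‖z - c‖ :=
  h.trans_le (by simpa using Complex.abs_im_le_norm (z - c))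

theorem one_lt_norm_of_re {z c : ℂ} (h : 1 < |z.re - c.re|) : 1 < ‖z - c‖ :=
  h.trans_le (by simpa using Complex.abs_re_le_norm (z - c))

/-- Only the disks of the nearest row matter. -/
theorem mem_openExt_of_row (hδ : 0 < δ) {z : ℂ} {n : ℤ}
    (hy : |z.im - n * (2 + δ)| ≤ (2 + δ) / 2) (h : 1 < ‖z - ctrL ε δ n‖ ∧ 1 < ‖z - ctrR ε δ n‖) :
    z ∈ openExt ε δ := by
  intro m
  by_cases hm : m = n
  · rw [hm]; exact h
  · have := abs_int_mul_sub_gt hδ hy hm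
    exact ⟨one_lt_norm_of_im this, one_lt_norm_of_im this⟩

theorem exists_row (hδ : 0 < δ) (y : ℝ) : ∃ n : ℤ, |y - n * (2 + δ)| ≤ (2 + δ) / 2 := by
  refine ⟨round (y / (2 + δ)), ?_⟩
  have hP : (0 : ℝ) < 2 + δ := by linarith
  have h1 := abs_sub_round (y / (2 + δ))
  have h2 : y - round (y / (2 + δ)) * (2 + δ) = (y / (2 + δ) - round (y / (2 + δ))) * (2 + δ) := by
    field_simp
  rw [h2, abs_mul, abs_of_pos hP]
  nlinarith

/-- Moving vertically away from the row of centres increases the distance to the disks. -/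
theorem mem_openExt_of_vertical (hδ : 0 < δ) {z w : ℂ} {n : ℤ} (hz : z ∈ closedExt ε δ)
    (hre : w.re = z.re) (him : |z.im - n * (2 + δ)| < |w.im - n * (2 + δ)|)
    (hw : |w.im - n * (2 + δ)| ≤ (2 + δ) / 2) : w ∈ openExt ε δ := by
  have hsq := sq_lt_sq.mpr him
  obtain ⟨h1, h2⟩ := hz n
  refine mem_openExt_of_row hδ hw ⟨?_, ?_⟩
  · rw [one_le_norm_iff] at h1
    rw [one_lt_norm_iff]
    simp only [Complex.sub_re, Complex.sub_im, ctrL, hre] at h1 ⊢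
    linarith
  · rw [one_le_norm_iff] at h2
    rw [one_lt_norm_iff]
    simp only [Complex.sub_re, Complex.sub_im, ctrR, hre] at h2 ⊢
    linarith

theorem mem_openExt_of_midline (hδ : 0 < δ) {z : ℂ} {n : ℤ}
    (h : |z.im - n * (2 + δ)| = (2 + δ) / 2) : z ∈ openExt ε δ :=
  mem_openExt_of_row hδ h.le ⟨one_lt_norm_of_im (by simp only [ctrL]; rw [h]; linarith),
    one_lt_norm_of_im (by simp only [ctrR]; rw [h]; linarith)⟩

/-- The disks occupy only `ε / 2 ≤ |x| ≤ 2 + ε / 2`. -/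
theorem mem_openExt_of_re (hε : 0 < ε) {z : ℂ} (h : z.re = 0 ∨ 3 + ε ≤ |z.re|) :
    z ∈ openExt ε δ := by
  intro n
  rcases h with h | h
  · constructor <;> apply one_lt_norm_of_re <;> simp only [ctrL, ctrR, h]
    · rw [abs_of_pos] <;> linarith
    · rw [abs_of_neg] <;> linarith
  · constructor <;> apply one_lt_norm_of_re <;> simp only [ctrL, ctrR]
    · rcases le_abs.mp h with h | h
      · rw [lt_abs]; left; linarith
      · rw [lt_abs]; right; linarith
    · rcases le_abs.mp h with h | h
      · rw [lt_abs]; left; linarith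
      · rw [lt_abs]; right; linarith

/-- The family is locally finite: a disk that meets the unit ball about `z` has `|n| ≤ |Im z| + 2`.
-/
theorem isClosed_iUnion_disks (hδ : 0 < δ) {c : ℤ → ℂ} (hc : ∀ n, (c n).im = n * (2 + δ)) :
    IsClosed (⋃ n, closedBall (c n) 1) := by
  refine LocallyFinite.isClosed_iUnion (fun z => ⟨ball z 1, ball_mem_nhds z one_pos, ?_⟩)
    fun n => isClosed_closedBall
  refine (Set.finite_Icc (-⌈|z.im| + 2⌉) ⌈|z.im| + 2⌉).subset ?_
  rintro n ⟨w, hw1, hw2⟩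
  rw [mem_closedBall, dist_eq_norm] at hw1
  rw [mem_ball, dist_eq_norm] at hw2
  have h1 := (Complex.abs_im_le_norm (w - c n)).trans hw1
  have h2 := (Complex.abs_im_le_norm (w - z)).trans hw2.le
  rw [Complex.sub_im, hc, abs_le] at h1
  rw [Complex.sub_im, abs_le] at h2
  have h3 : |(n : ℝ)| ≤ |z.im| + 2 := by
    have h4 : |(n : ℝ) * (2 + δ)| ≤ |z.im| + 2 := by
      have := abs_le.mp (le_refl |z.im|)
      rw [abs_le]; constructor <;> linarith
    rw [abs_mul, abs_of_pos (show (0 : ℝ) < 2 + δ by linarith)] at h4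
    nlinarith [abs_nonneg (n : ℝ)]
  have h5 : |(n : ℝ)| ≤ ((⌈|z.im| + 2⌉ : ℤ) : ℝ) := h3.trans (Int.le_ceil _)
  have h6 : |n| ≤ ⌈|z.im| + 2⌉ := by exact_mod_cast h5
  exact abs_le.mp h6

theorem openExt_eq_compl : openExt ε δ =
    ((⋃ n, closedBall (ctrL ε δ n) 1) ∪ ⋃ n, closedBall (ctrR ε δ n) 1)ᶜ := by
  ext z
  simp only [openExt, mem_ofPred_eq, mem_compl_iff, mem_union, mem_iUnion, mem_closedBall,
    dist_eq_norm, not_or, not_exists, not_le, forall_and]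

theorem isOpen_openExt (hδ : 0 < δ) : IsOpen (openExt ε δ) := by
  rw [openExt_eq_compl, isOpen_compl_iff]
  exact (isClosed_iUnion_disks hδ fun n => rfl).union (isClosed_iUnion_disks hδ fun n => rfl)

theorem isClosed_closedExt : IsClosed (closedExt ε δ) := by
  have : closedExt ε δ = ⋂ n : ℤ, {z | 1 ≤ ‖z - ctrL ε δ n‖} ∩ {z | 1 ≤ ‖z - ctrR ε δ n‖} := by
    ext z; simp [closedExt]
  rw [this]
  refine isClosed_iInter fun n => IsClosed.inter ?_ ?_
  · exact isClosed_le continuous_const (by fun_prop)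
  · exact isClosed_le continuous_const (by fun_prop)

/-- A small vertical move away from the nearest row of centres leaves all the closed disks. This
density carries identities from the open exterior to the circles by continuity. -/
theorem closedExt_subset_closure (hδ : 0 < δ) : closedExt ε δ ⊆ closure (openExt ε δ) := by
  intro z hz
  obtain ⟨n, hn⟩ := exists_row hδ z.im
  rcases hn.eq_or_lt with h | h
  · exact subset_closure (mem_openExt_of_midline hδ h)
  obtain ⟨σ, hσ, hσt⟩ : ∃ σ : ℝ, |σ| = 1 ∧ 0 ≤ σ * (z.im - n * (2 + δ)) := by
    rcases le_total 0 (z.im - n * (2 + δ)) with h0 | h0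
    · exact ⟨1, by simp, by linarith⟩
    · exact ⟨-1, by simp, by linarith⟩
  have hσ2 : σ ^ 2 = 1 := by rw [← sq_abs, hσ, one_pow]
  have hlim : Tendsto (fun s : ℝ => z + ((σ * s : ℝ) : ℂ) * Complex.I) (𝓝[>] 0) (𝓝 z) := by
    refine Tendsto.mono_left ?_ nhdsWithin_le_nhds
    have : Continuous fun s : ℝ => z + ((σ * s : ℝ) : ℂ) * Complex.I := by fun_prop
    simpa using this.tendsto 0
  refine mem_closure_of_tendsto hlim ?_
  have hsmall : ∀ᶠ s : ℝ in 𝓝[>] 0, s < (2 + δ) / 2 - |z.im - n * (2 + δ)| :=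
    nhdsWithin_le_nhds (gt_mem_nhds (by linarith))
  filter_upwards [self_mem_nhdsWithin, hsmall] with s hs hs2
  have hs : 0 < s := hs
  refine mem_openExt_of_vertical hδ (n := n) hz (by simp) ?_ ?_
  · simp only [Complex.add_im, Complex.mul_im, Complex.ofReal_re, Complex.I_im, mul_one,
      Complex.ofReal_im, Complex.I_re, mul_zero, add_zero]
    rw [← sq_lt_sq]
    nlinarith [mul_nonneg hσt hs.le, mul_pos hs hs]
  · simp only [Complex.add_im, Complex.mul_im, Complex.ofReal_re, Complex.I_im, mul_one,
      Complex.ofReal_im, Complex.I_re, mul_zero, add_zero]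
    have : |z.im + σ * s - n * (2 + δ)| ≤ |z.im - n * (2 + δ)| + s := by
      calc _ = |(z.im - n * (2 + δ)) + σ * s| := by ring_nf
        _ ≤ _ := abs_add_le _ _
        _ = _ := by rw [abs_mul, hσ, one_mul, abs_of_pos hs]
    linarith

theorem mem_segment_coords {z a b : ℂ} (h : z ∈ segment ℝ a b) :
    ∃ t : ℝ, 0 ≤ t ∧ t ≤ 1 ∧ z.re = a.re + t * (b.re - a.re) ∧ z.im = a.im + t * (b.im - a.im) := by
  rw [segment_eq_image'] at h
  obtain ⟨t, ht, rfl⟩ := h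
  exact ⟨t, ht.1, ht.2, by simp, by simp⟩

/-- Every point is joined to `0` by three segments: vertically away from its row to a line midway
between two rows, along that line to the imaginary axis, and along the axis. None of them meets a
closed disk. -/
theorem isPreconnected_openExt (hε : 0 < ε) (hδ : 0 < δ) : IsPreconnected (openExt ε δ) := by
  refine isPreconnected_of_forall 0 fun z hz => ?_
  obtain ⟨n, hn⟩ := exists_row hδ z.im
  obtain ⟨σ, hσ, hσt⟩ : ∃ σ : ℝ, (σ = 1 ∨ σ = -1) ∧ 0 ≤ σ * (z.im - n * (2 + δ)) := by
    rcases le_total 0 (z.im - n * (2 + δ)) with h0 | h0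
    · exact ⟨1, by simp, by linarith⟩
    · exact ⟨-1, by simp, by linarith⟩
  set y : ℝ := n * (2 + δ) + σ * ((2 + δ) / 2) with hy
  have hyn : |y - n * (2 + δ)| = (2 + δ) / 2 := by
    rw [hy, add_sub_cancel_left, abs_mul]
    rcases hσ with rfl | rfl <;> simp <;> linarith
  set a : ℂ := ⟨z.re, y⟩
  set b : ℂ := ⟨0, y⟩
  refine ⟨segment ℝ 0 b ∪ (segment ℝ b a ∪ segment ℝ a z), ?_, Or.inl (left_mem_segment ℝ _ _),
    Or.inr (Or.inr (right_mem_segment ℝ _ _)), ?_⟩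
  · rintro w (hw | hw | hw)
    · obtain ⟨t, -, -, h1, -⟩ := mem_segment_coords hw
      exact mem_openExt_of_re hε (Or.inl (by simp [h1, b]))
    · obtain ⟨t, -, -, -, h1⟩ := mem_segment_coords hw
      have : w.im = y := by simp [h1, a, b]
      exact mem_openExt_of_midline hδ (n := n) (by rw [this, hyn])
    · obtain ⟨t, ht0, ht1, h1, h2⟩ := mem_segment_coords hw
      have hre : w.re = z.re := by simp [h1, a]
      have him : w.im - n * (2 + δ) = t * (z.im - n * (2 + δ)) + (1 - t) * (y - n * (2 + δ)) := by
        rw [h2]; simp only [a]; ring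
      rcases le_or_gt |w.im - n * (2 + δ)| |z.im - n * (2 + δ)| with hle | hlt
      · have hge : |z.im - n * (2 + δ)| ≤ |w.im - n * (2 + δ)| := by
          rw [him, hy]
          rcases hσ with rfl | rfl
          · rw [abs_of_nonneg (by linarith)] at hn ⊢
            refine le_trans ?_ (le_abs_self _)
            nlinarith
          · rw [abs_of_nonpos (by linarith)] at hn ⊢
            refine le_trans ?_ (neg_le_abs _)
            nlinarith
        have heq := sq_eq_sq_iff_abs_eq_abs _ _ |>.mpr (le_antisymm hle hge)
        obtain ⟨h3, h4⟩ := hz n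
        refine mem_openExt_of_row hδ (hle.trans hn) ⟨?_, ?_⟩
        · rw [one_lt_norm_iff] at h3 ⊢
          simp only [Complex.sub_re, Complex.sub_im, ctrL, hre] at h3 ⊢
          linarith
        · rw [one_lt_norm_iff] at h4 ⊢
          simp only [Complex.sub_re, Complex.sub_im, ctrR, hre] at h4 ⊢
          linarith
      · refine mem_openExt_of_vertical hδ (openExt_subset_closedExt _ _ hz) hre hlt ?_
        rw [him]
        refine (abs_add_le _ _).trans ?_
        rw [abs_mul, abs_mul, hyn, abs_of_nonneg ht0, abs_of_nonneg (sub_nonneg.mpr ht1)]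
        nlinarith
  · refine IsPreconnected.union b (right_mem_segment ℝ _ _) (Or.inl (left_mem_segment ℝ _ _))
      (convex_segment _ _).isPreconnected ?_
    exact IsPreconnected.union a (right_mem_segment ℝ _ _) (left_mem_segment ℝ _ _)
      (convex_segment _ _).isPreconnected (convex_segment _ _).isPreconnected

/-! ### Solutions of the conductor problem in the complex plane -/

/-- The perfect conductor problem in complex coordinates; `cL` and `cR` are the potentials of the
disks of row `0`. -/
structure PlaneSolution (ε δ : ℝ) (H u : ℂ → ℝ) (cL cR : ℝ) : Prop where
  harmonic_background : HarmonicOnNhd H univ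
  periodic_background : ∀ z, fderiv ℝ H (z + per δ) = fderiv ℝ H z
  harmonic : HarmonicOnNhd u (openExt ε δ)
  cont : ContinuousOn u (closedExt ε δ)
  left : ∀ z, ‖z - ctrL ε δ 0‖ = 1 → u z = cL
  right : ∀ z, ‖z - ctrR ε δ 0‖ = 1 → u z = cR
  flux : ∃ g : ℝ → ℝ,
    (∀ θ : ℝ, HasDerivWithinAt (fun t : ℝ => u (ctrR ε δ 0 + (1 - t : ℝ) * Complex.exp (θ * Complex.I)))
      (g θ) (Iic 0) 0) ∧
    IntervalIntegrable g volume 0 (2 * Real.pi) ∧ ∫ θ in (0 : ℝ)..(2 * Real.pi), g θ = 0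
  energy : ∫⁻ z in {z : ℂ | |z.im| < (2 + δ) / 2 ∧ 4 < |z.re|},
    ‖fderiv ℝ (fun w => u w - H w) z‖ₑ ^ 2 < ∞
  periodic : ∀ z ∈ openExt ε δ, fderiv ℝ u (z + per δ) = fderiv ℝ u z

/-- The difference between `f` and its translate has zero derivative on a connected open set. -/
theorem exists_jump_of_periodic_fderiv {s : Set ℂ} {f : ℂ → ℝ} (hs : IsOpen s)
    (hc : IsPreconnected s) (hf : ∀ z ∈ s, DifferentiableAt ℝ f z)
    (hp : ∀ z ∈ s, z + per δ ∈ s) (hper : ∀ z ∈ s, fderiv ℝ f (z + per δ) = fderiv ℝ f z) :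
    ∃ κ, ∀ z ∈ s, f (z + per δ) = f z + κ := by
  have hd : ∀ z ∈ s, HasFDerivAt (fun z => f (z + per δ) - f z) (0 : ℂ →L[ℝ] ℝ) z := by
    intro z hz
    have h1 : HasFDerivAt (fun z => f (z + per δ)) (fderiv ℝ f (z + per δ)) z := by
      rw [hasFDerivAt_comp_add_right]
      exact (hf _ (hp z hz)).hasFDerivAt
    have h2 := h1.sub (hf z hz).hasFDerivAt
    rwa [hper z hz, sub_self] at h2
  obtain ⟨κ, hκ⟩ := hs.exists_is_const_of_fderiv_eq_zero (𝕜 := ℝ) hc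
    (fun z hz => (hd z hz).differentiableAt.differentiableWithinAt) fun z hz => (hd z hz).fderiv
  exact ⟨κ, fun z hz => by linarith [hκ z hz]⟩

variable {H u : ℂ → ℝ} {cL cR : ℝ}

theorem PlaneSolution.exists_jump (h : PlaneSolution ε δ H u cL cR) (hε : 0 < ε) (hδ : 0 < δ) :
    ∃ κ, ∀ z ∈ closedExt ε δ, u (z + per δ) = u z + κ := by
  obtain ⟨κ, hκ⟩ := exists_jump_of_periodic_fderiv (isOpen_openExt hδ)
    (isPreconnected_openExt hε hδ) (fun z hz => (h.harmonic z hz).1.differentiableAt two_ne_zero)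
    (fun z hz => add_per_mem_openExt.mpr hz) h.periodic
  refine ⟨κ, ?_⟩
  refine EqOn.of_subset_closure (s := openExt ε δ) hκ ?_ (h.cont.add continuousOn_const)
    (openExt_subset_closedExt _ _) (closedExt_subset_closure hδ)
  exact h.cont.comp (by fun_prop) fun z hz => add_per_mem_closedExt.mpr hz

theorem PlaneSolution.exists_jump_background (h : PlaneSolution ε δ H u cL cR) :
    ∃ κ, ∀ z, H (z + per δ) = H z + κ := by
  obtain ⟨κ, hκ⟩ := exists_jump_of_periodic_fderiv isOpen_univ isPreconnected_univ
    (fun z hz => (h.harmonic_background z hz).1.differentiableAt two_ne_zero)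
    (fun z _ => mem_univ _) fun z _ => h.periodic_background z
  exact ⟨κ, fun z => hκ z (mem_univ _)⟩

end TwoRows

namespace TwoRows

open InnerProductSpace Metric Filter Topology

/-! ### Behaviour at infinity -/

theorem volume_im_eq (a : ℝ) : volume {z : ℂ | z.im = a} = 0 := by
  have h1 : {z : ℂ | z.im = a} = Complex.measurableEquivRealProd ⁻¹' (univ ×ˢ {a}) := by
    ext z; simp [Complex.measurableEquivRealProd]
  rw [h1, Complex.volume_preserving_equiv_real_prod.measure_preimage
    (MeasurableSet.univ.prod (measurableSet_singleton a)).nullMeasurableSet,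
    Measure.volume_eq_prod, Measure.prod_prod]
  simp

/-- Continuity from above of the measure with density `F`, which is finite on `S`, along truncations
with empty intersection. -/
theorem exists_tail_le {F : ℂ → ℝ≥0∞} {S : Set ℂ} (hS : MeasurableSet S)
    (hF : ∫⁻ z in S, F z < ∞) {s : ℝ≥0∞} (hs : 0 < s) (X₀ : ℝ) :
    ∃ X ≥ X₀, ∫⁻ z in S ∩ {z | X < |z.re|}, F z ≤ s := by
  set ν : Measure ℂ := volume.withDensity F
  have hm : ∀ n : ℕ, MeasurableSet (S ∩ {z : ℂ | X₀ + n < |z.re|}) := fun n =>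
    hS.inter (measurableSet_lt measurable_const (by fun_prop))
  have hanti : Antitone fun n : ℕ => S ∩ {z : ℂ | X₀ + n < |z.re|} := by
    intro n m hnm z hz
    refine ⟨hz.1, ?_⟩
    have : (n : ℝ) ≤ m := by exact_mod_cast hnm
    have h2 : X₀ + m < |z.re| := hz.2
    change X₀ + n < |z.re|
    linarith
  have hlim := tendsto_measure_iInter_atTop (μ := ν) (fun n => (hm n).nullMeasurableSet) hanti
    ⟨0, by
      refine ne_of_lt (lt_of_le_of_lt ?_ hF)
      rw [withDensity_apply _ (hm 0)]
      exact lintegral_mono_set inter_subset_left⟩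
  have hempty : ⋂ n : ℕ, S ∩ {z : ℂ | X₀ + n < |z.re|} = ∅ := by
    rw [eq_empty_iff_forall_notMem]
    intro z hz
    obtain ⟨n, hn⟩ := exists_nat_gt (|z.re| - X₀)
    have := (mem_iInter.mp hz n).2
    change X₀ + n < |z.re| at this
    linarith
  rw [hempty, measure_empty] at hlim
  obtain ⟨n, hn⟩ := (hlim.eventually (ge_mem_nhds hs)).exists
  refine ⟨X₀ + n, by simp, ?_⟩
  rwa [Function.comp_apply, withDensity_apply _ (hm n)] at hn

variable {ε δ : ℝ} {H u : ℂ → ℝ} {cL cR : ℝ}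

namespace PlaneSolution

theorem differentiableAt_sub (h : PlaneSolution ε δ H u cL cR) {z : ℂ} (hz : z ∈ openExt ε δ) :
    HasFDerivAt (fun w => u w - H w) (fderiv ℝ u z - fderiv ℝ H z) z :=
  ((h.harmonic z hz).1.differentiableAt two_ne_zero).hasFDerivAt.sub
    ((h.harmonic_background z trivial).1.differentiableAt two_ne_zero).hasFDerivAt

theorem harmonic_sub (h : PlaneSolution ε δ H u cL cR) :
    HarmonicOnNhd (fun w => u w - H w) (openExt ε δ) := fun z hz =>
  (h.harmonic z hz).sub (h.harmonic_background z trivial)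

theorem fderiv_sub_add_per (h : PlaneSolution ε δ H u cL cR) {z : ℂ} (hz : z ∈ openExt ε δ) :
    fderiv ℝ (fun w => u w - H w) (z + per δ) = fderiv ℝ (fun w => u w - H w) z := by
  rw [(h.differentiableAt_sub hz).fderiv,
    (h.differentiableAt_sub (add_per_mem_openExt.mpr hz)).fderiv, h.periodic z hz,
    h.periodic_background z]

/-- The energy in three cells is three times the energy in one. -/
theorem energy_three_cells (h : PlaneSolution ε δ H u cL cR) (hε : 0 < ε) (hε1 : ε < 1)
    {X : ℝ} (hX : 4 ≤ X) :
    ∫⁻ z in {z : ℂ | |z.im| < 3 * (2 + δ) / 2} ∩ {z | X < |z.re|},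
      ‖fderiv ℝ (fun w => u w - H w) z‖ₑ ^ 2 ≤
    3 * ∫⁻ z in {z : ℂ | |z.im| < (2 + δ) / 2 ∧ 4 < |z.re|} ∩ {z | X < |z.re|},
      ‖fderiv ℝ (fun w => u w - H w) z‖ₑ ^ 2 := by
  set F : ℂ → ℝ≥0∞ := fun z => ‖fderiv ℝ (fun w => u w - H w) z‖ₑ ^ 2 with hF
  have hFper : ∀ z : ℂ, X < |z.re| → F (z + per δ) = F z := by
    intro z hz
    simp only [hF]
    rw [h.fderiv_sub_add_per (mem_openExt_of_re hε (Or.inr (by linarith)))]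
  set A : ℝ → Set ℂ := fun j => {z : ℂ | |z.im - j * (2 + δ)| < (2 + δ) / 2} ∩ {z | X < |z.re|}
    with hA
  have hAm : ∀ j, MeasurableSet (A j) := fun j =>
    (measurableSet_lt (by fun_prop) measurable_const).inter
      (measurableSet_lt measurable_const (by fun_prop))
  have hshift : ∀ j, ∫⁻ z in A (j + 1), F z = ∫⁻ z in A j, F z := by
    intro j
    have h1 := (measurePreserving_add_right (volume : Measure ℂ) (per δ)).setLIntegral_comp_preimage_emb
      (measurableEmbedding_addRight (per δ)) F (A (j + 1))
    rw [← h1]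
    have h2 : (fun z => z + per δ) ⁻¹' A (j + 1) = A j := by
      ext z
      simp only [hA, mem_preimage, mem_inter_iff, mem_ofPred_eq, Complex.add_im, Complex.add_re, per,
        add_zero]
      rw [show z.im + (2 + δ) - (j + 1) * (2 + δ) = z.im - j * (2 + δ) by ring]
    rw [h2]
    exact setLIntegral_congr_fun (hAm j) fun z hz => hFper z hz.2
  have h0 : A 0 = {z : ℂ | |z.im| < (2 + δ) / 2 ∧ 4 < |z.re|} ∩ {z | X < |z.re|} := by
    ext z
    simp only [hA, mem_inter_iff, mem_ofPred_eq, zero_mul, sub_zero]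
    exact ⟨fun hz => ⟨⟨hz.1, by linarith [hz.2]⟩, hz.2⟩, fun hz => ⟨hz.1.1, hz.2⟩⟩
  have h1 : ∫⁻ z in A 1, F z = ∫⁻ z in A 0, F z := by simpa using hshift 0
  have h2 : ∫⁻ z in A (-1), F z = ∫⁻ z in A 0, F z := by simpa using (hshift (-1)).symm
  -- Three translates of the cell cover the tall strip except for two horizontal lines, which are
  -- null.
  have hcover : {z : ℂ | |z.im| < 3 * (2 + δ) / 2} ∩ {z | X < |z.re|} ⊆
      ((A 0 ∪ A 1) ∪ A (-1)) ∪ ({z | z.im = (2 + δ) / 2} ∪ {z | z.im = -((2 + δ) / 2)}) := by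
    rintro z ⟨hz1, hz2⟩
    simp only [mem_ofPred_eq, abs_lt] at hz1
    simp only [hA, mem_union, mem_inter_iff, mem_ofPred_eq, abs_lt]
    rcases lt_trichotomy z.im ((2 + δ) / 2) with h | h | h
    · rcases lt_trichotomy z.im (-((2 + δ) / 2)) with h' | h' | h'
      · refine Or.inl (Or.inr ⟨⟨?_, ?_⟩, hz2⟩) <;> linarith [hz1.1]
      · exact Or.inr (Or.inr h')
      · refine Or.inl (Or.inl (Or.inl ⟨⟨?_, ?_⟩, hz2⟩)) <;> linarith
    · exact Or.inr (Or.inl h)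
    · refine Or.inl (Or.inl (Or.inr ⟨⟨?_, ?_⟩, hz2⟩)) <;> linarith [hz1.2]
  calc _ ≤ _ := lintegral_mono_set hcover
    _ ≤ (∫⁻ z in A 0, F z) + (∫⁻ z in A 1, F z) + (∫⁻ z in A (-1), F z) + 0 := by
        refine (lintegral_union_le _ _ _).trans (add_le_add ?_ (le_of_eq ?_))
        · exact (lintegral_union_le _ _ _).trans
            (add_le_add (lintegral_union_le _ _ _) le_rfl)
        · exact setLIntegral_measure_zero _ _
            (measure_union_null (volume_im_eq _) (volume_im_eq _))
    _ = 3 * ∫⁻ z in A 0, F z := by rw [h1, h2]; ring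
    _ = _ := by rw [h0]

/-- The gradient of `u - H` tends to zero at infinity. -/
theorem exists_fderiv_small (h : PlaneSolution ε δ H u cL cR) (hε : 0 < ε) (hε1 : ε < 1)
    (hδ : 0 < δ) {s : ℝ} (hs : 0 < s) : ∃ X ≥ 5, ∀ z : ℂ, X ≤ |z.re| → |z.im| ≤ 2 + δ →
      ‖fderiv ℝ (fun w => u w - H w) z‖ ≤ s := by
  have hm : MeasurableSet {z : ℂ | |z.im| < (2 + δ) / 2 ∧ 4 < |z.re|} :=
    MeasurableSet.inter (s₁ := {z : ℂ | |z.im| < (2 + δ) / 2}) (s₂ := {z : ℂ | 4 < |z.re|})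
      (measurableSet_lt (by fun_prop) measurable_const)
      (measurableSet_lt measurable_const (by fun_prop))
  -- The factor `1/3` pays for the three cells, which contain the unit disks about all points with
  -- `|Im z| ≤ 2 + δ`; the `s / 2` pays for the factor in `norm_fderiv_le_of_energy_le`.
  obtain ⟨X, hX, hE⟩ := exists_tail_le hm h.energy
    (s := ENNReal.ofReal ((s / 2) ^ 2 / 3)) (by rw [ENNReal.ofReal_pos]; positivity) 4
  refine ⟨X + 1, by linarith, fun z hz hz2 => ?_⟩
  have hre : ∀ w ∈ ball z 1, X < |w.re| := by
    intro w hw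
    rw [mem_ball, dist_eq_norm] at hw
    have h1 := (Complex.abs_re_le_norm (w - z)).trans_lt hw
    rw [Complex.sub_re] at h1
    have h2 := abs_sub_abs_le_abs_sub z.re w.re
    rw [abs_sub_comm] at h2
    linarith
  have him : ∀ w ∈ ball z 1, |w.im| < 3 * (2 + δ) / 2 := by
    intro w hw
    rw [mem_ball, dist_eq_norm] at hw
    have h1 := (Complex.abs_im_le_norm (w - z)).trans_lt hw
    rw [Complex.sub_im] at h1
    have h2 := abs_sub_abs_le_abs_sub w.im z.im
    linarith
  have key := norm_fderiv_le_of_energy_le (f := fun w => u w - H w) (p := z) (s := s / 2)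
    (by positivity)
    (fun w hw => h.harmonic_sub w (mem_openExt_of_re hε (Or.inr (by linarith [hre w hw])))) ?_
  · linarith
  · calc _ ≤ _ := lintegral_mono_set fun w hw => show w ∈ {z : ℂ | |z.im| < 3 * (2 + δ) / 2} ∩
          {z | X < |z.re|} from ⟨him w hw, hre w hw⟩
      _ ≤ _ := h.energy_three_cells hε hε1 hX
      _ ≤ 3 * ENNReal.ofReal ((s / 2) ^ 2 / 3) := by gcongr
      _ = ENNReal.ofReal ((s / 2) ^ 2) := by
          rw [show (3 : ℝ≥0∞) = ENNReal.ofReal 3 by simp, ← ENNReal.ofReal_mul (by norm_num)]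
          congr 1; ring

/-- The background and the solution have the same jump over a period. -/
theorem exists_common_jump (h : PlaneSolution ε δ H u cL cR) (hε : 0 < ε) (hε1 : ε < 1)
    (hδ : 0 < δ) : ∃ κ, (∀ z ∈ closedExt ε δ, u (z + per δ) = u z + κ) ∧
      ∀ z, H (z + per δ) = H z + κ := by
  obtain ⟨κ, hκ⟩ := h.exists_jump hε hδ
  obtain ⟨κ', hκ'⟩ := h.exists_jump_background
  suffices hz : κ - κ' = 0 by
    refine ⟨κ, hκ, fun z => ?_⟩
    rw [hκ', sub_eq_zero.mp hz]
  -- Along one vertical period far to the right, `u - H` changes by exactly `κ - κ'`, while its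
  -- gradient there is at most `s`.
  have hb : ∀ s : ℝ, 0 < s → |κ - κ'| ≤ s * (2 + δ) := by
    intro s hs
    obtain ⟨X, hX, hgrad⟩ := h.exists_fderiv_small hε hε1 hδ hs
    have hseg : Convex ℝ (segment ℝ (X : ℂ) (X + per δ)) := convex_segment _ _
    have hcoord : ∀ z ∈ segment ℝ (X : ℂ) (X + per δ), z.re = X ∧ |z.im| ≤ 2 + δ := by
      intro z hz
      obtain ⟨t, h0, h1, h2, h3⟩ := mem_segment_coords hz
      simp only [Complex.add_re, Complex.ofReal_re, Complex.add_im, Complex.ofReal_im, per] at h2 h3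
      refine ⟨by rw [h2]; ring, ?_⟩
      rw [h3, abs_le]
      constructor <;> nlinarith
    have hmem : ∀ z ∈ segment ℝ (X : ℂ) (X + per δ), z ∈ openExt ε δ := fun z hz =>
      mem_openExt_of_re hε (Or.inr (by
        rw [(hcoord z hz).1, abs_of_nonneg (by linarith)]; linarith))
    have hmv := hseg.norm_image_sub_le_of_norm_hasFDerivWithin_le (C := s)
      (fun z hz => (h.differentiableAt_sub (hmem z hz)).hasFDerivWithinAt)
      (fun z hz => by
        rw [← (h.differentiableAt_sub (hmem z hz)).fderiv]
        exact hgrad z (by rw [(hcoord z hz).1]; exact le_abs_self _) (hcoord z hz).2)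
      (left_mem_segment ℝ _ _) (right_mem_segment ℝ _ _)
    have hX0 : (X : ℂ) ∈ closedExt ε δ :=
      openExt_subset_closedExt _ _ (hmem _ (left_mem_segment ℝ _ _))
    rw [hκ _ hX0, hκ', add_sub_cancel_left, Real.norm_eq_abs] at hmv
    have hn : ‖per δ‖ = 2 + δ := by
      have : per δ = ((2 + δ : ℝ) : ℂ) * Complex.I := by
        apply Complex.ext <;> simp [per]
      rw [this, norm_mul, Complex.norm_I, mul_one, Complex.norm_real, Real.norm_eq_abs,
        abs_of_pos (by linarith)]
    rw [hn] at hmv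
    convert hmv using 2
    ring
  by_contra hne
  have hpos : 0 < |κ - κ'| := abs_pos.mpr hne
  have := hb (|κ - κ'| / (2 * (2 + δ))) (by positivity)
  have h2 : |κ - κ'| / (2 * (2 + δ)) * (2 + δ) = |κ - κ'| / 2 := by field_simp
  linarith

end PlaneSolution

end TwoRows

namespace TwoRows

open InnerProductSpace Metric Filter Topology

/-! ### The maximum principle on the periodic exterior domain -/

variable {ε δ : ℝ}

/-- A periodic harmonic function that grows linearly at both ends: the logarithm of the modulus of
this function. -/
noncomputable def sinhProfile (ε δ : ℝ) (z : ℂ) : ℂ :=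
  Complex.exp ((Real.pi / (2 + δ) : ℝ) * (z - ctrR ε δ 0)) -
    Complex.exp (-((Real.pi / (2 + δ) : ℝ) * (z - ctrR ε δ 0)))

/-- The zeros are exactly the centres of the right-hand disks, which lie outside the exterior
domain. -/
theorem sinhProfile_ne_zero (hδ : 0 < δ) {z : ℂ} (hz : z ∈ closedExt ε δ) :
    sinhProfile ε δ z ≠ 0 := by
  intro h
  rw [sinhProfile, sub_eq_zero, Complex.exp_eq_exp_iff_exists_int] at h
  obtain ⟨n, hn⟩ := h
  have hP : (2 + δ : ℝ) ≠ 0 := by linarith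
  have hP' : ((2 + δ : ℝ) : ℂ) ≠ 0 := by exact_mod_cast hP
  have hpi : (Real.pi : ℂ) ≠ 0 := by exact_mod_cast Real.pi_ne_zero
  have h2 : z - ctrR ε δ 0 = n * ((2 + δ : ℝ) : ℂ) * Complex.I := by
    have h3 : 2 * ((Real.pi / (2 + δ) : ℝ) : ℂ) * (z - ctrR ε δ 0) =
        n * (2 * Real.pi * Complex.I) := by linear_combination hn
    rw [Complex.ofReal_div] at h3
    field_simp at h3
    rw [h3]; ring
  have h3 := (hz n).2
  have h4 : z - ctrR ε δ n = 0 := by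
    have : ctrR ε δ n = ctrR ε δ 0 + n * ((2 + δ : ℝ) : ℂ) * Complex.I := by
      apply Complex.ext <;> simp [ctrR]
    rw [this, ← h2]; ring
  rw [h4, norm_zero] at h3
  linarith

/-- A period adds `iπ` to the argument of the exponential, which only changes the sign. -/
theorem norm_sinhProfile_add_per (hδ : 0 < δ) (z : ℂ) :
    ‖sinhProfile ε δ (z + per δ)‖ = ‖sinhProfile ε δ z‖ := by
  have h1 : ((Real.pi / (2 + δ) : ℝ) : ℂ) * (z + per δ - ctrR ε δ 0) =
      ((Real.pi / (2 + δ) : ℝ) : ℂ) * (z - ctrR ε δ 0) + Real.pi * Complex.I := by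
    have hP : ((2 + δ : ℝ) : ℂ) ≠ 0 := by exact_mod_cast (show (2 + δ : ℝ) ≠ 0 by linarith)
    have h2 : per δ = ((2 + δ : ℝ) : ℂ) * Complex.I := by
      apply Complex.ext <;> simp [per]
    rw [h2, Complex.ofReal_div]
    field_simp
    ring
  have h2 : sinhProfile ε δ (z + per δ) = -sinhProfile ε δ z := by
    unfold sinhProfile
    rw [h1, neg_add, Complex.exp_add, Complex.exp_add, Complex.exp_neg (Real.pi * Complex.I),
      Complex.exp_pi_mul_I, inv_neg, inv_one]
    ring
  rw [h2, norm_neg]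

/-- With `t` the real part of the exponent, the modulus is at least `e^|t| - e^(-|t|) ≥ e^(|t| - 1)`
once `|t| ≥ 1`; the centre has real part less than `2`. -/
theorem le_log_norm_sinhProfile (hε : 0 < ε) (hε1 : ε < 1) {z : ℂ} (hδ : 0 < δ)
    (h : 1 ≤ Real.pi / (2 + δ) * (|z.re| - 2)) :
    Real.pi / (2 + δ) * (|z.re| - 2) - 1 ≤ Real.log ‖sinhProfile ε δ z‖ := by
  set k : ℝ := Real.pi / (2 + δ) with hk
  have hk0 : 0 < k := by have := Real.pi_pos; positivity
  set t : ℝ := k * (z.re - (1 + ε / 2)) with ht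
  have hre : (((k : ℝ) : ℂ) * (z - ctrR ε δ 0)).re = t := by simp [ctrR, ht]
  have htabs : k * (|z.re| - 2) ≤ |t| := by
    rw [ht, abs_mul, abs_of_pos hk0]
    have := abs_sub_abs_le_abs_sub z.re (1 + ε / 2)
    rw [abs_of_pos (show (0 : ℝ) < 1 + ε / 2 by linarith)] at this
    exact mul_le_mul_of_nonneg_left (by linarith) hk0.le
  have hn : Real.exp |t| - Real.exp (-|t|) ≤ ‖sinhProfile ε δ z‖ := by
    have h1 : ‖Complex.exp ((k : ℂ) * (z - ctrR ε δ 0))‖ = Real.exp t := by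
      rw [Complex.norm_exp, hre]
    have h2 : ‖Complex.exp (-((k : ℂ) * (z - ctrR ε δ 0)))‖ = Real.exp (-t) := by
      rw [Complex.norm_exp, Complex.neg_re, hre]
    have h3 := norm_sub_norm_le (Complex.exp ((k : ℂ) * (z - ctrR ε δ 0)))
      (Complex.exp (-((k : ℂ) * (z - ctrR ε δ 0))))
    have h4 := norm_sub_norm_le (Complex.exp (-((k : ℂ) * (z - ctrR ε δ 0))))
      (Complex.exp ((k : ℂ) * (z - ctrR ε δ 0)))
    rw [norm_sub_rev] at h4
    rw [h1, h2] at h3 h4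
    unfold sinhProfile
    rcases abs_cases t with ⟨h5, -⟩ | ⟨h5, -⟩ <;> rw [h5]
    · exact h3
    · rw [neg_neg]; exact h4
  have hexp : Real.exp (|t| - 1) ≤ Real.exp |t| - Real.exp (-|t|) := by
    have h1 : 1 ≤ |t| := h.trans htabs
    have h2 : Real.exp (|t| - 1) ≤ Real.exp |t| / 2 := by
      have h3 : Real.exp |t| = Real.exp (|t| - 1) * Real.exp 1 := by rw [← Real.exp_add]; ring_nf
      have h4 := Real.add_one_le_exp (1 : ℝ)
      have h5 := Real.exp_pos (|t| - 1)
      rw [h3]; nlinarith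
    have h6 : Real.exp (-|t|) ≤ Real.exp (|t| - 1) := Real.exp_le_exp.mpr (by linarith)
    linarith
  have := Real.log_le_log (Real.exp_pos _) (hexp.trans hn)
  rw [Real.log_exp] at this
  linarith

theorem harmonicAt_log_sinhProfile (hδ : 0 < δ) {z : ℂ} (hz : z ∈ closedExt ε δ) :
    HarmonicAt (fun z => Real.log ‖sinhProfile ε δ z‖) z := by
  refine AnalyticAt.harmonicAt_log_norm ?_ (sinhProfile_ne_zero hδ hz)
  have : Differentiable ℂ (sinhProfile ε δ) := by unfold sinhProfile; fun_prop
  exact this.analyticAt z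

theorem int_mul_per_im (n : ℤ) : ((n : ℂ) * per δ).im = n * (2 + δ) := by simp [per]

theorem add_int_per_mem_closedExt {z : ℂ} (hz : z ∈ closedExt ε δ) (n : ℤ) :
    z + n * per δ ∈ closedExt ε δ := by
  induction n with
  | zero => simpa using hz
  | succ n ih => push_cast at ih ⊢; rw [add_mul, ← add_assoc, one_mul]; exact add_per_mem_closedExt.mpr ih
  | pred n ih =>
    rw [← add_per_mem_closedExt]
    convert ih using 1
    push_cast; ring

theorem apply_add_int_per {f : ℂ → ℝ} {κ : ℝ} (hf : ∀ z ∈ closedExt ε δ, f (z + per δ) = f z + κ)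
    {z : ℂ} (hz : z ∈ closedExt ε δ) (n : ℤ) : f (z + n * per δ) = f z + n * κ := by
  induction n with
  | zero => simp
  | succ n ih =>
    have := hf _ (add_int_per_mem_closedExt hz n)
    push_cast at ih this ⊢
    rw [add_mul, ← add_assoc, one_mul, this, ih]; ring
  | pred n ih =>
    have := hf _ (add_int_per_mem_closedExt hz (-n - 1))
    have h2 : z + ((-n - 1 : ℤ) : ℂ) * per δ + per δ = z + ((-n : ℤ) : ℂ) * per δ := by
      push_cast; ring
    rw [h2, ih] at this
    push_cast at this ⊢
    linarith

/-- A periodic harmonic function with sublinear growth is bounded by its boundary values on the disks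
of row `0`. -/
theorem le_of_sublinear (hε : 0 < ε) (hε1 : ε < 1) (hδ : 0 < δ) {f : ℂ → ℝ} {m : ℝ}
    (hf : HarmonicOnNhd f (openExt ε δ)) (hc : ContinuousOn f (closedExt ε δ))
    (hper : ∀ z ∈ closedExt ε δ, f (z + per δ) = f z)
    (hL : ∀ z, ‖z - ctrL ε δ 0‖ = 1 → f z ≤ m) (hR : ∀ z, ‖z - ctrR ε δ 0‖ = 1 → f z ≤ m)
    (hgrowth : ∀ s : ℝ, 0 < s → ∃ C X₀ : ℝ, ∀ z : ℂ, X₀ ≤ |z.re| → |z.im| ≤ 2 + δ →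
      f z ≤ C + s * |z.re|) :
    ∀ z ∈ closedExt ε δ, f z ≤ m := by
  have hint : ∀ z ∈ closedExt ε δ, ∀ n : ℤ, f (z + n * per δ) = f z := fun z hz n => by
    rw [apply_add_int_per (f := f) (κ := 0) (fun z hz => by rw [hper z hz, add_zero]) hz n, mul_zero,
      add_zero]
  -- Such a point lies on some circle, and a translation by periods brings it to row `0`.
  have hbdry : ∀ z ∈ closedExt ε δ, z ∉ openExt ε δ → f z ≤ m ∧ |z.re| ≤ 4 := by
    intro z hz hzo
    simp only [openExt, mem_ofPred_eq, not_forall, not_and_or, not_lt] at hzo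
    obtain ⟨n, hn⟩ := hzo
    have hctrL : ctrL ε δ n = ctrL ε δ 0 + n * per δ := by
      apply Complex.ext <;> simp [ctrL, per]
    have hctrR : ctrR ε δ n = ctrR ε δ 0 + n * per δ := by
      apply Complex.ext <;> simp [ctrR, per]
    have hre : ∀ c : ℂ, ‖z - c‖ ≤ 1 → |c.re| ≤ 2 → |z.re| ≤ 4 := by
      intro c h1 h2
      have h3 := (Complex.abs_re_le_norm (z - c)).trans h1
      rw [Complex.sub_re] at h3
      have := abs_sub_abs_le_abs_sub z.re c.re
      linarith
    have hshift := hint z hz (-n)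
    have hsh : ∀ c : ℂ, z - (c + n * per δ) = z + ((-n : ℤ) : ℂ) * per δ - c := by
      intro c; push_cast; ring
    rcases hn with hn | hn
    · refine ⟨?_, hre _ hn (by rw [abs_le]; constructor <;> simp only [ctrL] <;> linarith)⟩
      have := le_antisymm hn (hz n).1
      rw [hctrL, hsh] at this
      rw [← hshift]; exact hL _ this
    · refine ⟨?_, hre _ hn (by rw [abs_le]; constructor <;> simp only [ctrR] <;> linarith)⟩
      have := le_antisymm hn (hz n).2
      rw [hctrR, hsh] at this
      rw [← hshift]; exact hR _ this
  set G : ℂ → ℝ := fun z => Real.log ‖sinhProfile ε δ z‖ with hG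
  have hGper : ∀ z, G (z + per δ) = G z := fun z => by
    simp only [hG, norm_sinhProfile_add_per hδ]
  have hGc : ContinuousOn G (closedExt ε δ) := fun z hz =>
    (harmonicAt_log_sinhProfile hδ hz).1.continuousAt.continuousWithinAt
  set box : ℝ → Set ℂ := fun X => {z : ℂ | |z.re| ≤ X ∧ |z.im| ≤ 2 + δ} with hbox
  have hboxc : ∀ X, IsCompact (box X ∩ closedExt ε δ) := by
    intro X
    have h1 : box X = Icc (-X) X ×ℂ Icc (-(2 + δ)) (2 + δ) := by
      ext z; simp only [hbox, mem_ofPred_eq, Complex.mem_reProdIm, mem_Icc, abs_le]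
    rw [h1]
    exact (isCompact_Icc.reProdIm isCompact_Icc).inter_right isClosed_closedExt
  obtain ⟨C₁, hC₁⟩ := (hboxc 4).bddBelow_image (hGc.mono inter_subset_right)
  set k : ℝ := Real.pi / (2 + δ) with hk
  have hk0 : 0 < k := by have := Real.pi_pos; positivity
  -- Compare `f` with `m` plus a small multiple of the barrier on a large box. Near the disks `G ≥
  -- C₁`. At the sides `|Re| = X` the growth of `f`, taken with half the slope `η * k` of the
  -- barrier, loses to it for large `X`.
  have key : ∀ η : ℝ, 0 < η → ∀ z ∈ closedExt ε δ, |z.im| ≤ 2 + δ → f z - η * G z ≤ m - η * C₁ := by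
    intro η hη z hz hzim
    obtain ⟨C, X₀, hgr⟩ := hgrowth (η * k / 2) (by positivity)
    obtain ⟨X, hX⟩ : ∃ X : ℝ, 5 ≤ X ∧ |z.re| < X ∧ X₀ ≤ X ∧ 1 ≤ k * (X - 2) ∧
        C + η * k / 2 * X - η * (k * (X - 2) - 1) ≤ m - η * C₁ := by
      have h1 : ∀ᶠ X : ℝ in atTop, 1 ≤ k * (X - 2) :=
        (tendsto_id.atTop_add tendsto_const_nhds).const_mul_atTop hk0 |>.eventually_ge_atTop 1
      have h2 : ∀ᶠ X : ℝ in atTop, C + η * k * 2 + η - (m - η * C₁) ≤ η * k / 2 * X :=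
        (tendsto_id.const_mul_atTop (by positivity)).eventually_ge_atTop _
      obtain ⟨X, a, b, c, d, e⟩ := ((eventually_ge_atTop 5).and ((eventually_gt_atTop |z.re|).and
        ((eventually_ge_atTop X₀).and (h1.and h2)))).exists
      exact ⟨X, a, b, c, d, by linarith⟩
    obtain ⟨hX5, hXz, hX0, hXk, hXm⟩ := hX
    refine maximum_principle (K := box X ∩ closedExt ε δ)
      (T := {q | |q.re| = X ∨ q ∉ openExt ε δ}) (w := f - η • G) (m := m - η * C₁) (hboxc X)
      ((hc.mono inter_subset_right).sub ((hGc.mono inter_subset_right).const_smul η)) ?_ ?_ z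
      ⟨⟨hXz.le, hzim⟩, hz⟩
    · rintro q ⟨⟨hq1, hq2⟩, hq3⟩ hT
      simp only [Pi.sub_apply, Pi.smul_apply, smul_eq_mul]
      rcases hT with hT | hT
      · have h1 := hgr q (by rw [hT]; exact hX0) hq2
        have h2 := le_log_norm_sinhProfile (ε := ε) (z := q) hε hε1 hδ (by rw [hT]; exact hXk)
        rw [hT] at h1 h2
        have h3 := mul_le_mul_of_nonneg_left h2 hη.le
        simp only [hG]
        linarith
      · obtain ⟨h1, h2⟩ := hbdry q hq3 hT
        have h3 : C₁ ≤ G q := hC₁ ⟨q, ⟨⟨h2, hq2⟩, hq3⟩, rfl⟩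
        have := mul_le_mul_of_nonneg_left h3 hη.le
        linarith
    · rintro q ⟨⟨hq1, hq2⟩, hq3⟩ hT
      simp only [mem_ofPred_eq, not_or, not_not] at hT
      have hlt : |q.re| < X := lt_of_le_of_ne hq1 hT.1
      have hnhds : ∀ q' : ℂ, q' ∈ openExt ε δ → |q'.re| < X → |q'.im| < 2 + δ →
          HarmonicAt (f - η • G) q' ∧ box X ∩ closedExt ε δ ∈ 𝓝 q' := by
        intro q' h1 h2 h3
        refine ⟨(hf q' h1).sub
          (harmonicAt_log_sinhProfile hδ (openExt_subset_closedExt _ _ h1)).const_smul, ?_⟩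
        have ho : IsOpen ({z : ℂ | |z.re| < X} ∩ {z : ℂ | |z.im| < 2 + δ} ∩ openExt ε δ) :=
          ((isOpen_lt (by fun_prop) continuous_const).inter
            (isOpen_lt (by fun_prop) continuous_const)).inter (isOpen_openExt hδ)
        exact mem_of_superset (ho.mem_nhds ⟨⟨h2, h3⟩, h1⟩) fun x hx =>
          ⟨⟨le_of_lt hx.1.1, le_of_lt hx.1.2⟩, openExt_subset_closedExt _ _ hx.2⟩
      have hp1 : |(0 : ℝ)| < 2 + δ := by rw [abs_zero]; linarith
      rcases hq2.lt_or_eq with h | h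
      · exact ⟨q, rfl, rfl, hnhds q hT.2 hlt h⟩
      -- The top and bottom of the box are not true boundary: the box is two periods high, so a
      -- shift by one period sends them to height `0` without changing `f - η • G`.
      · rcases eq_or_eq_neg_of_abs_eq h with h | h
        · have hq' : q - per δ ∈ openExt ε δ := by
            rw [← add_per_mem_openExt, sub_add_cancel]; exact hT.2
          refine ⟨q - per δ, ?_, by simp [per], hnhds _ hq' (by simpa [per] using hlt)
            (by simpa [per, h] using hp1)⟩
          have h1 := hper _ (openExt_subset_closedExt _ _ hq')
          have h2 := hGper (q - per δ)
          rw [sub_add_cancel] at h1 h2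
          simp only [Pi.sub_apply, Pi.smul_apply, h1, h2]
        · refine ⟨q + per δ, ?_, by simp [per], hnhds _ (add_per_mem_openExt.mpr hT.2)
            (by simpa [per] using hlt) (by simpa [per, h] using hp1)⟩
          simp only [Pi.sub_apply, Pi.smul_apply, hper _ hq3, hGper]
  have hcell : ∀ z ∈ closedExt ε δ, |z.im| ≤ 2 + δ → f z ≤ m := by
    intro z hz hzim
    -- For a fixed point, let `η → 0`.
    have h1 : ∀ᶠ η : ℝ in 𝓝[>] 0, f z ≤ m - η * C₁ + η * G z := by
      filter_upwards [self_mem_nhdsWithin] with η hη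
      linarith [key η hη z hz hzim]
    refine ge_of_tendsto ?_ h1
    refine Tendsto.mono_left ?_ nhdsWithin_le_nhds
    have : Continuous fun η : ℝ => m - η * C₁ + η * G z := by fun_prop
    simpa using this.tendsto 0
  intro z hz
  obtain ⟨n, hn⟩ := exists_row hδ z.im
  rw [← hint z hz (-n)]
  refine hcell _ (add_int_per_mem_closedExt hz _) ?_
  rw [Complex.add_im, int_mul_per_im]
  push_cast
  rw [neg_mul, ← sub_eq_add_neg]
  linarith

end TwoRows

namespace TwoRows

open InnerProductSpace Metric Filter Topology

variable {ε δ : ℝ} {H u : ℂ → ℝ} {cL cR : ℝ}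

/-! ### Uniform bounds for the potential -/

theorem closed_disk_re_im (hε : 0 < ε) (hε1 : ε < 1) (hδ : 0 < δ) {z : ℂ}
    (h : ‖z - ctrL ε δ 0‖ = 1 ∨ ‖z - ctrR ε δ 0‖ = 1) : |z.re| < 4 ∧ |z.im| < (2 + δ) / 2 := by
  have key : ∀ c : ℂ, ‖z - c‖ = 1 → |c.re| < 2 → c.im = 0 → |z.re| < 4 ∧ |z.im| < (2 + δ) / 2 := by
    intro c h1 h2 h3
    have h4 := Complex.abs_re_le_norm (z - c)
    have h5 := Complex.abs_im_le_norm (z - c)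
    rw [h1, Complex.sub_re] at h4
    rw [h1, Complex.sub_im, h3, sub_zero] at h5
    have := abs_sub_abs_le_abs_sub z.re c.re
    constructor <;> linarith
  rcases h with h | h
  · exact key _ h (by rw [abs_lt]; constructor <;> simp only [ctrL] <;> linarith) (by simp [ctrL])
  · exact key _ h (by rw [abs_lt]; constructor <;> simp only [ctrR] <;> linarith) (by simp [ctrR])

namespace PlaneSolution

/-- `u - H` grows sublinearly. -/
theorem exists_growth (h : PlaneSolution ε δ H u cL cR) (hε : 0 < ε) (hε1 : ε < 1) (hδ : 0 < δ)
    {s : ℝ} (hs : 0 < s) : ∃ C X₀ : ℝ, ∀ z : ℂ, X₀ ≤ |z.re| → |z.im| ≤ 2 + δ →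
      |u z - H z| ≤ C + s * |z.re| := by
  obtain ⟨X, hX, hgrad⟩ := h.exists_fderiv_small hε hε1 hδ hs
  have hc : IsCompact (Icc (-X) X ×ℂ Icc (-(2 + δ)) (2 + δ) ∩ closedExt ε δ) :=
    (isCompact_Icc.reProdIm isCompact_Icc).inter_right isClosed_closedExt
  have hHc : Continuous H := continuous_iff_continuousAt.mpr fun z =>
    (h.harmonic_background z trivial).1.continuousAt
  obtain ⟨C, hC⟩ := hc.exists_bound_of_continuousOn (f := fun z => u z - H z)
    ((h.cont.mono inter_subset_right).sub hHc.continuousOn)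
  refine ⟨C, X, fun z hz1 hz2 => ?_⟩
  obtain ⟨σ, hσ, hσz⟩ : ∃ σ : ℝ, (σ = 1 ∨ σ = -1) ∧ σ * z.re = |z.re| := by
    rcases le_total 0 z.re with h0 | h0
    · exact ⟨1, Or.inl rfl, by rw [abs_of_nonneg h0, one_mul]⟩
    · exact ⟨-1, Or.inr rfl, by rw [abs_of_nonpos h0]; ring⟩
  -- The point of `|Re| = X` at the same height and on the same side as `z`; the small gradient is
  -- integrated along the horizontal segment from it to `z`.
  set z₀ : ℂ := ⟨σ * X, z.im⟩ with hz₀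
  have hcoord : ∀ w ∈ segment ℝ z₀ z, X ≤ |w.re| ∧ w.im = z.im := by
    intro w hw
    obtain ⟨t, h0, h1, h2, h3⟩ := mem_segment_coords hw
    simp only [hz₀] at h2 h3
    refine ⟨?_, by rw [h3]; ring⟩
    have h4 : σ * w.re = X + t * (|z.re| - X) := by
      rw [h2, ← hσz]; rcases hσ with rfl | rfl <;> ring
    have h5 : X ≤ σ * w.re := by rw [h4]; nlinarith
    rcases hσ with rfl | rfl
    · exact (by linarith : X ≤ w.re).trans (le_abs_self _)
    · exact (by linarith : X ≤ -w.re).trans (neg_le_abs _)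
  have hmem : ∀ w ∈ segment ℝ z₀ z, w ∈ openExt ε δ := fun w hw =>
    mem_openExt_of_re hε (Or.inr (by linarith [(hcoord w hw).1]))
  have hmv := (convex_segment z₀ z).norm_image_sub_le_of_norm_hasFDerivWithin_le (C := s)
    (fun w hw => (h.differentiableAt_sub (hmem w hw)).hasFDerivWithinAt)
    (fun w hw => by
      rw [← (h.differentiableAt_sub (hmem w hw)).fderiv]
      exact hgrad w (hcoord w hw).1 (by rw [(hcoord w hw).2]; exact hz2))
    (left_mem_segment ℝ _ _) (right_mem_segment ℝ _ _)
  have hC0 := hC z₀ ⟨⟨by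
      simp only [hz₀, mem_preimage, mem_Icc]
      rcases hσ with rfl | rfl <;> constructor <;> linarith, abs_le.mp hz2⟩,
    openExt_subset_closedExt _ _ (hmem _ (left_mem_segment ℝ _ _))⟩
  have hnorm : ‖z - z₀‖ ≤ |z.re| := by
    have : z - z₀ = ((σ * (|z.re| - X) : ℝ) : ℂ) := by
      apply Complex.ext
      · simp only [hz₀, Complex.sub_re, Complex.ofReal_re, ← hσz]
        rcases hσ with rfl | rfl <;> ring
      · simp [hz₀]
    rw [this, Complex.norm_real, Real.norm_eq_abs, abs_mul]
    have h1 : |σ| = 1 := by rcases hσ with rfl | rfl <;> simp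
    rw [h1, one_mul, abs_of_nonneg (by linarith)]
    linarith
  have h2 := mul_le_mul_of_nonneg_left hnorm hs.le
  rw [Real.norm_eq_abs] at hC0 hmv
  have h3 := abs_sub_abs_le_abs_sub (u z - H z) (u z₀ - H z₀)
  linarith

/-- The maximum principle for `u - H`. -/
theorem abs_sub_sub_le (h : PlaneSolution ε δ H u cL cR) (hε : 0 < ε) (hε1 : ε < 1) (hδ : 0 < δ)
    {M : ℝ} (hM : ∀ z : ℂ, |z.re| < 4 → |z.im| < (2 + δ) / 2 → |H z| ≤ M) :
    ∀ z ∈ closedExt ε δ, |u z - H z - cR| ≤ M + |cR - cL| := by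
  obtain ⟨κ, hκ, hκH⟩ := h.exists_common_jump hε hε1 hδ
  have hHc : Continuous H := continuous_iff_continuousAt.mpr fun z =>
    (h.harmonic_background z trivial).1.continuousAt
  have hcont : ContinuousOn (fun z => u z - H z) (closedExt ε δ) := h.cont.sub hHc.continuousOn
  have hper : ∀ z ∈ closedExt ε δ, u (z + per δ) - H (z + per δ) = u z - H z := fun z hz => by
    rw [hκ z hz, hκH]; ring
  have hLv : ∀ z, ‖z - ctrL ε δ 0‖ = 1 → |u z - H z - cL| ≤ M := fun z hz => by
    obtain ⟨h1, h2⟩ := closed_disk_re_im hε hε1 hδ (Or.inl hz)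
    rw [h.left z hz, show cL - H z - cL = -H z by ring, abs_neg]
    exact hM z h1 h2
  have hRv : ∀ z, ‖z - ctrR ε δ 0‖ = 1 → |u z - H z - cR| ≤ M := fun z hz => by
    obtain ⟨h1, h2⟩ := closed_disk_re_im hε hε1 hδ (Or.inr hz)
    rw [h.right z hz, show cR - H z - cR = -H z by ring, abs_neg]
    exact hM z h1 h2
  -- On the circles `u - H` is `cL - H` or `cR - H`; centring both at `cR` costs `|cR - cL|`.
  have hd := abs_le.mp (le_refl |cR - cL|)
  have hup := le_of_sublinear (m := cR + M + |cR - cL|) hε hε1 hδ h.harmonic_sub hcont hper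
    (fun z hz => by have := abs_le.mp (hLv z hz); linarith)
    (fun z hz => by have := abs_le.mp (hRv z hz); linarith)
    (fun s hs => by
      obtain ⟨C, X₀, hC⟩ := h.exists_growth hε hε1 hδ hs
      exact ⟨C, X₀, fun z h1 h2 => (abs_le.mp (hC z h1 h2)).2⟩)
  have hdown := le_of_sublinear (f := -fun z => u z - H z) (m := -cR + M + |cR - cL|) hε hε1 hδ
    h.harmonic_sub.neg hcont.neg (fun z hz => by simp only [Pi.neg_apply, hper z hz])
    (fun z hz => by have := abs_le.mp (hLv z hz); simp only [Pi.neg_apply]; linarith)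
    (fun z hz => by have := abs_le.mp (hRv z hz); simp only [Pi.neg_apply]; linarith)
    (fun s hs => by
      obtain ⟨C, X₀, hC⟩ := h.exists_growth hε hε1 hδ hs
      refine ⟨C, X₀, fun z h1 h2 => ?_⟩
      have := (abs_le.mp (hC z h1 h2)).1
      simp only [Pi.neg_apply]; linarith)
  intro z hz
  have h1 := hup z hz
  have h2 := hdown z hz
  simp only [Pi.neg_apply] at h2
  rw [abs_le]; constructor <;> linarith

end PlaneSolution

/-- A point of the closed strip is the limit of the points obtained by contracting its height by
factors `t < 1`. -/
theorem abs_le_of_strip_closed (hH : Continuous H) (hδ : 0 < δ) {M : ℝ}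
    (hM : ∀ z : ℂ, |z.re| < 4 → |z.im| < (2 + δ) / 2 → |H z| ≤ M) {z : ℂ} (h1 : |z.re| < 4)
    (h2 : |z.im| ≤ (2 + δ) / 2) : |H z| ≤ M := by
  have hlim : Tendsto (fun t : ℝ => |H ⟨z.re, t * z.im⟩|) (𝓝[<] 1) (𝓝 |H z|) := by
    have hc : Continuous fun t : ℝ => |H ⟨z.re, t * z.im⟩| := by
      have : (fun t : ℝ => |H ⟨z.re, t * z.im⟩|) =
          fun t : ℝ => |H ((z.re : ℂ) + ((t * z.im : ℝ) : ℂ) * Complex.I)| := by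
        funext t; congr 2; apply Complex.ext <;> simp
      rw [this]; fun_prop
    have := hc.tendsto 1
    simp only [one_mul] at this
    exact this.mono_left nhdsWithin_le_nhds
  refine le_of_tendsto hlim ?_
  have : ∀ᶠ t : ℝ in 𝓝[<] 1, 0 < t := nhdsWithin_le_nhds (lt_mem_nhds one_pos)
  filter_upwards [self_mem_nhdsWithin, this] with t ht ht0
  refine hM _ h1 ?_
  simp only
  rw [abs_mul, abs_of_pos ht0]
  have ht1 : t < 1 := ht
  nlinarith [abs_nonneg z.im]

/-- Bounds of the background over three cells. -/
theorem background_bounds (hH : Continuous H) (hδ : 0 < δ) {M κ : ℝ}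
    (hM : ∀ z : ℂ, |z.re| < 4 → |z.im| < (2 + δ) / 2 → |H z| ≤ M)
    (hκ : ∀ z, H (z + per δ) = H z + κ) :
    |κ| ≤ 2 * M ∧ ∀ z : ℂ, |z.re| < 4 → |z.im| ≤ 3 * (2 + δ) / 2 → |H z| ≤ 3 * M := by
  have hcl := fun z : ℂ => abs_le_of_strip_closed (z := z) hH hδ hM
  have h1 : |κ| ≤ 2 * M := by
    -- The jump is the difference of `H` between the top and the bottom of one cell.
    have h2 := hκ ⟨0, -((2 + δ) / 2)⟩
    have h3 := abs_le.mp (hcl ⟨0, -((2 + δ) / 2)⟩ (by simp) (by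
      simp only [abs_neg]; rw [abs_of_pos (by linarith)]))
    have h4 := abs_le.mp (hcl (⟨0, -((2 + δ) / 2)⟩ + per δ) (by simp [per]) (by
      simp only [Complex.add_im, per]; rw [abs_of_pos (by linarith)]; linarith))
    rw [abs_le]; constructor <;> linarith
  refine ⟨h1, fun z hz1 hz2 => ?_⟩
  have hM0 : 0 ≤ M := by have := abs_nonneg κ; linarith
  have hκ' := abs_le.mp h1
  rw [abs_le] at hz2
  rcases le_or_gt z.im ((2 + δ) / 2) with h | h
  · rcases le_or_gt (-((2 + δ) / 2)) z.im with h' | h'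
    · exact (hcl z hz1 (abs_le.mpr ⟨h', h⟩)).trans (by linarith)
    · have h2 := hκ z
      have h3 := abs_le.mp (hcl (z + per δ) (by simpa [per] using hz1) (by
        simp only [Complex.add_im, per]; rw [abs_le]; constructor <;> linarith))
      rw [abs_le]; constructor <;> linarith
  · have h2 := hκ (z - per δ)
    have h3 := abs_le.mp (hcl (z - per δ) (by simpa [per] using hz1) (by
      simp only [Complex.sub_im, per]; rw [abs_le]; constructor <;> linarith))
    rw [sub_add_cancel] at h2
    rw [abs_le]; constructor <;> linarith

/-- The bounds on the data that the gap estimates use. -/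
structure BoundedSolution (ε δ M κ : ℝ) (u : ℂ → ℝ) (cL cR : ℝ) : Prop where
  harmonic : HarmonicOnNhd u (openExt ε δ)
  cont : ContinuousOn u (closedExt ε δ)
  left : ∀ z, ‖z - ctrL ε δ 0‖ = 1 → u z = cL
  right : ∀ z, ‖z - ctrR ε δ 0‖ = 1 → u z = cR
  right_up : ∀ z, ‖z - ctrR ε δ 1‖ = 1 → u z = cR + κ
  right_down : ∀ z, ‖z - ctrR ε δ (-1)‖ = 1 → u z = cR - κ
  jump_le : |κ| ≤ 2 * M
  bound : ∀ z ∈ closedExt ε δ, |z.re| < 4 → |z.im| ≤ 3 → |u z - cR| ≤ 4 * M + |cR - cL|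

theorem circle_subset_closedExt (hε : 0 < ε) (hδ : 0 < δ) {z : ℂ}
    (hz : ‖z - ctrR ε δ 0‖ = 1) : z ∈ closedExt ε δ := by
  have h4 := Complex.abs_re_le_norm (z - ctrR ε δ 0)
  have h5 := Complex.abs_im_le_norm (z - ctrR ε δ 0)
  rw [hz] at h4 h5
  simp only [Complex.sub_re, Complex.sub_im, ctrR, Int.cast_zero, zero_mul, sub_zero] at h4 h5
  have hre : 1 < ‖z - ctrL ε δ 0‖ := by
    apply one_lt_norm_of_re
    simp only [ctrL]
    rw [lt_abs]; left
    linarith [(abs_le.mp h4).1]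
  intro n
  by_cases hn : n = 0
  · rw [hn]; exact ⟨hre.le, hz.ge⟩
  · have := abs_int_mul_sub_gt hδ (y := z.im) (n := 0) (m := n) (by simp; linarith) hn
    exact ⟨(one_lt_norm_of_im this).le, (one_lt_norm_of_im this).le⟩

theorem PlaneSolution.bounded (h : PlaneSolution ε δ H u cL cR) (hε : 0 < ε) (hε1 : ε < 1)
    (hδ : 0 < δ) {M : ℝ} (hM : ∀ z : ℂ, |z.re| < 4 → |z.im| < (2 + δ) / 2 → |H z| ≤ M) :
    ∃ κ, (∀ z, H (z + per δ) = H z + κ) ∧ BoundedSolution ε δ M κ u cL cR := by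
  obtain ⟨κ, hκ, hκH⟩ := h.exists_common_jump hε hε1 hδ
  have hHc : Continuous H := continuous_iff_continuousAt.mpr fun z =>
    (h.harmonic_background z trivial).1.continuousAt
  obtain ⟨hκM, hH3⟩ := background_bounds hHc hδ hM hκH
  refine ⟨κ, hκH, h.harmonic, h.cont, h.left, h.right, fun z hz => ?_, fun z hz => ?_, hκM,
    fun z hz h1 h2 => ?_⟩
  · rw [← zero_add (1 : ℤ), ctrR_add_one, ← sub_sub, sub_right_comm] at hz
    have h2 := hκ _ (circle_subset_closedExt hε hδ hz)
    rw [sub_add_cancel] at h2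
    rw [h2, h.right _ hz]
  · have h1 : ctrR ε δ 0 = ctrR ε δ (-1) + per δ := by rw [← ctrR_add_one]; norm_num
    have hz' : ‖z + per δ - ctrR ε δ 0‖ = 1 := by
      rw [h1, add_sub_add_right_eq_sub]; exact hz
    have h2 := hκ z (add_per_mem_closedExt.mp (circle_subset_closedExt hε hδ hz'))
    rw [h.right _ hz'] at h2
    linarith
  -- The bound is `M + |cR - cL|` for `u - H - cR` plus `3M` for `H`, valid since `|Im z| ≤ 3` stays
  -- within three cells.
  · have h3 := abs_le.mp (h.abs_sub_sub_le hε hε1 hδ hM z hz)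
    have h4 := abs_le.mp (hH3 z h1 (by linarith))
    rw [abs_le]; constructor <;> linarith

end TwoRows

namespace TwoRows

open InnerProductSpace Metric Filter Topology

/-! ### The harmonic profile of the gap between two disks -/

/-- The distance from the origin of the poles of the profile. -/
noncomputable def pole (b : ℝ) : ℝ := √(b ^ 2 - 1)

/-- The value of `log ‖ζ + a‖ - log ‖ζ - a‖`, `a = pole b`, on the circle of centre `b`. -/
noncomputable def height (b : ℝ) : ℝ := Real.log (b + pole b)

/-- The function harmonic outside the unit disks with centres `b` and `-b` which has the values
`1/2` and `-1/2` on their boundaries. -/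
noncomputable def profile (b : ℝ) (ζ : ℂ) : ℝ :=
  (2 * height b)⁻¹ * (Real.log ‖ζ + pole b‖ - Real.log ‖ζ - pole b‖)

variable {b : ℝ}

theorem pole_sq (hb : 1 < b) : pole b ^ 2 = b ^ 2 - 1 := Real.sq_sqrt (by nlinarith)

theorem pole_pos (hb : 1 < b) : 0 < pole b := Real.sqrt_pos.mpr (by nlinarith)

theorem pole_lt (hb : 1 < b) : pole b < b := by
  have := pole_sq hb; have := pole_pos hb; nlinarith

theorem sub_pole_lt_one (hb : 1 < b) : b - pole b < 1 := by
  have := pole_sq hb; have := pole_pos hb; nlinarith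

theorem height_pos (hb : 1 < b) : 0 < height b :=
  Real.log_pos (by linarith [pole_pos hb])

/-- The ratio `pole b / height b` is close to `1`. -/
theorem pole_div_height (hb : 1 < b) :
    1 ≤ pole b / height b ∧ pole b / height b ≤ (1 + b) / 2 := by
  have ha := pole_pos hb
  have hs := height_pos hb
  have hsq := pole_sq hb
  have hpos : 0 < b + pole b := by linarith
  constructor
  · rw [one_le_div hs]
    -- `exp (height b) = b + pole b` has inverse `b - pole b`; the lower bound is then `s ≤ sinh s`.
    have h1 : Real.sinh (height b) = pole b := by
      rw [Real.sinh_eq, Real.exp_neg, height, Real.exp_log hpos]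
      field_simp
      linarith
    rw [← h1]
    exact Real.self_le_sinh_iff.mpr hs.le
  -- `log (1 + x) ≥ 2x / (x + 2)` at `x = b + pole b - 1`, where the right side simplifies to `2 *
  -- pole b / (1 + b)`.
  · have h1 := Real.le_log_one_add_of_nonneg (x := b + pole b - 1) (by linarith)
    rw [show 1 + (b + pole b - 1) = b + pole b by ring] at h1
    have h2 : 2 * (b + pole b - 1) / (b + pole b - 1 + 2) = 2 * pole b / (1 + b) := by
      rw [div_eq_div_iff (by linarith) (by linarith)]
      linear_combination (-2) * hsq
    rw [h2, div_le_iff₀ (by linarith)] at h1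
    rw [div_le_iff₀ hs, height]
    linarith

theorem profile_neg (ζ : ℂ) : profile b (-ζ) = -profile b ζ := by
  have h1 : ‖-ζ + pole b‖ = ‖ζ - pole b‖ := by rw [← norm_neg]; congr 1; ring
  have h2 : ‖-ζ - pole b‖ = ‖ζ + pole b‖ := by rw [← norm_neg]; congr 1; ring
  rw [profile, h1, h2, profile]; ring

theorem norm_sub_pole_pos (hb : 1 < b) {ζ : ℂ} (h : 1 ≤ ‖ζ - b‖) : 0 < ‖ζ - pole b‖ := by
  rw [norm_pos_iff, sub_ne_zero]
  rintro rfl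
  rw [← Complex.ofReal_sub, Complex.norm_real, Real.norm_eq_abs, abs_sub_comm,
    abs_of_pos (by linarith [pole_lt hb])] at h
  linarith [sub_pole_lt_one hb]

theorem norm_add_pole_pos (hb : 1 < b) {ζ : ℂ} (h : 1 ≤ ‖ζ + b‖) : 0 < ‖ζ + pole b‖ := by
  have := norm_sub_pole_pos hb (ζ := -ζ) (by rwa [← norm_neg, neg_sub, sub_neg_eq_add, add_comm])
  rwa [← norm_neg, neg_sub, sub_neg_eq_add, add_comm] at this

/-- The circle is a circle of Apollonius for `±pole b`: on it `|ζ|² + pole² = 2b Re ζ`, which makes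
`|ζ + pole b| / |ζ - pole b|` equal to `b + pole b`. -/
theorem profile_eq_half (hb : 1 < b) {ζ : ℂ} (h : ‖ζ - b‖ = 1) : profile b ζ = 1 / 2 := by
  have hs := height_pos hb
  have hsq := pole_sq hb
  have ha := pole_pos hb
  have hpos := norm_sub_pole_pos hb h.ge
  have hn : ‖ζ + pole b‖ = (b + pole b) * ‖ζ - pole b‖ := by
    rw [← sq_eq_sq₀ (norm_nonneg _) (by positivity), mul_pow, ← Complex.normSq_eq_norm_sq,
      ← Complex.normSq_eq_norm_sq, Complex.normSq_apply, Complex.normSq_apply]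
    rw [norm_eq_one_iff] at h
    simp only [Complex.sub_re, Complex.sub_im, Complex.add_re, Complex.add_im, Complex.ofReal_re,
      Complex.ofReal_im, sub_zero, add_zero] at h ⊢
    have h2 : ζ.re ^ 2 + ζ.im ^ 2 + pole b ^ 2 = 2 * b * ζ.re := by linarith
    have h3 : (b + pole b) ^ 2 * (2 * b * ζ.re - 2 * pole b * ζ.re) =
        2 * b * ζ.re + 2 * pole b * ζ.re := by
      have : (b + pole b) * (b - pole b) = 1 := by ring_nf; linarith
      linear_combination (2 * ζ.re * (b + pole b)) * this
    linear_combination h2 - h3 - (b + pole b) ^ 2 * h2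
  rw [profile, hn, Real.log_mul (by linarith) hpos.ne', ← height]
  field_simp
  ring

theorem profile_eq_neg_half (hb : 1 < b) {ζ : ℂ} (h : ‖ζ + b‖ = 1) : profile b ζ = -(1 / 2) := by
  have := profile_eq_half hb (ζ := -ζ) (by rwa [← norm_neg, neg_sub, sub_neg_eq_add, add_comm])
  rw [profile_neg] at this
  linarith

/-- Off the disk the Apollonius ratio is at most `b + pole b`: the defect in the squared inequality
is a positive multiple of `|ζ - b|² - 1`. -/
theorem profile_le_half (hb : 1 < b) {ζ : ℂ} (h : 1 ≤ ‖ζ - b‖) (h' : 1 ≤ ‖ζ + b‖) :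
    profile b ζ ≤ 1 / 2 := by
  have hs := height_pos hb
  have hsq := pole_sq hb
  have ha := pole_pos hb
  have hpos := norm_sub_pole_pos hb h
  have hpos' := norm_add_pole_pos hb h'
  have hn : ‖ζ + pole b‖ ≤ (b + pole b) * ‖ζ - pole b‖ := by
    rw [← sq_le_sq₀ (norm_nonneg _) (by positivity), mul_pow, ← Complex.normSq_eq_norm_sq,
      ← Complex.normSq_eq_norm_sq, Complex.normSq_apply, Complex.normSq_apply]
    rw [one_le_norm_iff] at h
    simp only [Complex.sub_re, Complex.sub_im, Complex.add_re, Complex.add_im, Complex.ofReal_re,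
      Complex.ofReal_im, sub_zero, add_zero] at h ⊢
    have h2 : 0 ≤ ζ.re ^ 2 + ζ.im ^ 2 + pole b ^ 2 - 2 * b * ζ.re := by linarith
    have h3 := mul_nonneg (mul_nonneg ha.le (by linarith : 0 ≤ b + pole b)) h2
    have e : (b + pole b) ^ 2 * ((ζ.re - pole b) * (ζ.re - pole b) + ζ.im * ζ.im) -
        ((ζ.re + pole b) * (ζ.re + pole b) + ζ.im * ζ.im) =
        2 * (pole b * (b + pole b) * (ζ.re ^ 2 + ζ.im ^ 2 + pole b ^ 2 - 2 * b * ζ.re)) := by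
      linear_combination (-(ζ.re ^ 2 + ζ.im ^ 2 + pole b ^ 2) - 2 * pole b * ζ.re) * hsq
    linarith
  have hl := Real.log_le_log hpos' hn
  rw [Real.log_mul (by linarith) hpos.ne', ← height] at hl
  rw [profile, inv_mul_le_iff₀ (by positivity)]
  linarith

theorem abs_profile_le (hb : 1 < b) {ζ : ℂ} (h : 1 ≤ ‖ζ - b‖) (h' : 1 ≤ ‖ζ + b‖) :
    |profile b ζ| ≤ 1 / 2 := by
  have h1 := profile_le_half hb h h'
  have h2 := profile_le_half hb (ζ := -ζ) (by rwa [← norm_neg, neg_sub, sub_neg_eq_add, add_comm])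
    (by rwa [← norm_neg, neg_add, neg_neg, ← sub_eq_add_neg])
  rw [profile_neg] at h2
  rw [abs_le]; constructor <;> linarith

theorem harmonicAt_profile_comp (hb : 1 < b) {φ : ℂ → ℂ} {z : ℂ} (hφ : AnalyticAt ℂ φ z)
    (h : 1 ≤ ‖φ z - b‖) (h' : 1 ≤ ‖φ z + b‖) : HarmonicAt (fun z => profile b (φ z)) z := by
  have h1 : HarmonicAt (fun z => Real.log ‖φ z + pole b‖) z :=
    AnalyticAt.harmonicAt_log_norm (f := fun z => φ z + pole b) (by fun_prop)
      (norm_pos_iff.mp (norm_add_pole_pos hb h'))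
  have h2 : HarmonicAt (fun z => Real.log ‖φ z - pole b‖) z :=
    AnalyticAt.harmonicAt_log_norm (f := fun z => φ z - pole b) (by fun_prop)
      (norm_pos_iff.mp (norm_sub_pole_pos hb h))
  exact (h1.sub h2).const_smul (c := (2 * height b)⁻¹)

theorem hasFDerivAt_log_norm {ζ c : ℂ} (h : ζ - c ≠ 0) :
    HasFDerivAt (fun z : ℂ => Real.log ‖z - c‖)
      (Complex.reCLM ∘L ((ζ - c)⁻¹ • (1 : ℂ →L[ℝ] ℂ))) ζ := by
  have h0 : (0 : ℝ) < Complex.normSq (ζ - c) := Complex.normSq_pos.mpr h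
  have e : (fun z : ℂ => Real.log ‖z - c‖) =
      fun z : ℂ => 2⁻¹ * Real.log ((z.re - c.re) ^ 2 + (z.im - c.im) ^ 2) := by
    funext z
    have : (z.re - c.re) ^ 2 + (z.im - c.im) ^ 2 = ‖z - c‖ ^ 2 := by
      rw [← Complex.normSq_eq_norm_sq, Complex.normSq_apply, Complex.sub_re, Complex.sub_im]; ring
    rw [this, Real.log_pow]; push_cast; ring
  rw [e]
  have h1 : HasFDerivAt (fun z : ℂ => z.re - c.re) Complex.reCLM ζ :=
    Complex.reCLM.hasFDerivAt.sub_const _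
  have h2 : HasFDerivAt (fun z : ℂ => z.im - c.im) Complex.imCLM ζ :=
    Complex.imCLM.hasFDerivAt.sub_const _
  have h00 : (ζ.re - c.re) ^ 2 + (ζ.im - c.im) ^ 2 = Complex.normSq (ζ - c) := by
    rw [Complex.normSq_apply, Complex.sub_re, Complex.sub_im]; ring
  have h3 := (((h1.pow 2).add (h2.pow 2)).log (by
    simp only [Pi.add_apply]; rw [h00]; exact h0.ne')).const_mul 2⁻¹
  refine HasFDerivAt.congr_fderiv h3 ?_
  ext w
  simp [h00]
  field_simp
  ring

/-- The complex derivative of the profile. -/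
noncomputable def profileDeriv (b : ℝ) (ζ : ℂ) : ℂ :=
  ((pole b / height b : ℝ) : ℂ) / ((pole b : ℂ) ^ 2 - ζ ^ 2)

theorem hasFDerivAt_profile (hb : 1 < b) {ζ : ℂ} (h : 1 ≤ ‖ζ - b‖) (h' : 1 ≤ ‖ζ + b‖) :
    HasFDerivAt (profile b) (Complex.reCLM ∘L (profileDeriv b ζ • (1 : ℂ →L[ℝ] ℂ))) ζ := by
  have h1 := norm_pos_iff.mp (norm_sub_pole_pos hb h)
  have h2 := norm_pos_iff.mp (norm_add_pole_pos hb h')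
  have hs : (height b : ℂ) ≠ 0 := by exact_mod_cast (height_pos hb).ne'
  have h3 := hasFDerivAt_log_norm (c := -(pole b : ℂ)) (ζ := ζ) (by rwa [sub_neg_eq_add])
  simp only [sub_neg_eq_add] at h3
  have h4 := (h3.sub (hasFDerivAt_log_norm h1)).const_mul (2 * height b)⁻¹
  refine HasFDerivAt.congr_fderiv (f := profile b) h4 ?_
  have h5 : ((pole b : ℂ) ^ 2 - ζ ^ 2) ≠ 0 := by
    rw [show (pole b : ℂ) ^ 2 - ζ ^ 2 = -((ζ - pole b) * (ζ + pole b)) by ring]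
    exact neg_ne_zero.mpr (mul_ne_zero h1 h2)
  have h6 : profileDeriv b ζ = ((2 * height b)⁻¹ : ℝ) * ((ζ + pole b)⁻¹ - (ζ - pole b)⁻¹) := by
    rw [profileDeriv]
    push_cast
    field_simp
    ring
  refine ContinuousLinearMap.ext fun w => ?_
  rw [h6]
  simp only [smul_apply, sub_apply,
    ContinuousLinearMap.comp_apply, one_apply_eq_self, Complex.reCLM_apply, smul_eq_mul]
  rw [mul_assoc, Complex.re_ofReal_mul, sub_mul, Complex.sub_re]

/-- The derivative of the profile in the direction of the inner normal of the disk of centre `b`. -/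
theorem profileDeriv_normal (hb : 1 < b) (θ : ℝ) :
    (profileDeriv b (b + Complex.exp (θ * Complex.I)) * -Complex.exp (θ * Complex.I)).re =
      pole b / height b / (2 * (b + Real.cos θ)) := by
  set E := Complex.exp (θ * Complex.I) with hE
  have hE0 : E ≠ 0 := Complex.exp_ne_zero _
  have hcos : E + E⁻¹ = ((2 * Real.cos θ : ℝ) : ℂ) := by
    rw [hE, ← Complex.exp_neg, Complex.ofReal_mul, Complex.ofReal_cos, Complex.cos]
    rw [← neg_mul]; push_cast; ring
  have hbc : 0 < b + Real.cos θ := by linarith [Real.neg_one_le_cos θ]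
  -- At a point `b + E` of the circle, `pole² - ζ² = -1 - 2bE - E² = -E (2b + E + E⁻¹)`, and the
  -- last factor is real. So the derivative times the inner normal `-E` is real.
  have h1 : (pole b : ℂ) ^ 2 - (b + E) ^ 2 = -E * ((2 * (b + Real.cos θ) : ℝ) : ℂ) := by
    have h2 : ((2 * (b + Real.cos θ) : ℝ) : ℂ) = 2 * b + (E + E⁻¹) := by
      rw [hcos]; push_cast; ring
    have h3 : (pole b : ℂ) ^ 2 = (b : ℂ) ^ 2 - 1 := by exact_mod_cast pole_sq hb
    rw [h2, h3]
    field_simp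
    ring
  have h4 : profileDeriv b (b + E) * -E =
      ((pole b / height b / (2 * (b + Real.cos θ)) : ℝ) : ℂ) := by
    rw [profileDeriv, h1, Complex.ofReal_div _ (2 * (b + Real.cos θ))]
    have : ((2 * (b + Real.cos θ) : ℝ) : ℂ) ≠ 0 := by
      exact_mod_cast (by positivity : (2 * (b + Real.cos θ) : ℝ) ≠ 0)
    field_simp
  rw [h4, Complex.ofReal_re]

/-! ### Width of the gap and expansion of the profile gradient -/

/-- In the gap the half-width is at most two thirds of `e + y²`. -/
theorem abs_le_of_gap {e x y : ℝ} (he : 0 < e) (hx : |x| < 1 + e / 2 - √(1 - y ^ 2))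
    (hy : |y| < √3 / 2) : |x| ≤ 2 / 3 * (e + y ^ 2) ∧ y ^ 2 < 3 / 4 := by
  have hy2 : y ^ 2 < 3 / 4 := by
    have h3 : √3 ^ 2 = 3 := Real.sq_sqrt (by norm_num)
    have := sq_lt_sq' (by linarith [abs_nonneg y, Real.sqrt_nonneg 3]) hy
    rw [sq_abs] at this
    nlinarith
  refine ⟨?_, hy2⟩
  -- The chord of the concave function `√(1 - t)` over `[0, 3/4]` has slope `-2/3`.
  have h1 : 1 - 2 / 3 * y ^ 2 ≤ √(1 - y ^ 2) := by
    apply Real.le_sqrt_of_sq_le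
    nlinarith [sq_nonneg y]
  linarith

/-- The gradient of the profile in the gap. -/
theorem norm_profileDeriv_sub_le {e x y : ℝ} (he : 0 < e) (he1 : e < 1 / 4)
    (hx : |x| ≤ 2 / 3 * (e + y ^ 2)) (hy : y ^ 2 < 3 / 4) :
    ‖profileDeriv (1 + e / 2) ⟨x, y⟩ -
      ((1 / (e + y ^ 2) : ℝ) + (2 * x * y / (e + y ^ 2) ^ 2 : ℝ) * Complex.I)‖ ≤ 10 := by
  have hb : 1 < 1 + e / 2 := by linarith
  set h : ℝ := e + y ^ 2 with hh
  have hh0 : 0 < h := by positivity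
  have hh1 : h < 1 := by linarith
  have heh : e ≤ h := by have := sq_nonneg y; linarith
  have hyh : y ^ 2 ≤ h := by linarith
  -- The denominator is `τ = h - q + r` with `h = e + y²`, `q = 2ixy`, `r = e²/4 - x²`. In the gap
  -- `q² = O(h³)` and `r = O(h²)`.
  set τ : ℂ := (pole (1 + e / 2) : ℂ) ^ 2 - (⟨x, y⟩ : ℂ) ^ 2 with hτ
  set q : ℂ := (2 * x * y : ℝ) * Complex.I with hq
  set r : ℝ := e ^ 2 / 4 - x ^ 2 with hr
  set k : ℝ := pole (1 + e / 2) / height (1 + e / 2) with hk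
  obtain ⟨hk1, hk2⟩ := pole_div_height hb
  have hx2 : x ^ 2 ≤ 4 / 9 * h ^ 2 := by
    have := sq_le_sq' (by linarith [abs_nonneg x]) hx
    rw [sq_abs] at this
    nlinarith
  have hτe : τ = (h : ℂ) - q + r := by
    have h1 : (pole (1 + e / 2) : ℂ) ^ 2 = (((1 + e / 2) ^ 2 - 1 : ℝ) : ℂ) := by
      exact_mod_cast pole_sq hb
    have h2 : (⟨x, y⟩ : ℂ) = x + y * Complex.I := by apply Complex.ext <;> simp
    rw [hτ, h1, h2, hq, hh, hr]
    push_cast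
    linear_combination (-(y : ℂ) ^ 2) * Complex.I_sq
  have hτn : h / 2 ≤ ‖τ‖ := by
    refine le_trans ?_ ((le_abs_self _).trans (Complex.abs_re_le_norm τ))
    rw [hτe]
    simp only [hq, Complex.add_re, Complex.sub_re, Complex.ofReal_re, Complex.mul_re, Complex.I_re,
      Complex.I_im, Complex.ofReal_im, mul_zero, zero_mul, sub_zero]
    rw [hr]; nlinarith [sq_nonneg e]
  have hτ0 : τ ≠ 0 := norm_pos_iff.mp (by linarith)
  have hhC : (h : ℂ) ≠ 0 := by exact_mod_cast hh0.ne'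
  have hqn2 : ‖q‖ ^ 2 ≤ 16 / 9 * h ^ 3 := by
    rw [hq, norm_mul, Complex.norm_I, mul_one, Complex.norm_real, Real.norm_eq_abs, sq_abs]
    have := mul_le_mul hx2 hyh (sq_nonneg y) (by positivity)
    nlinarith
  have hqn : ‖q‖ ≤ 4 / 3 * h := by
    rw [← sq_le_sq₀ (norm_nonneg _) (by positivity)]
    nlinarith [pow_pos hh0 2]
  have hrn : |r| ≤ 4 / 9 * h ^ 2 := by
    rw [hr, abs_le]; constructor <;> nlinarith [sq_nonneg e, sq_nonneg x]
  -- Expand `1/τ` as `1/h + q/h²` plus a remainder. Its numerator is `O(h³)`, and `|τ| ≥ h / 2`, so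
  -- it is bounded; so is `(k - 1) / τ`, because `k - 1 ≤ e / 4`.
  have hdecomp : profileDeriv (1 + e / 2) ⟨x, y⟩ -
      ((1 / h : ℝ) + (2 * x * y / h ^ 2 : ℝ) * Complex.I) =
      ((k - 1 : ℝ) : ℂ) / τ + (q ^ 2 - r * (h + q)) / (τ * (h : ℂ) ^ 2) := by
    have h1 : profileDeriv (1 + e / 2) ⟨x, y⟩ = (k : ℂ) / τ := rfl
    have h2 : ((2 * x * y / h ^ 2 : ℝ) : ℂ) * Complex.I = q / (h : ℂ) ^ 2 := by
      rw [hq, Complex.ofReal_div]; push_cast; ring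
    have h3 : (q ^ 2 - r * (h + q)) = (h : ℂ) ^ 2 - τ * (h + q) := by rw [hτe]; ring
    rw [h1, h2, h3]
    push_cast
    field_simp
    ring
  rw [hdecomp]
  have hfirst : ‖((k - 1 : ℝ) : ℂ) / τ‖ ≤ 1 := by
    rw [norm_div, Complex.norm_real, Real.norm_eq_abs, abs_of_nonneg (by linarith),
      div_le_one (by linarith)]
    linarith
  have hsecond : ‖(q ^ 2 - r * (h + q)) / (τ * (h : ℂ) ^ 2)‖ ≤ 9 := by
    rw [norm_div, norm_mul, norm_pow, Complex.norm_real, Real.norm_eq_abs, abs_of_pos hh0,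
      div_le_iff₀ (by positivity)]
    have h1 : ‖q ^ 2 - r * (h + q)‖ ≤ 16 / 9 * h ^ 3 + 4 / 9 * h ^ 2 * (h + 4 / 3 * h) := by
      refine (norm_sub_le _ _).trans (add_le_add (by rw [norm_pow]; exact hqn2) ?_)
      rw [norm_mul, Complex.norm_real, Real.norm_eq_abs]
      refine mul_le_mul hrn ((norm_add_le _ _).trans ?_) (norm_nonneg _) (by positivity)
      rw [Complex.norm_real, Real.norm_eq_abs, abs_of_pos hh0]
      linarith
    have h2 : h / 2 * h ^ 2 ≤ ‖τ‖ * h ^ 2 := mul_le_mul_of_nonneg_right hτn (by positivity)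
    nlinarith [pow_pos hh0 3]
  exact (norm_add_le _ _).trans (by linarith)

end TwoRows

namespace TwoRows

open InnerProductSpace Metric Filter Topology

variable {ε δ : ℝ}

/-! ### Localization to a single gap -/

theorem ctrR_zero : ctrR ε δ 0 = ((1 + ε / 2 : ℝ) : ℂ) := by
  apply Complex.ext <;> simp [ctrR]

theorem ctrL_zero : ctrL ε δ 0 = -((1 + ε / 2 : ℝ) : ℂ) := by
  apply Complex.ext <;> simp [ctrL]; ring

theorem one_lt_norm_sub_of_im_lt_one (hδ : 0 < δ) {q : ℂ} (h : |q.im| < 1) {n : ℤ} (hn : n ≠ 0) :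
    1 < ‖q - ctrL ε δ n‖ ∧ 1 < ‖q - ctrR ε δ n‖ := by
  have := abs_int_mul_sub_gt hδ (y := q.im) (n := 0) (m := n) (by simp; linarith) hn
  exact ⟨one_lt_norm_of_im this, one_lt_norm_of_im this⟩

theorem one_lt_norm_sub_of_right (hε : 0 < ε) (hδ : 0 < δ) {q : ℂ} (hre : 0 < q.re)
    (h1 : -1 < q.im) (h2 : q.im < 3) (n : ℤ) :
    1 < ‖q - ctrL ε δ n‖ ∧ (n ≠ 0 → n ≠ 1 → 1 < ‖q - ctrR ε δ n‖) := by
  constructor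
  · apply one_lt_norm_of_re
    simp only [ctrL]; rw [lt_abs]; left; linarith
  · intro hn0 hn1
    apply one_lt_norm_of_im
    simp only [ctrR]; rw [lt_abs]
    rcases lt_or_gt_of_ne hn0 with hn | hn
    · left
      have : (n : ℝ) ≤ -1 := by exact_mod_cast (by lia : n ≤ -1)
      nlinarith
    · right
      have : (2 : ℝ) ≤ n := by exact_mod_cast (by lia : (2 : ℤ) ≤ n)
      nlinarith

theorem coords_of_mem_closedBall {p q : ℂ} {ρ : ℝ} (hq : q ∈ closedBall p ρ) :
    |q.re - p.re| ≤ ρ ∧ |q.im - p.im| ≤ ρ := by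
  rw [mem_closedBall, dist_eq_norm] at hq
  exact ⟨le_trans (by simpa using Complex.abs_re_le_norm (q - p)) hq,
    le_trans (by simpa using Complex.abs_im_le_norm (q - p)) hq⟩

/-- Subtracting the profile from a potential in the gap between `D_{L0}` and `D_{R0}`. -/
theorem vanishesNear_vertical (hε : 0 < ε) (hδ : 0 < δ) {U : ℂ → ℝ} {α β N : ℝ}
    (hU : HarmonicOnNhd U (openExt ε δ)) (hUc : ContinuousOn U (closedExt ε δ))
    (hα : ∀ z, ‖z - ctrL ε δ 0‖ = 1 → U z = α) (hβ : ∀ z, ‖z - ctrR ε δ 0‖ = 1 → U z = β)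
    (hN : ∀ z ∈ closedExt ε δ, |z.re| < 4 → |z.im| ≤ 3 → |U z - β| ≤ N) {p : ℂ}
    (hp1 : |p.im| < 7 / 8) (hp2 : |p.re| < 3) :
    VanishesNear (ctrR ε δ 0) (ctrL ε δ 0) p (1 / 10) (N + |β - α|)
      (fun z => U z - ((α + β) / 2 + (β - α) * profile (1 + ε / 2) z)) := by
  have hb : 1 < 1 + ε / 2 := by linarith
  -- The radius `1/10` keeps heights below `1`, where no other row of disks interferes.
  have hcoord : ∀ q ∈ closedBall p (1 / 10), |q.im| < 1 ∧ |q.re| < 4 := by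
    intro q hq
    obtain ⟨h1, h2⟩ := coords_of_mem_closedBall hq
    have h3 := abs_sub_abs_le_abs_sub q.re p.re
    have h4 := abs_sub_abs_le_abs_sub q.im p.im
    constructor <;> linarith
  have hopen : ∀ q ∈ closedBall p (1 / 10), 1 < ‖q - ctrR ε δ 0‖ → 1 < ‖q - ctrL ε δ 0‖ →
      q ∈ openExt ε δ := by
    intro q hq h1 h2 n
    by_cases hn : n = 0
    · rw [hn]; exact ⟨h2, h1⟩
    · exact one_lt_norm_sub_of_im_lt_one hδ (hcoord q hq).1 hn
  have hclosed : ∀ q ∈ closedBall p (1 / 10), 1 ≤ ‖q - ctrR ε δ 0‖ → 1 ≤ ‖q - ctrL ε δ 0‖ →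
      q ∈ closedExt ε δ := by
    intro q hq h1 h2 n
    by_cases hn : n = 0
    · rw [hn]; exact ⟨h2, h1⟩
    · obtain ⟨h3, h4⟩ := one_lt_norm_sub_of_im_lt_one (ε := ε) hδ (hcoord q hq).1 hn
      exact ⟨h3.le, h4.le⟩
  have hprof : ∀ q : ℂ, 1 ≤ ‖q - ctrR ε δ 0‖ → 1 ≤ ‖q - ctrL ε δ 0‖ →
      HarmonicAt (profile (1 + ε / 2)) q ∧ |profile (1 + ε / 2) q| ≤ 1 / 2 := by
    intro q h1 h2
    rw [ctrR_zero] at h1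
    rw [ctrL_zero, sub_neg_eq_add] at h2
    exact ⟨harmonicAt_profile_comp (φ := fun z => z) hb analyticAt_id h1 h2, abs_profile_le hb h1 h2⟩
  have hmain : ∀ q : ℂ, 1 ≤ ‖q - ctrR ε δ 0‖ → 1 ≤ ‖q - ctrL ε δ 0‖ →
      HarmonicAt (fun z => (α + β) / 2 + (β - α) * profile (1 + ε / 2) z) q := fun q h1 h2 =>
    (harmonicAt_const _).add ((hprof q h1 h2).1.const_smul (c := β - α))
  refine ⟨fun q hq h1 h2 => ?_, ?_, fun q hq h1 h2 h3 => ?_, fun q hq h1 h2 => ?_⟩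
  · exact (hU q (hopen q (ball_subset_closedBall hq) h1 h2)).sub (hmain q h1.le h2.le)
  · refine (hUc.mono fun q hq => hclosed q hq.1 hq.2.1 hq.2.2).sub fun q hq => ?_
    exact (hmain q hq.2.1 hq.2.2).1.continuousAt.continuousWithinAt
  · rcases h3 with h3 | h3
    · rw [hβ q h3]
      rw [ctrR_zero] at h3
      rw [profile_eq_half hb h3]; ring
    · rw [hα q h3]
      rw [ctrL_zero, sub_neg_eq_add] at h3
      rw [profile_eq_neg_half hb h3]; ring
  · have h3 := abs_le.mp (hN q (hclosed q hq h1 h2) (hcoord q hq).2 (by linarith [(hcoord q hq).1]))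
    -- The subtracted function equals `β - (β - α) * (1/2 - profile)`.
    have h4 : |(β - α) * (1 / 2 - profile (1 + ε / 2) q)| ≤ |β - α| := by
      rw [abs_mul]
      have := abs_le.mp (hprof q h1 h2).2
      refine mul_le_of_le_one_right (abs_nonneg _) ?_
      rw [abs_le]; constructor <;> linarith
    have h5 := abs_le.mp h4
    rw [abs_le]; constructor <;> linarith

/-- Coordinates in which the gap between `D_{R0}` and `D_{R1}` is vertical. -/
noncomputable def rot (ε δ : ℝ) (z : ℂ) : ℂ := -Complex.I * (z - ⟨1 + ε / 2, 1 + δ / 2⟩)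

theorem norm_rot_sub (z : ℂ) : ‖rot ε δ z - ((1 + δ / 2 : ℝ) : ℂ)‖ = ‖z - ctrR ε δ 1‖ := by
  have : rot ε δ z - ((1 + δ / 2 : ℝ) : ℂ) = -Complex.I * (z - ctrR ε δ 1) := by
    apply Complex.ext <;> simp [rot, ctrR]; ring
  rw [this, norm_mul, norm_neg, Complex.norm_I, one_mul]

theorem norm_rot_add (z : ℂ) : ‖rot ε δ z + ((1 + δ / 2 : ℝ) : ℂ)‖ = ‖z - ctrR ε δ 0‖ := by
  have : rot ε δ z + ((1 + δ / 2 : ℝ) : ℂ) = -Complex.I * (z - ctrR ε δ 0) := by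
    apply Complex.ext <;> simp [rot, ctrR]
  rw [this, norm_mul, norm_neg, Complex.norm_I, one_mul]

/-- Subtracting the profile from a potential in the gap between `D_{R0}` and `D_{R1}`. -/
theorem vanishesNear_horizontal (hε : 0 < ε) (hδ : 0 < δ) {U : ℂ → ℝ} {α β N : ℝ}
    (hU : HarmonicOnNhd U (openExt ε δ)) (hUc : ContinuousOn U (closedExt ε δ))
    (hα : ∀ z, ‖z - ctrR ε δ 0‖ = 1 → U z = α) (hβ : ∀ z, ‖z - ctrR ε δ 1‖ = 1 → U z = β)
    (hN : ∀ z ∈ closedExt ε δ, |z.re| < 4 → |z.im| ≤ 3 → |U z - α| ≤ N) {p : ℂ}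
    (hp1 : 1 / 10 < p.re) (hp2 : p.re < 3) (hp3 : -(1 / 2) < p.im) (hp4 : p.im < 5 / 2) :
    VanishesNear (ctrR ε δ 0) (ctrR ε δ 1) p (1 / 10) (N + |β - α|)
      (fun z => U z - ((α + β) / 2 + (β - α) * profile (1 + δ / 2) (rot ε δ z))) := by
  have hb : 1 < 1 + δ / 2 := by linarith
  have hcoord : ∀ q ∈ closedBall p (1 / 10), 0 < q.re ∧ q.re < 4 ∧ -1 < q.im ∧ q.im < 3 := by
    intro q hq
    obtain ⟨h1, h2⟩ := coords_of_mem_closedBall hq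
    rw [abs_le] at h1 h2
    refine ⟨?_, ?_, ?_, ?_⟩ <;> linarith
  have hopen : ∀ q ∈ closedBall p (1 / 10), 1 < ‖q - ctrR ε δ 0‖ → 1 < ‖q - ctrR ε δ 1‖ →
      q ∈ openExt ε δ := by
    intro q hq h1 h2 n
    obtain ⟨a1, a2, a3, a4⟩ := hcoord q hq
    obtain ⟨h3, h4⟩ := one_lt_norm_sub_of_right hε hδ a1 a3 a4 n
    refine ⟨h3, ?_⟩
    by_cases hn : n = 0
    · rw [hn]; exact h1
    by_cases hn1 : n = 1
    · rw [hn1]; exact h2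
    exact h4 hn hn1
  have hclosed : ∀ q ∈ closedBall p (1 / 10), 1 ≤ ‖q - ctrR ε δ 0‖ → 1 ≤ ‖q - ctrR ε δ 1‖ →
      q ∈ closedExt ε δ := by
    intro q hq h1 h2 n
    obtain ⟨a1, a2, a3, a4⟩ := hcoord q hq
    obtain ⟨h3, h4⟩ := one_lt_norm_sub_of_right hε hδ a1 a3 a4 n
    refine ⟨h3.le, ?_⟩
    by_cases hn : n = 0
    · rw [hn]; exact h1
    by_cases hn1 : n = 1
    · rw [hn1]; exact h2
    exact (h4 hn hn1).le
  have hprof : ∀ q : ℂ, 1 ≤ ‖q - ctrR ε δ 0‖ → 1 ≤ ‖q - ctrR ε δ 1‖ →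
      HarmonicAt (fun z => profile (1 + δ / 2) (rot ε δ z)) q ∧
        |profile (1 + δ / 2) (rot ε δ q)| ≤ 1 / 2 := by
    intro q h1 h2
    rw [← norm_rot_add] at h1
    rw [← norm_rot_sub] at h2
    refine ⟨harmonicAt_profile_comp hb ?_ h2 h1, abs_profile_le hb h2 h1⟩
    unfold rot
    fun_prop
  have hmain : ∀ q : ℂ, 1 ≤ ‖q - ctrR ε δ 0‖ → 1 ≤ ‖q - ctrR ε δ 1‖ →
      HarmonicAt (fun z => (α + β) / 2 + (β - α) * profile (1 + δ / 2) (rot ε δ z)) q :=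
    fun q h1 h2 => (harmonicAt_const _).add ((hprof q h1 h2).1.const_smul (c := β - α))
  refine ⟨fun q hq h1 h2 => ?_, ?_, fun q hq h1 h2 h3 => ?_, fun q hq h1 h2 => ?_⟩
  · exact (hU q (hopen q (ball_subset_closedBall hq) h1 h2)).sub (hmain q h1.le h2.le)
  · refine (hUc.mono fun q hq => hclosed q hq.1 hq.2.1 hq.2.2).sub fun q hq => ?_
    exact (hmain q hq.2.1 hq.2.2).1.continuousAt.continuousWithinAt
  · rcases h3 with h3 | h3
    · rw [hα q h3]
      rw [← norm_rot_add] at h3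
      rw [profile_eq_neg_half hb h3]; ring
    · rw [hβ q h3]
      rw [← norm_rot_sub] at h3
      rw [profile_eq_half hb h3]; ring
  · obtain ⟨a1, a2, a3, a4⟩ := hcoord q hq
    have h3 := abs_le.mp (hN q (hclosed q hq h1 h2) (by rw [abs_lt]; constructor <;> linarith)
      (by rw [abs_le]; constructor <;> linarith))
    have h4 : |(β - α) * (1 / 2 + profile (1 + δ / 2) (rot ε δ q))| ≤ |β - α| := by
      rw [abs_mul]
      have := abs_le.mp (hprof q h1 h2).2
      refine mul_le_of_le_one_right (abs_nonneg _) ?_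
      rw [abs_le]; constructor <;> linarith
    have h5 := abs_le.mp h4
    rw [abs_le]; constructor <;> linarith

/-- Bound of the normal derivative at a boundary point. -/
theorem VanishesNear.abs_normalDeriv_le {c₁ c₂ E : ℂ} {ρ M G : ℝ} {v : ℂ → ℝ}
    (h : VanishesNear c₁ c₂ (c₁ + E) ρ M v) (hρ : 0 < ρ) (hρ1 : ρ ≤ 1) (hE : ‖E‖ = 1)
    (hc : 1 < ‖c₁ + E - c₂‖)
    (hG : HasDerivWithinAt (fun t : ℝ => v (c₁ + (1 - t : ℝ) * E)) G (Iic 0) 0) :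
    |G| ≤ 64 * M / ρ ^ 2 := by
  have h0 : v (c₁ + E) = 0 := h.zero _ (mem_closedBall_self hρ.le) (by simp [hE]) hc.le
    (Or.inl (by simp [hE]))
  rw [hasDerivWithinAt_iff_tendsto_slope] at hG
  have hset : Iic (0 : ℝ) \ {0} = Iio 0 := Iic_sdiff_right
  rw [hset] at hG
  refine le_of_tendsto hG.abs ?_
  have hc2 : ∀ᶠ t : ℝ in 𝓝[<] 0, 1 < ‖c₁ + (1 - t : ℝ) * E - c₂‖ := by
    refine nhdsWithin_le_nhds ?_
    have hcont : Continuous fun t : ℝ => ‖c₁ + (1 - t : ℝ) * E - c₂‖ := by fun_prop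
    refine hcont.continuousAt.eventually (lt_mem_nhds ?_)
    simpa using hc
  have ht : ∀ᶠ t : ℝ in 𝓝[<] 0, -(ρ / 2) < t := nhdsWithin_le_nhds (lt_mem_nhds (by linarith))
  filter_upwards [hc2, ht, self_mem_nhdsWithin] with t ht1 ht2 ht3
  have ht3 : t < 0 := ht3
  have hn : ‖c₁ + (1 - t : ℝ) * E - c₁‖ = 1 - t := by
    rw [add_sub_cancel_left, norm_mul, hE, mul_one, Complex.norm_real, Real.norm_eq_abs,
      abs_of_pos (by linarith)]
  have hmem : c₁ + (1 - t : ℝ) * E ∈ closedBall (c₁ + E) (ρ / 2) := by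
    rw [mem_closedBall, dist_eq_norm]
    have : c₁ + (1 - t : ℝ) * E - (c₁ + E) = ((-t : ℝ) : ℂ) * E := by push_cast; ring
    rw [this, norm_mul, hE, mul_one, Complex.norm_real, Real.norm_eq_abs, abs_of_pos (by linarith)]
    linarith
  -- The linear growth bound on balls of radius `ρ / 2` controls the difference quotients from
  -- outside; halving the radius turns `16` into `64`.
  have hb := (h.shrink hmem).abs_le (by linarith) (by linarith) (by rw [hn]; linarith) ht1.le
  rw [hn] at hb
  simp only [slope, sub_zero, vsub_eq_sub, smul_eq_mul, Complex.ofReal_one, one_mul]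
  rw [h0, sub_zero, abs_mul, abs_inv, abs_of_neg ht3, inv_mul_le_iff₀ (by linarith)]
  refine hb.trans (le_of_eq ?_)
  ring

/-! ### Symmetrization and the normal derivative on the right disk -/

/-- The symmetrization of a function in the vertical direction. -/
noncomputable def symm (u : ℂ → ℝ) (z : ℂ) : ℝ := u z + u ((starRingEnd ℂ) z)

theorem norm_conj_sub_ctrR (z : ℂ) (n : ℤ) :
    ‖(starRingEnd ℂ) z - ctrR ε δ n‖ = ‖z - ctrR ε δ (-n)‖ := by
  have : (starRingEnd ℂ) z - ctrR ε δ n = (starRingEnd ℂ) (z - ctrR ε δ (-n)) := by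
    apply Complex.ext <;> simp [ctrR]
  rw [this, RCLike.norm_conj]

theorem norm_conj_sub_ctrL (z : ℂ) (n : ℤ) :
    ‖(starRingEnd ℂ) z - ctrL ε δ n‖ = ‖z - ctrL ε δ (-n)‖ := by
  have : (starRingEnd ℂ) z - ctrL ε δ n = (starRingEnd ℂ) (z - ctrL ε δ (-n)) := by
    apply Complex.ext <;> simp [ctrL]
  rw [this, RCLike.norm_conj]

theorem conj_mem_openExt {z : ℂ} (hz : z ∈ openExt ε δ) : (starRingEnd ℂ) z ∈ openExt ε δ :=
  fun n => by rw [norm_conj_sub_ctrL, norm_conj_sub_ctrR]; exact hz (-n)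

theorem conj_mem_closedExt {z : ℂ} (hz : z ∈ closedExt ε δ) : (starRingEnd ℂ) z ∈ closedExt ε δ :=
  fun n => by rw [norm_conj_sub_ctrL, norm_conj_sub_ctrR]; exact hz (-n)

namespace BoundedSolution

variable {M κ cL cR : ℝ} {u : ℂ → ℝ}

theorem symm_harmonic (h : BoundedSolution ε δ M κ u cL cR) :
    HarmonicOnNhd (symm u) (openExt ε δ) := fun z hz =>
  (h.harmonic z hz).add (harmonicAt_comp_isometry Complex.conjLIE
    (h.harmonic _ (conj_mem_openExt hz)))

theorem symm_cont (h : BoundedSolution ε δ M κ u cL cR) :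
    ContinuousOn (symm u) (closedExt ε δ) :=
  h.cont.add (h.cont.comp Complex.continuous_conj.continuousOn fun _ hz => conj_mem_closedExt hz)

theorem symm_bound (h : BoundedSolution ε δ M κ u cL cR) :
    ∀ z ∈ closedExt ε δ, |z.re| < 4 → |z.im| ≤ 3 →
      |symm u z - 2 * cR| ≤ 8 * M + 2 * |cR - cL| := by
  intro z hz h1 h2
  have h3 := abs_le.mp (h.bound z hz h1 h2)
  have h4 := abs_le.mp (h.bound _ (conj_mem_closedExt hz) (by simpa using h1) (by simpa using h2))
  unfold symm
  rw [abs_le]; constructor <;> linarith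

/-- The normal derivative of the symmetrized potential on `∂D_{R0}`. -/
theorem abs_normalDeriv_sub_le (h : BoundedSolution ε δ M κ u cL cR) (hε : 0 < ε) (hε1 : ε < 1 / 4)
    (hδ : 0 < δ) {θ G : ℝ} (hθ : 0 ≤ Real.sin θ)
    (hG : HasDerivWithinAt (fun t : ℝ => symm u (ctrR ε δ 0 + (1 - t : ℝ) *
      Complex.exp (θ * Complex.I))) G (Iic 0) 0) :
    |G - (cR - cL) * (pole (1 + ε / 2) / height (1 + ε / 2) / (1 + ε / 2 + Real.cos θ))| ≤
      52000 * M + 26000 * |cR - cL| := by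
  have hb : 1 < 1 + ε / 2 := by linarith
  have hM : 0 ≤ M := by linarith [h.jump_le, abs_nonneg κ]
  set E := Complex.exp (θ * Complex.I) with hE
  have hEn : ‖E‖ = 1 := Complex.norm_exp_ofReal_mul_I θ
  have hEre : E.re = Real.cos θ := Complex.exp_ofReal_mul_I_re θ
  have hEim : E.im = Real.sin θ := Complex.exp_ofReal_mul_I_im θ
  have hpre : (ctrR ε δ 0 + E).re = 1 + ε / 2 + Real.cos θ := by simp [ctrR, hEre]
  have hpim : (ctrR ε δ 0 + E).im = Real.sin θ := by simp [ctrR, hEim]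
  have hsl : ∀ z, ‖z - ctrL ε δ 0‖ = 1 → symm u z = 2 * cL := fun z hz => by
    rw [symm, h.left z hz, h.left _ (by rw [norm_conj_sub_ctrL]; simpa using hz)]; ring
  have hsr : ∀ z, ‖z - ctrR ε δ 0‖ = 1 → symm u z = 2 * cR := fun z hz => by
    rw [symm, h.right z hz, h.right _ (by rw [norm_conj_sub_ctrR]; simpa using hz)]; ring
  -- Here the jumps `κ` and `-κ` cancel: there is no potential difference between `D_{R0}` and
  -- `D_{R1}`, and so no singular flux through the horizontal gap.
  have hsu : ∀ z, ‖z - ctrR ε δ 1‖ = 1 → symm u z = 2 * cR := fun z hz => by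
    rw [symm, h.right_up z hz, h.right_down _ (by rw [norm_conj_sub_ctrR]; simpa using hz)]; ring
  have hcos := Real.neg_one_le_cos θ
  have hcos1 := Real.cos_le_one θ
  have hsin1 := Real.sin_le_one θ
  -- The arc `cos θ ≤ -1/2` faces the vertical gap, and there the profile supplies the main term. On
  -- the rest of the upper half circle the normal derivative is itself bounded, and the term
  -- compared with it is at most `4 |cR - cL|`.
  rcases le_or_gt (Real.cos θ) (-(1 / 2)) with hc | hc
  · have hsin : |Real.sin θ| < 7 / 8 := by
      rw [abs_of_nonneg hθ]
      nlinarith [Real.sin_sq_add_cos_sq θ]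
    have hv := vanishesNear_vertical hε hδ h.symm_harmonic h.symm_cont hsl hsr h.symm_bound
      (p := ctrR ε δ 0 + E) (by rw [hpim]; exact hsin)
      (by rw [hpre, abs_of_pos (by linarith)]; linarith)
    have hfar : 1 < ‖ctrR ε δ 0 + E - ctrL ε δ 0‖ := by
      apply one_lt_norm_of_re
      rw [hpre, lt_abs]; left; simp only [ctrL]; linarith
    have hpd : HasDerivAt (fun t : ℝ => profile (1 + ε / 2) (ctrR ε δ 0 + (1 - t : ℝ) * E))
        (pole (1 + ε / 2) / height (1 + ε / 2) / (2 * (1 + ε / 2 + Real.cos θ))) 0 := by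
      have h1 : HasDerivAt (fun t : ℝ => ctrR ε δ 0 + ((1 - t : ℝ) : ℂ) * E) (-E) 0 := by
        have h2 : HasDerivAt (fun t : ℝ => ((1 - t : ℝ) : ℂ)) ((-1 : ℝ) : ℂ) 0 :=
          ((hasDerivAt_id (0 : ℝ)).const_sub 1).ofReal_comp
        have h3 := (h2.mul_const E).const_add (ctrR ε δ 0)
        simpa using h3
      have h2 : HasFDerivAt (profile (1 + ε / 2)) (Complex.reCLM ∘L
          (profileDeriv (1 + ε / 2) (ctrR ε δ 0 + E) • (1 : ℂ →L[ℝ] ℂ)))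
          (ctrR ε δ 0 + ((1 - (0 : ℝ) : ℝ) : ℂ) * E) := by
        rw [sub_zero, Complex.ofReal_one, one_mul]
        refine hasFDerivAt_profile hb ?_ ?_
        · rw [ctrR_zero, add_sub_cancel_left, hEn]
        · have := hfar.le
          rwa [ctrL_zero, sub_neg_eq_add] at this
      have h3 := h2.comp_hasDerivAt (0 : ℝ) h1
      refine h3.congr_deriv ?_
      have h4 := profileDeriv_normal hb θ
      rw [← hE, ← ctrR_zero (ε := ε) (δ := δ)] at h4
      rw [← h4]
      simp
    have hder := hG.sub (((hpd.const_mul (2 * cR - 2 * cL)).const_add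
      ((2 * cL + 2 * cR) / 2)).hasDerivWithinAt)
    have hbd := hv.abs_normalDeriv_le (by norm_num) (by norm_num) hEn hfar hder
    have e1 : (2 * cR - 2 * cL) * (pole (1 + ε / 2) / height (1 + ε / 2) /
        (2 * (1 + ε / 2 + Real.cos θ))) =
        (cR - cL) * (pole (1 + ε / 2) / height (1 + ε / 2) / (1 + ε / 2 + Real.cos θ)) := by
      have : (1 + ε / 2 + Real.cos θ) ≠ 0 := by linarith
      field_simp
    rw [e1] at hbd
    refine hbd.trans ?_
    have e2 : |2 * cR - 2 * cL| = 2 * |cR - cL| := by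
      rw [← mul_sub, abs_mul, abs_two]
    rw [e2]
    have := abs_nonneg (cR - cL)
    rw [div_le_iff₀ (by norm_num)]
    linarith
  · have hv := vanishesNear_horizontal hε hδ h.symm_harmonic h.symm_cont hsr hsu h.symm_bound
      (p := ctrR ε δ 0 + E) (by rw [hpre]; linarith) (by rw [hpre]; linarith)
      (by rw [hpim]; linarith) (by rw [hpim]; linarith)
    have hfar : 1 < ‖ctrR ε δ 0 + E - ctrR ε δ 1‖ := by
      apply one_lt_norm_of_im
      rw [hpim, lt_abs]; right; simp only [ctrR]; push_cast; linarith
    have hder := hG.sub_const ((2 * cR + 2 * cR) / 2)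
    have hbd := hv.abs_normalDeriv_le (G := G) (by norm_num) (by norm_num) hEn hfar (by
      simpa using hder)
    rw [sub_self, abs_zero, add_zero] at hbd
    have h2 : |(cR - cL) * (pole (1 + ε / 2) / height (1 + ε / 2) / (1 + ε / 2 + Real.cos θ))| ≤
        |cR - cL| * 4 := by
      rw [abs_mul]
      refine mul_le_mul_of_nonneg_left ?_ (abs_nonneg _)
      obtain ⟨k1, k2⟩ := pole_div_height hb
      rw [abs_of_nonneg (div_nonneg (by linarith) (by linarith)), div_le_iff₀ (by linarith)]
      linarith
    refine (abs_sub _ _).trans ?_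
    have h3 : 64 * (8 * M + 2 * |cR - cL|) / (1 / 10) ^ 2 = 51200 * M + 12800 * |cR - cL| := by
      ring
    have := abs_nonneg (cR - cL)
    linarith

end BoundedSolution

end TwoRows

namespace TwoRows

open InnerProductSpace Metric Filter Topology

variable {ε δ : ℝ} {M κ cL cR lam : ℝ} {H u : ℂ → ℝ}

/-! ### The potential difference across the vertical gap -/

/-- On `[π, π + √ε]` one has `1 + cos θ ≤ ε / 2`, so the integrand is at least `1 / ε` on an
interval of length `√ε`. -/
theorem inv_sqrt_le_integral (hε : 0 < ε) (hε1 : ε < 1) :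
    1 / √ε ≤ ∫ θ in (0 : ℝ)..(2 * Real.pi), pole (1 + ε / 2) / height (1 + ε / 2) /
      (1 + ε / 2 + Real.cos θ) := by
  have hb : 1 < 1 + ε / 2 := by linarith
  obtain ⟨k1, -⟩ := pole_div_height hb
  have hpos : ∀ θ, 0 < 1 + ε / 2 + Real.cos θ := fun θ => by linarith [Real.neg_one_le_cos θ]
  have hc : Continuous fun θ => pole (1 + ε / 2) / height (1 + ε / 2) /
      (1 + ε / 2 + Real.cos θ) :=
    continuous_const.div (by fun_prop) fun θ => (hpos θ).ne'
  have hs0 : 0 < √ε := Real.sqrt_pos.mpr hε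
  have hs1 : √ε < 1 := by rw [Real.sqrt_lt' one_pos]; linarith
  have hss : √ε ^ 2 = ε := Real.sq_sqrt hε.le
  have hpi := Real.pi_gt_three
  refine le_trans ?_ (intervalIntegral.integral_mono_interval (a := Real.pi) (b := Real.pi + √ε)
    (by linarith) (by linarith) (by linarith)
    (Eventually.of_forall fun θ => div_nonneg (by linarith) (hpos θ).le) (hc.intervalIntegrable _ _))
  have h1 : ∫ θ in Real.pi..Real.pi + √ε, (1 / ε : ℝ) = 1 / √ε := by
    rw [intervalIntegral.integral_const, add_sub_cancel_left, smul_eq_mul]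
    nth_rewrite 2 [← hss]
    field_simp
  rw [← h1]
  refine intervalIntegral.integral_mono_on (by linarith) (by simp) (hc.intervalIntegrable _ _) ?_
  intro θ hθ
  have h2 : 1 + ε / 2 + Real.cos θ ≤ ε := by
    have h3 := Real.one_sub_sq_div_two_le_cos (x := θ - Real.pi)
    rw [Real.cos_sub_pi] at h3
    have h4 : (θ - Real.pi) ^ 2 ≤ ε := by
      rw [← hss]
      exact pow_le_pow_left₀ (by linarith [hθ.1]) (by linarith [hθ.2]) 2
    linarith
  exact (one_div_le_one_div_of_le (hpos θ) h2).trans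
    (div_le_div_of_nonneg_right k1 (hpos θ).le)

/-- The zero flux condition forces the potential difference to be of order `√ε`. -/
theorem BoundedSolution.abs_sub_le (hb : BoundedSolution ε δ M κ u cL cR) (hε : 0 < ε)
    (hε1 : ε < 1 / 10 ^ 12) (hδ : 0 < δ)
    (hflux : ∃ g : ℝ → ℝ, (∀ θ : ℝ, HasDerivWithinAt
      (fun t : ℝ => u (ctrR ε δ 0 + (1 - t : ℝ) * Complex.exp (θ * Complex.I))) (g θ) (Iic 0) 0) ∧
      IntervalIntegrable g volume 0 (2 * Real.pi) ∧ ∫ θ in (0 : ℝ)..(2 * Real.pi), g θ = 0) :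
    |cR - cL| ≤ 500000 * √ε * M := by
  obtain ⟨g, hg, hgi, hg0⟩ := hflux
  have hM : 0 ≤ M := by linarith [hb.jump_le, abs_nonneg κ]
  set d := cR - cL with hd
  set N := 52000 * M + 26000 * |d| with hN
  set φ : ℝ → ℝ := fun θ => pole (1 + ε / 2) / height (1 + ε / 2) / (1 + ε / 2 + Real.cos θ) with hφ
  -- Conjugation is `θ ↦ 2π - θ` on the circle, so the symmetrized potential has normal derivative
  -- `g θ + g (2π - θ)`, again of zero flux.
  have hconj : ∀ θ t : ℝ, (starRingEnd ℂ) (ctrR ε δ 0 + (1 - t : ℝ) * Complex.exp (θ * Complex.I)) =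
      ctrR ε δ 0 + (1 - t : ℝ) * Complex.exp ((2 * Real.pi - θ : ℝ) * Complex.I) := by
    intro θ t
    have h1 : Complex.exp ((2 * Real.pi - θ : ℝ) * Complex.I) =
        (starRingEnd ℂ) (Complex.exp (θ * Complex.I)) := by
      rw [← Complex.exp_conj, map_mul, Complex.conj_ofReal, Complex.conj_I,
        ← Complex.exp_periodic (θ * -Complex.I)]
      congr 1
      push_cast; ring
    rw [h1, map_add, map_mul, Complex.conj_ofReal, ctrR_zero, Complex.conj_ofReal]
  have hder : ∀ θ : ℝ, HasDerivWithinAt (fun t : ℝ => symm u (ctrR ε δ 0 + (1 - t : ℝ) *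
      Complex.exp (θ * Complex.I))) (g θ + g (2 * Real.pi - θ)) (Iic 0) 0 := by
    intro θ
    simp only [symm, hconj]
    exact (hg θ).add (hg (2 * Real.pi - θ))
  have hpt : ∀ θ : ℝ, |g θ + g (2 * Real.pi - θ) - d * φ θ| ≤ N := by
    intro θ
    rcases le_total 0 (Real.sin θ) with h | h
    · exact hb.abs_normalDeriv_sub_le hε (by linarith) hδ h (hder θ)
    · have h2 := hb.abs_normalDeriv_sub_le hε (by linarith) hδ (θ := 2 * Real.pi - θ)
        (by rw [Real.sin_two_pi_sub]; linarith) (hder _)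
      rw [Real.cos_two_pi_sub, sub_sub_cancel, add_comm (g (2 * Real.pi - θ))] at h2
      exact h2
  have hφc : Continuous φ := continuous_const.div (by fun_prop) fun θ => by
    have := Real.neg_one_le_cos θ; exact (by linarith : 0 < 1 + ε / 2 + Real.cos θ).ne'
  have hφi : IntervalIntegrable (fun θ => d * φ θ) volume 0 (2 * Real.pi) :=
    (continuous_const.mul hφc).intervalIntegrable _ _
  have hgi' : IntervalIntegrable (fun θ => g (2 * Real.pi - θ)) volume 0 (2 * Real.pi) := by
    have := (hgi.comp_sub_left (2 * Real.pi)).symm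
    simpa using this
  have hg0' : ∫ θ in (0 : ℝ)..(2 * Real.pi), g (2 * Real.pi - θ) = 0 := by
    rw [intervalIntegral.integral_comp_sub_left (fun θ => g θ)]
    simpa using hg0
  -- With zero flux only the explicit term is left, so its integral must itself be at most `2π N`.
  have hint : ∫ θ in (0 : ℝ)..(2 * Real.pi), (g θ + g (2 * Real.pi - θ) - d * φ θ) =
      -(d * ∫ θ in (0 : ℝ)..(2 * Real.pi), φ θ) := by
    rw [intervalIntegral.integral_sub (hgi.add hgi') hφi,
      intervalIntegral.integral_add hgi hgi', hg0, hg0', intervalIntegral.integral_const_mul]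
    ring
  have hle := intervalIntegral.norm_integral_le_of_norm_le_const (a := 0) (b := 2 * Real.pi)
    (C := N) (f := fun θ => g θ + g (2 * Real.pi - θ) - d * φ θ) fun θ _ => hpt θ
  have hI := inv_sqrt_le_integral hε (by linarith)
  have hs0 : 0 < √ε := Real.sqrt_pos.mpr hε
  have hs1 : √ε ≤ 1 / 10 ^ 6 := by
    rw [Real.sqrt_le_left (by norm_num)]; norm_num; linarith
  have hpi := Real.pi_lt_d2
  have hd0 := abs_nonneg d
  rw [hint, norm_neg, norm_mul, Real.norm_eq_abs, Real.norm_eq_abs, sub_zero,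
    abs_of_pos (show 0 < 2 * Real.pi by positivity),
    abs_of_nonneg (le_trans (by positivity) hI)] at hle
  have h3 : |d| * (1 / √ε) ≤ N * 7 :=
    (mul_le_mul_of_nonneg_left hI hd0).trans (hle.trans
      (mul_le_mul_of_nonneg_left (by linarith) (by positivity)))
  rw [mul_one_div, div_le_iff₀ hs0, hN] at h3
  -- The part `7 * 26000 * |d|` of the right side carries a factor `√ε ≤ 10⁻⁶` and is absorbed on
  -- the left; this is what the threshold `10⁻¹²` is for.
  nlinarith [mul_nonneg hd0 hs0.le, mul_nonneg hM hs0.le]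

/-! ### The gradient in the gaps -/

theorem one_lt_norm_of_gap {e x y : ℝ} (hx : |x| < 1 + e / 2 - √(1 - y ^ 2)) :
    1 < ‖(⟨x, y⟩ : ℂ) - ((1 + e / 2 : ℝ) : ℂ)‖ ∧ 1 < ‖(⟨x, y⟩ : ℂ) + ((1 + e / 2 : ℝ) : ℂ)‖ := by
  have hs := Real.sqrt_nonneg (1 - y ^ 2)
  -- No bound on `y` is needed: for `y² > 1` the root is `0` by convention and the conclusion still
  -- holds.
  have key : ∀ t : ℝ, √(1 - y ^ 2) < t → 1 < t ^ 2 + y ^ 2 := by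
    intro t ht
    have := Real.lt_sq_of_sqrt_lt ht
    linarith
  obtain ⟨h1, h2⟩ := abs_lt.mp hx
  constructor <;> rw [one_lt_norm_iff]
  · have := key (1 + e / 2 - x) (by linarith)
    simp only [Complex.sub_re, Complex.sub_im, Complex.ofReal_re, Complex.ofReal_im, sub_zero]
    nlinarith
  · have := key (1 + e / 2 + x) (by linarith)
    simp only [Complex.add_re, Complex.add_im, Complex.ofReal_re, Complex.ofReal_im, add_zero]
    nlinarith

theorem sqrt_three_div_two_lt : √3 / 2 < 7 / 8 := by
  have : √3 < 7 / 4 := by rw [Real.sqrt_lt' (by norm_num)]; norm_num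
  linarith

/-- From `2√e |y| ≤ e + y²` and the width of the gap. The cross term of the profile gradient is thus
only of size `1/√e`, which also bounds `S`. -/
theorem two_mul_abs_div_le {e x y : ℝ} (he : 0 < e) (hx : |x| ≤ 2 / 3 * (e + y ^ 2)) :
    |2 * x * y / (e + y ^ 2) ^ 2| ≤ 1 / √e := by
  have hs : 0 < √e := Real.sqrt_pos.mpr he
  have hss : √e ^ 2 = e := Real.sq_sqrt he.le
  have hh : 0 < e + y ^ 2 := by positivity
  rw [abs_div, abs_mul, abs_mul, abs_two, abs_of_pos (pow_pos hh 2), div_le_div_iff₀ (by positivity) hs]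
  have h1 : 2 * (√e * |y|) ≤ e + y ^ 2 := by
    nlinarith [sq_nonneg (√e - |y|), sq_abs y]
  have h2 := mul_le_mul hx h1 (by positivity) (by positivity)
  nlinarith [abs_nonneg x, abs_nonneg y]

/-- The cost in the cross term of replacing the jump of `H` by `λ`. -/
theorem abs_mul_le_of_le_inv_sqrt {a q : ℝ} (hM : 0 ≤ M) (hδ : 0 < δ) (hδ1 : δ < 1)
    (ha : |a| ≤ 12 * δ * M) (hq : |q| ≤ 1 / √δ) : |a * q| ≤ 12 * M := by
  have hs : 0 < √δ := Real.sqrt_pos.mpr hδ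
  have hss : √δ ^ 2 = δ := Real.sq_sqrt hδ.le
  have hs1 : √δ ≤ 1 := by rw [Real.sqrt_le_left (by norm_num)]; linarith
  rw [abs_mul]
  refine (mul_le_mul ha hq (abs_nonneg _) (by positivity)).trans ?_
  rw [mul_one_div, div_le_iff₀ hs]
  nth_rewrite 1 [← hss]
  nlinarith [mul_nonneg hM hs.le]

/-- The same cost in the main term: an error `O(δM)` against a factor of at most `1/δ`. -/
theorem abs_mul_one_div_le {a y : ℝ} (hM : 0 ≤ M) (hδ : 0 < δ) (ha : |a| ≤ 12 * δ * M) :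
    |a * (1 / (δ + y ^ 2))| ≤ 12 * M := by
  have hh : 0 < δ + y ^ 2 := by positivity
  rw [abs_mul, abs_of_pos (by positivity : 0 < 1 / (δ + y ^ 2)), mul_one_div, div_le_iff₀ hh]
  nlinarith [mul_nonneg hM (sq_nonneg y)]

/-- The gradient in the gap between `D_{L0}` and `D_{R0}`. -/
theorem BoundedSolution.gradient_vertical (h : BoundedSolution ε δ M κ u cL cR) (hε : 0 < ε)
    (hε1 : ε < 1 / 10 ^ 12) (hδ : 0 < δ) (hd : |cR - cL| ≤ 500000 * √ε * M) {z : ℂ}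
    (hz1 : |z.re| < 1 + ε / 2 - √(1 - z.im ^ 2)) (hz2 : |z.im| < √3 / 2) :
    |fderiv ℝ u z 1 - (cR - cL) / (ε + z.im ^ 2)| ≤ 1000000 * M ∧
      |fderiv ℝ u z Complex.I| ≤ 1000000 * M := by
  have hb : 1 < 1 + ε / 2 := by linarith
  have hM : 0 ≤ M := by linarith [h.jump_le, abs_nonneg κ]
  obtain ⟨hx, hy⟩ := abs_le_of_gap hε hz1 hz2
  obtain ⟨n1, n2⟩ := one_lt_norm_of_gap hz1
  rw [Complex.eta] at n1 n2
  have hs0 : 0 < √ε := Real.sqrt_pos.mpr hε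
  have hs1 : √ε ≤ 1 / 10 ^ 6 := by
    rw [Real.sqrt_le_left (by norm_num)]; norm_num; linarith
  have hd1 : |cR - cL| ≤ M / 2 := by nlinarith
  have hv := vanishesNear_vertical hε hδ h.harmonic h.cont h.left h.right h.bound (p := z)
    (hz2.trans sqrt_three_div_two_lt) (by linarith)
  have n1' : 1 < ‖z - ctrR ε δ 0‖ := by rw [ctrR_zero]; exact n1
  have n2' : 1 < ‖z - ctrL ε δ 0‖ := by rw [ctrL_zero, sub_neg_eq_add]; exact n2
  have hgrad := hv.norm_fderiv_le (by norm_num) (by norm_num) n1' n2'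
  have hzE : z ∈ openExt ε δ := mem_openExt_of_row hδ (n := 0) (by
    simp only [Int.cast_zero, zero_mul, sub_zero]
    linarith [sqrt_three_div_two_lt]) ⟨n2', n1'⟩
  have hu := ((h.harmonic z hzE).1.differentiableAt two_ne_zero).hasFDerivAt
  have hder := hu.sub (((hasFDerivAt_profile hb n1.le n2.le).const_mul (cR - cL)).const_add
    ((cL + cR) / 2))
  have hgrad2 := hgrad
  rw [HasFDerivAt.fderiv (f := fun z => u z - ((cL + cR) / 2 + (cR - cL) * profile (1 + ε / 2) z))
    hder] at hgrad2
  have herr := norm_profileDeriv_sub_le hε (by linarith) hx hy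
  rw [Complex.eta] at herr
  set D := profileDeriv (1 + ε / 2) z with hD
  have hK : 512 * (4 * M + |cR - cL| + |cR - cL|) / (1 / 10) ^ 2 ≤ 256000 * M := by
    rw [div_le_iff₀ (by norm_num)]; linarith
  have hre := (Complex.abs_re_le_norm _).trans herr
  have him := (Complex.abs_im_le_norm _).trans herr
  simp only [Complex.sub_re, Complex.add_re, Complex.ofReal_re, Complex.mul_re, Complex.I_re,
    Complex.I_im, Complex.ofReal_im, mul_zero, zero_mul, sub_zero, add_zero] at hre
  simp only [Complex.sub_im, Complex.add_im, Complex.ofReal_re, Complex.mul_im, Complex.I_re,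
    Complex.I_im, Complex.ofReal_im, mul_zero, mul_one, add_zero, zero_add] at him
  have a1 := (ContinuousLinearMap.le_opNorm _ (1 : ℂ)).trans
    (mul_le_mul_of_nonneg_right (hgrad2.trans hK) (norm_nonneg (1 : ℂ)))
  have a2 := (ContinuousLinearMap.le_opNorm _ Complex.I).trans
    (mul_le_mul_of_nonneg_right (hgrad2.trans hK) (norm_nonneg Complex.I))
  simp only [sub_apply, smul_apply, ContinuousLinearMap.comp_apply, one_apply_eq_self,
    Complex.reCLM_apply, smul_eq_mul, mul_one, norm_one, Complex.norm_I, Real.norm_eq_abs,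
    Complex.mul_I_re] at a1 a2
  have hm : ∀ t : ℝ, |t| ≤ 10 → |(cR - cL) * t| ≤ 10 * M := by
    intro t ht
    rw [abs_mul]
    nlinarith [abs_nonneg t, abs_nonneg (cR - cL)]
  have m1 := abs_le.mp (hm _ hre)
  have m2 := abs_le.mp (hm _ him)
  have hq := two_mul_abs_div_le hε hx
  -- The cross term is absorbed in the remainder because the potential difference is already `O(√ε
  -- M)`. So the vertical expansion needs no analogue of `S`.
  have m3 : |(cR - cL) * (2 * z.re * z.im / (ε + z.im ^ 2) ^ 2)| ≤ 500000 * M := by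
    rw [abs_mul]
    refine (mul_le_mul hd hq (abs_nonneg _) (by positivity)).trans (le_of_eq ?_)
    field_simp
  rw [abs_le] at a1 a2 m3
  have e1 : (cR - cL) * (D.re - 1 / (ε + z.im ^ 2)) =
      (cR - cL) * D.re - (cR - cL) / (ε + z.im ^ 2) := by ring
  rw [mul_sub] at m2
  rw [e1] at m1
  constructor <;> rw [abs_le] <;> constructor <;> linarith

/-- The gradient in the gap between `D_{R0}` and `D_{R1}`. -/
theorem BoundedSolution.gradient_horizontal (h : BoundedSolution ε δ M κ u cL cR) (hε : 0 < ε)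
    (hε1 : ε < 1 / 10 ^ 12) (hδ : 0 < δ) (hδ1 : δ < 1 / 10 ^ 12)
    (hd : |cR - cL| ≤ 500000 * √ε * M) (hlam : |κ - lam| ≤ 12 * δ * M) {z : ℂ}
    (hz1 : |z.im - 1 - δ / 2| < 1 + δ / 2 - √(1 - (z.re - 1 - ε / 2) ^ 2))
    (hz2 : |z.re - 1 - ε / 2| < √3 / 2) :
    |fderiv ℝ u z 1 - lam * (-2 * (z.re - 1 - ε / 2) * (z.im - 1 - δ / 2) /
      ((z.re - 1 - ε / 2) ^ 2 + δ) ^ 2)| ≤ 1000000 * M ∧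
    |fderiv ℝ u z Complex.I - lam / (δ + (z.re - 1 - ε / 2) ^ 2)| ≤ 1000000 * M := by
  have hb : 1 < 1 + δ / 2 := by linarith
  have hM : 0 ≤ M := by linarith [h.jump_le, abs_nonneg κ]
  set X := z.re - 1 - ε / 2 with hX
  set Y := z.im - 1 - δ / 2 with hY
  have hz1' : |Y| < 1 + δ / 2 - √(1 - (-X) ^ 2) := by rw [neg_sq]; exact hz1
  have hz2' : |-X| < √3 / 2 := by rw [abs_neg]; exact hz2
  obtain ⟨hx, hy⟩ := abs_le_of_gap hδ hz1' hz2'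
  obtain ⟨n1, n2⟩ := one_lt_norm_of_gap hz1'
  -- After rotation the transverse coordinate is `Y` and the coordinate along the gap is `-X`; the
  -- sign change produces the minus sign in `S`.
  have hrot : rot ε δ z = ⟨Y, -X⟩ := by
    apply Complex.ext <;> simp [rot, hX, hY] <;> ring
  have hs0 : 0 < √ε := Real.sqrt_pos.mpr hε
  have hs1 : √ε ≤ 1 / 10 ^ 6 := by
    rw [Real.sqrt_le_left (by norm_num)]; norm_num; linarith
  have hd1 : |cR - cL| ≤ M / 2 := by nlinarith
  have hz3 := abs_lt.mp (hz2.trans sqrt_three_div_two_lt)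
  have hY1 := abs_le.mp hx
  have hv := vanishesNear_horizontal hε hδ h.harmonic h.cont h.right h.right_up h.bound (p := z)
    (by linarith) (by linarith) (by linarith) (by linarith)
  rw [← hrot] at n1 n2
  have n1' : 1 < ‖z - ctrR ε δ 1‖ := by rw [← norm_rot_sub]; exact n1
  have n2' : 1 < ‖z - ctrR ε δ 0‖ := by rw [← norm_rot_add]; exact n2
  have hgrad := hv.norm_fderiv_le (by norm_num) (by norm_num) n2' n1'
  have hzE : z ∈ openExt ε δ := by
    intro n
    obtain ⟨h3, h4⟩ := one_lt_norm_sub_of_right (q := z) hε hδ (by linarith) (by linarith)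
      (by linarith) n
    refine ⟨h3, ?_⟩
    by_cases hn : n = 0
    · rw [hn]; exact n2'
    by_cases hn1 : n = 1
    · rw [hn1]; exact n1'
    exact h4 hn hn1
  have hu := ((h.harmonic z hzE).1.differentiableAt two_ne_zero).hasFDerivAt
  have hrotd : HasFDerivAt (rot ε δ) ((-Complex.I) • (1 : ℂ →L[ℝ] ℂ)) z := by
    have h1 : HasDerivAt (rot ε δ) (-Complex.I) z := by
      have := ((hasDerivAt_id z).sub_const (⟨1 + ε / 2, 1 + δ / 2⟩ : ℂ)).const_mul (-Complex.I)
      rw [mul_one] at this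
      exact this
    exact h1.complexToReal_fderiv
  have hder := hu.sub ((((hasFDerivAt_profile hb n1.le n2.le).comp z hrotd).const_mul
    (cR + κ - cR)).const_add ((cR + (cR + κ)) / 2))
  have hgrad2 := hgrad
  rw [HasFDerivAt.fderiv (f := fun z => u z - ((cR + (cR + κ)) / 2 + (cR + κ - cR) *
    profile (1 + δ / 2) (rot ε δ z))) hder] at hgrad2
  have herr := norm_profileDeriv_sub_le hδ (by linarith) hx hy
  rw [← hrot] at herr
  set D := profileDeriv (1 + δ / 2) (rot ε δ z) with hD
  rw [add_sub_cancel_left] at hgrad2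
  have hκ := h.jump_le
  have hK : 512 * (4 * M + |cR - cL| + |κ|) / (1 / 10) ^ 2 ≤ 332800 * M := by
    rw [div_le_iff₀ (by norm_num)]; linarith
  have hre := (Complex.abs_re_le_norm _).trans herr
  have him := (Complex.abs_im_le_norm _).trans herr
  simp only [Complex.sub_re, Complex.add_re, Complex.ofReal_re, Complex.mul_re, Complex.I_re,
    Complex.I_im, Complex.ofReal_im, mul_zero, zero_mul, sub_zero, add_zero] at hre
  simp only [Complex.sub_im, Complex.add_im, Complex.ofReal_re, Complex.mul_im, Complex.I_re,
    Complex.I_im, Complex.ofReal_im, mul_zero, mul_one, add_zero, zero_add] at him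
  have a1 := (ContinuousLinearMap.le_opNorm _ (1 : ℂ)).trans
    (mul_le_mul_of_nonneg_right (hgrad2.trans hK) (norm_nonneg (1 : ℂ)))
  have a2 := (ContinuousLinearMap.le_opNorm _ Complex.I).trans
    (mul_le_mul_of_nonneg_right (hgrad2.trans hK) (norm_nonneg Complex.I))
  simp only [sub_apply, smul_apply, ContinuousLinearMap.comp_apply, one_apply_eq_self,
    Complex.reCLM_apply, smul_eq_mul, mul_one, norm_one, Complex.norm_I, Real.norm_eq_abs,
    neg_mul, mul_neg, Complex.I_mul_I, neg_neg, Complex.neg_re, Complex.mul_I_re] at a1 a2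
  have hm : ∀ t : ℝ, |t| ≤ 10 → |κ * t| ≤ 20 * M := by
    intro t ht
    rw [abs_mul]
    nlinarith [abs_nonneg t, abs_nonneg κ]
  have m1 := abs_le.mp (hm _ hre)
  have m2 := abs_le.mp (hm _ him)
  have hq := two_mul_abs_div_le hδ hx
  -- Here the exact potential difference `κ` is traded for `lam`.
  have m3 := abs_mul_le_of_le_inv_sqrt hM hδ (by linarith) hlam hq
  have m4 := abs_mul_one_div_le (y := -X) hM hδ hlam
  rw [abs_le] at a1 a2 m3 m4
  have e2 : lam * (-2 * X * Y / (X ^ 2 + δ) ^ 2) = lam * (2 * Y * -X / (δ + (-X) ^ 2) ^ 2) := by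
    rw [neg_sq, add_comm (X ^ 2)]; ring
  have e1 : lam / (δ + X ^ 2) = lam * (1 / (δ + (-X) ^ 2)) := by rw [neg_sq]; ring
  rw [e1, e2]
  rw [mul_sub] at m1 m2
  rw [sub_mul] at m3 m4
  constructor <;> rw [abs_le] <;> constructor <;> linarith

end TwoRows

namespace TwoRows

open InnerProductSpace Metric Filter Topology

variable {ε δ : ℝ}

/-! ### Transport between the Euclidean plane and the complex plane -/

/-- The isometry `x + iy ↦ (x, y)`. -/
noncomputable def toPlane : ℂ ≃ₗᵢ[ℝ] Plane := Complex.orthonormalBasisOneI.repr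

theorem toPlane_apply (z : ℂ) : toPlane z = !₂[z.re, z.im] := by
  ext i
  fin_cases i <;> simp [toPlane]

@[simp] theorem toPlane_zero_coord (z : ℂ) : toPlane z 0 = z.re := by simp [toPlane_apply]

@[simp] theorem toPlane_one_coord (z : ℂ) : toPlane z 1 = z.im := by simp [toPlane_apply]

theorem toPlane_ctrR (n : ℤ) : toPlane (ctrR ε δ n) = centerR ε δ n := by
  rw [toPlane_apply]; rfl

theorem toPlane_ctrL (n : ℤ) : toPlane (ctrL ε δ n) = centerL ε δ n := by
  rw [toPlane_apply]; rfl

theorem toPlane_per : toPlane (per δ) = period δ := by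
  rw [toPlane_apply]; rfl

theorem toPlane_exp (θ : ℝ) : toPlane (Complex.exp (θ * Complex.I)) = circleVec θ := by
  rw [toPlane_apply, Complex.exp_ofReal_mul_I_re, Complex.exp_ofReal_mul_I_im]; rfl

theorem mem_diskR_iff (z : ℂ) (n : ℤ) : toPlane z ∈ diskR ε δ n ↔ ‖z - ctrR ε δ n‖ < 1 := by
  rw [diskR, mem_ball, ← toPlane_ctrR, toPlane.dist_map, dist_eq_norm]

theorem mem_diskL_iff (z : ℂ) (n : ℤ) : toPlane z ∈ diskL ε δ n ↔ ‖z - ctrL ε δ n‖ < 1 := by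
  rw [diskL, mem_ball, ← toPlane_ctrL, toPlane.dist_map, dist_eq_norm]

theorem mem_inclusions_iff (z : ℂ) : toPlane z ∈ inclusions ε δ ↔
    z ∈ (⋃ n, ball (ctrL ε δ n) 1) ∪ ⋃ n, ball (ctrR ε δ n) 1 := by
  simp only [inclusions, mem_iUnion, mem_union, mem_diskR_iff, mem_diskL_iff, mem_ball, dist_eq_norm,
    exists_or]

theorem closedExt_eq_preimage : closedExt ε δ = toPlane ⁻¹' (inclusions ε δ)ᶜ := by
  ext z
  rw [mem_preimage, mem_compl_iff, mem_inclusions_iff]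
  simp only [closedExt, mem_ofPred_eq, mem_union, mem_iUnion, mem_ball, dist_eq_norm, not_or,
    not_exists, not_lt, forall_and]

/-- The closure of the union of the open disks is the union of the closed disks, by local
finiteness. -/
theorem openExt_eq_preimage (hδ : 0 < δ) : openExt ε δ = toPlane ⁻¹' exterior ε δ := by
  have h1 : toPlane ⁻¹' inclusions ε δ =
      (⋃ n, ball (ctrL ε δ n) 1) ∪ ⋃ n, ball (ctrR ε δ n) 1 := by
    ext z; exact mem_inclusions_iff z
  have h2 : toPlane ⁻¹' closure (inclusions ε δ) = closure (toPlane ⁻¹' inclusions ε δ) :=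
    toPlane.toHomeomorph.preimage_closure _
  have h3 : ∀ c : ℤ → ℂ, (∀ n, (c n).im = n * (2 + δ)) →
      closure (⋃ n, ball (c n) 1) = ⋃ n, closedBall (c n) 1 := by
    intro c hc
    apply Subset.antisymm
    · exact closure_minimal (iUnion_mono fun n => ball_subset_closedBall)
        (isClosed_iUnion_disks hδ hc)
    · refine iUnion_subset fun n => ?_
      rw [← closure_ball (c n) one_ne_zero]
      exact closure_mono (subset_iUnion (fun n => ball (c n) 1) n)
  rw [exterior, preimage_compl, h2, h1, closure_union, h3 _ fun n => rfl, h3 _ fun n => rfl,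
    openExt_eq_compl]

theorem fderiv_comp_toPlane (f : Plane → ℝ) (z w : ℂ) :
    fderiv ℝ (f ∘ toPlane) z w = inner ℝ (gradient f (toPlane z)) (toPlane w) := by
  have h := toPlane.toContinuousLinearEquiv.comp_right_fderiv (f := f) (x := z)
  have h2 : fderiv ℝ (f ∘ toPlane) z = _ := h
  rw [h2, inner_gradient_left]
  rfl

theorem fderiv_comp_toPlane_one (f : Plane → ℝ) (z : ℂ) :
    fderiv ℝ (f ∘ toPlane) z 1 = gradient f (toPlane z) 0 := by
  rw [fderiv_comp_toPlane, PiLp.inner_apply, Fin.sum_univ_two, toPlane_zero_coord,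
    toPlane_one_coord]
  simp

theorem fderiv_comp_toPlane_I (f : Plane → ℝ) (z : ℂ) :
    fderiv ℝ (f ∘ toPlane) z Complex.I = gradient f (toPlane z) 1 := by
  rw [fderiv_comp_toPlane, PiLp.inner_apply, Fin.sum_univ_two, toPlane_zero_coord,
    toPlane_one_coord]
  simp

theorem norm_fderiv_comp_toPlane (f : Plane → ℝ) (z : ℂ) :
    ‖fderiv ℝ (f ∘ toPlane) z‖ = ‖gradient f (toPlane z)‖ := by
  rw [← norm_complex_partial, fderiv_comp_toPlane_one, fderiv_comp_toPlane_I,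
    EuclideanSpace.norm_eq, Fin.sum_univ_two, Complex.norm_def, Complex.normSq_apply]
  congr 1
  simp [sq]

theorem gradient_periodic_comp {f : Plane → ℝ} {z : ℂ}
    (h : gradient f (toPlane z) = gradient f (toPlane z + period δ)) :
    fderiv ℝ (f ∘ toPlane) (z + per δ) = fderiv ℝ (f ∘ toPlane) z := by
  refine ContinuousLinearMap.ext fun w => ?_
  rw [fderiv_comp_toPlane, fderiv_comp_toPlane, map_add, toPlane_per, ← h]

theorem mem_frontier_disk {c z : ℂ} (h : ‖z - c‖ = 1) :
    toPlane z ∈ frontier (ball (toPlane c) 1) := by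
  rw [frontier_ball _ one_ne_zero, mem_sphere, toPlane.dist_map, dist_eq_norm, h]

/-- A solution in the Euclidean plane gives one in the complex plane. -/
theorem exists_planeSolution (hε : 0 < ε) (hε1 : ε < 1) (hδ : 0 < δ) {H u : Plane → ℝ}
    (hH : IsBackground δ H) (hu : IsSolution ε δ H u) :
    ∃ cL cR, PlaneSolution ε δ (H ∘ toPlane) (u ∘ toPlane) cL cR := by
  obtain ⟨cL, hcL⟩ := hu.const_left
  obtain ⟨cR, hcR⟩ := hu.const_right
  obtain ⟨g, hg, hgi, hg0⟩ := hu.flux_right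
  refine ⟨cL, cR, fun z _ => harmonicAt_comp_isometry toPlane (hH.harmonic _ trivial),
    fun z => gradient_periodic_comp (hH.periodic _), fun z hz => ?_, ?_, fun z hz => ?_,
    fun z hz => ?_, ⟨g, fun θ => ?_, hgi, hg0⟩, ?_, fun z hz => ?_⟩
  · rw [openExt_eq_preimage hδ] at hz
    exact harmonicAt_comp_isometry toPlane (hu.harmonic _ hz)
  · rw [closedExt_eq_preimage]
    exact hu.continuousOn.comp toPlane.continuous.continuousOn fun z hz => hz
  · have := mem_frontier_disk hz
    rw [toPlane_ctrL] at this
    exact hcL _ this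
  · have := mem_frontier_disk hz
    rw [toPlane_ctrR] at this
    exact hcR _ this
  · have h1 := hg θ
    rw [HasNormalDeriv] at h1
    convert h1 using 1
    funext t
    have : toPlane (ctrR ε δ 0 + ((1 - t : ℝ) : ℂ) * Complex.exp (θ * Complex.I)) =
        centerR ε δ 0 + circleVec θ + t • -circleVec θ := by
      rw [map_add, toPlane_ctrR, ← Complex.real_smul, map_smul, toPlane_exp]
      module
    rw [Function.comp_apply, this]
  · have hmp := toPlane.measurePreserving
    -- Both disks of the cell lie in `|x| < 4`, so this tail of the strip avoids them and inherits
    -- finite energy.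
    have hsub : {z : ℂ | |z.im| < (2 + δ) / 2 ∧ 4 < |z.re|} ⊆
        toPlane ⁻¹' (strip δ \ closure (diskL ε δ 0 ∪ diskR ε δ 0)) := by
      rintro z ⟨h1, h2⟩
      rw [abs_lt] at h1
      refine ⟨⟨by rw [toPlane_one_coord]; linarith, by rw [toPlane_one_coord]; linarith⟩, ?_⟩
      rw [closure_union, diskL, diskR, closure_ball _ one_ne_zero, closure_ball _ one_ne_zero,
        ← toPlane_ctrL, ← toPlane_ctrR, mem_union, mem_closedBall, mem_closedBall,
        toPlane.dist_map, toPlane.dist_map, dist_eq_norm, dist_eq_norm, not_or, not_le, not_le]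
      constructor <;> apply one_lt_norm_of_re <;> simp only [ctrL, ctrR]
      · rcases lt_abs.mp h2 with h | h
        · rw [lt_abs]; left; linarith
        · rw [lt_abs]; right; linarith
      · rcases lt_abs.mp h2 with h | h
        · rw [lt_abs]; left; linarith
        · rw [lt_abs]; right; linarith
    refine lt_of_le_of_lt (lintegral_mono_set hsub) (lt_of_eq_of_lt ?_ hu.energy)
    rw [← hmp.setLIntegral_comp_preimage_emb toPlane.toHomeomorph.measurableEmbedding]
    refine lintegral_congr fun z => ?_
    rw [← ofReal_norm, ← ofReal_norm, ← norm_fderiv_comp_toPlane]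
    rfl
  · rw [openExt_eq_preimage hδ] at hz
    exact gradient_periodic_comp (hu.periodic _ hz)

/-! ### Essential suprema -/

theorem isOpen_stripTrunc (m : ℝ) : IsOpen (stripTrunc δ m) := by
  have h : stripTrunc δ m = ({p : Plane | -1 - δ / 2 < p 1} ∩ {p : Plane | p 1 < 1 + δ / 2}) ∩
      {p : Plane | |p 0| < m} := rfl
  rw [h]
  exact ((isOpen_lt continuous_const (by fun_prop)).inter (isOpen_lt (by fun_prop)
    continuous_const)).inter (isOpen_lt (by fun_prop) continuous_const)

theorem linftyNorm_le {F : Type*} [NormedAddCommGroup F] {f : Plane → F} {s : Set Plane} {C : ℝ}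
    (hs : MeasurableSet s) (h : ∀ p ∈ s, ‖f p‖ ≤ C) : LinftyNorm f s ≤ ENNReal.ofReal C := by
  rw [LinftyNorm, eLpNorm_exponent_top]
  refine eLpNormEssSup_le_of_ae_bound ?_
  filter_upwards [ae_restrict_mem hs] with p hp using h p hp

theorem linftyNorm_lt_top (hδ1 : δ < 1) {H : Plane → ℝ} (hH : Continuous H) :
    LinftyNorm H (stripTrunc δ 4) < ∞ := by
  obtain ⟨C, hC⟩ := (isCompact_closedBall (0 : Plane) 10).exists_bound_of_continuousOn
    hH.continuousOn
  refine lt_of_le_of_lt (linftyNorm_le (isOpen_stripTrunc 4).measurableSet fun p hp => hC p ?_)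
    ENNReal.ofReal_lt_top
  obtain ⟨⟨h1, h2⟩, h3⟩ := hp
  rw [abs_lt] at h3
  rw [mem_closedBall, dist_zero_right, EuclideanSpace.norm_eq, Real.sqrt_le_left (by norm_num),
    Fin.sum_univ_two, Real.norm_eq_abs, Real.norm_eq_abs, sq_abs, sq_abs]
  nlinarith

/-- By continuity the part of `s` where `|H|` exceeds its essential supremum is open; being null, it
is empty. -/
theorem abs_le_linftyNorm {H : Plane → ℝ} (hH : Continuous H) {s : Set Plane} (hs : IsOpen s)
    (hfin : LinftyNorm H s < ∞) {p : Plane} (hp : p ∈ s) : |H p| ≤ (LinftyNorm H s).toReal := by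
  by_contra hlt
  rw [not_le] at hlt
  set O : Set Plane := {q | (LinftyNorm H s).toReal < |H q|} ∩ s with hO
  have hOo : IsOpen O := (isOpen_lt continuous_const hH.abs).inter hs
  have hO0 : volume O = 0 := by
    have h1 : ∀ᵐ q ∂volume.restrict s, ‖H q‖ₑ ≤ LinftyNorm H s := by
      rw [LinftyNorm, eLpNorm_exponent_top]
      exact enorm_ae_le_eLpNormEssSup H _
    rw [ae_restrict_iff' hs.measurableSet] at h1
    refine measure_mono_null ?_ (ae_iff.mp h1)
    rintro q ⟨hq1, hq2⟩ hq3
    have h2 := hq3 hq2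
    rw [← ofReal_norm, ← ENNReal.ofReal_toReal hfin.ne,
      ENNReal.ofReal_le_ofReal_iff ENNReal.toReal_nonneg, Real.norm_eq_abs] at h2
    exact absurd h2 (not_le.mpr hq1)
  have := hOo.eq_empty_of_measure_zero hO0
  exact absurd (show p ∈ O from ⟨hlt, hp⟩) (by rw [this]; exact notMem_empty p)

theorem measurableSet_gapV : MeasurableSet (gapV ε) := by
  have h : gapV ε = {p : Plane | |p 0| < 1 + ε / 2 - √(1 - p 1 ^ 2)} ∩
      {p : Plane | |p 1| < √3 / 2} := rfl
  rw [h]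
  exact ((isOpen_lt (by fun_prop) (by fun_prop)).inter
    (isOpen_lt (by fun_prop) (by fun_prop))).measurableSet

theorem measurableSet_gapH : MeasurableSet (gapH ε δ) := by
  have h : gapH ε δ = {p : Plane | |p 1 - 1 - δ / 2| <
      1 + δ / 2 - √(1 - (p 0 - 1 - ε / 2) ^ 2)} ∩ {p : Plane | |p 0 - 1 - ε / 2| < √3 / 2} := rfl
  rw [h]
  exact ((isOpen_lt (by fun_prop) (by fun_prop)).inter
    (isOpen_lt (by fun_prop) (by fun_prop))).measurableSet

theorem norm_le_of_coords {p : Plane} {C : ℝ} (h0 : |p 0| ≤ C) (h1 : |p 1| ≤ C) : ‖p‖ ≤ 2 * C := by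
  have hC : 0 ≤ C := (abs_nonneg _).trans h0
  rw [EuclideanSpace.norm_eq, Real.sqrt_le_left (by positivity), Fin.sum_univ_two,
    Real.norm_eq_abs, Real.norm_eq_abs]
  nlinarith [abs_nonneg (p 0), abs_nonneg (p 1)]

/-- The bound of `S`. -/
theorem abs_S_le (hδ : 0 < δ) {p : Plane} (hp : p ∈ gapH ε δ) : |S ε δ p| ≤ 2 := by
  have hs : 0 < √δ := Real.sqrt_pos.mpr hδ
  obtain ⟨hx, -⟩ := abs_le_of_gap hδ hp.1 hp.2
  have h1 := two_mul_abs_div_le hδ hx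
  have h2 : S ε δ p = -√δ * (2 * (p 1 - 1 - δ / 2) * (p 0 - 1 - ε / 2) /
      (δ + (p 0 - 1 - ε / 2) ^ 2) ^ 2) := by
    rw [S, add_comm δ]; ring
  rw [h2, abs_mul, abs_neg, abs_of_pos hs]
  have h3 := mul_le_mul_of_nonneg_left h1 hs.le
  rw [mul_one_div, div_self hs.ne'] at h3
  linarith

/-- Replacing the exact jump of the background by `H(0, 1) - H(0, -1)`. -/
theorem abs_jump_sub_le (hδ : 0 < δ) {H : ℂ → ℝ} (hH : HarmonicOnNhd H univ) {M κ : ℝ}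
    (hM : ∀ z : ℂ, |z.re| < 4 → |z.im| < (2 + δ) / 2 → |H z| ≤ M)
    (hκ : ∀ z, H (z + per δ) = H z + κ) :
    |κ - (H ⟨0, 1⟩ - H ⟨0, -1⟩)| ≤ 12 * δ * M := by
  have hHc : Continuous H := continuous_iff_continuousAt.mpr fun z => (hH z trivial).1.continuousAt
  obtain ⟨-, hH3⟩ := background_bounds hHc hδ hM hκ
  -- Unit balls about these points stay in the three cells where `|H| ≤ 3M`, which gives `4 * 3M`.
  have hgrad : ∀ z : ℂ, z.re = 0 → |z.im| ≤ (2 + δ) / 2 → ‖fderiv ℝ H z‖ ≤ 12 * M := by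
    intro z h1 h2
    have := norm_fderiv_le_of_harmonicOn_ball (f := H) (z := z) (r := 1) (M := 3 * M) one_pos
      (fun w _ => hH w trivial) fun w hw => by
        obtain ⟨a, b⟩ := coords_of_mem_closedBall (ball_subset_closedBall hw)
        rw [h1, sub_zero] at a
        have := abs_sub_abs_le_abs_sub w.im z.im
        exact hH3 w (by linarith) (by linarith)
    linarith
  -- The exact jump compares the heights `±(1 + δ/2)`; each endpoint is moved by `δ/2` to `±1`.
  have hseg : ∀ σ : ℝ, |σ| = 1 →
      |H ⟨0, σ * ((2 + δ) / 2)⟩ - H ⟨0, σ⟩| ≤ 12 * M * (δ / 2) := by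
    intro σ hσ
    have hmv := (convex_segment (𝕜 := ℝ) (⟨0, σ⟩ : ℂ) ⟨0, σ * ((2 + δ) / 2)⟩).norm_image_sub_le_of_norm_hasFDerivWithin_le
      (f := H) (C := 12 * M)
      (fun z _ => ((hH z trivial).1.differentiableAt two_ne_zero).hasFDerivAt.hasFDerivWithinAt)
      (fun z hz => by
        obtain ⟨t, h0, h1, h2, h3⟩ := mem_segment_coords hz
        refine hgrad z (by rw [h2]; simp) ?_
        rw [h3]
        have e : σ + t * (σ * ((2 + δ) / 2) - σ) = σ * (1 + t * (δ / 2)) := by ring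
        simp only
        rw [e, abs_mul, hσ, one_mul, abs_of_nonneg (by positivity)]
        nlinarith)
      (left_mem_segment ℝ _ _) (right_mem_segment ℝ _ _)
    have e : (⟨0, σ * ((2 + δ) / 2)⟩ : ℂ) - ⟨0, σ⟩ = ((σ * (δ / 2) : ℝ) : ℂ) * Complex.I := by
      apply Complex.ext <;> simp; ring
    rwa [e, norm_mul, Complex.norm_I, mul_one, Complex.norm_real, Real.norm_eq_abs,
      Real.norm_eq_abs, abs_mul, hσ, one_mul, abs_of_pos (by positivity : 0 < δ / 2)] at hmv
  have h1 := abs_le.mp (hseg 1 (by simp))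
  have h2 := abs_le.mp (hseg (-1) (by simp))
  have h3 := hκ ⟨0, -1 * ((2 + δ) / 2)⟩
  have e : (⟨0, -1 * ((2 + δ) / 2)⟩ : ℂ) + per δ = ⟨0, 1 * ((2 + δ) / 2)⟩ := by
    apply Complex.ext <;> simp [per]; ring
  rw [e] at h3
  rw [abs_le]; constructor <;> linarith

end TwoRows

/-! ### Assembly of the two gap expansions -/

theorem theorem1p1 :
    ∃ C : ℝ≥0, ∃ r : ℝ, 0 < r ∧
      ∀ ε δ : ℝ, 0 < ε → ε < r → 0 < δ → δ < r →
      ∀ H u : TwoRows.Plane → ℝ, TwoRows.IsBackground δ H → TwoRows.IsSolution ε δ H u →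
      ∃ (lam μ : ℝ) (R₁ R₂ : TwoRows.Plane → TwoRows.Plane),
        (∀ p ∈ TwoRows.gapH ε δ,
          gradient u p =
            lam • ((1 / (δ + (p 0 - 1 - ε / 2) ^ 2)) • !₂[(0 : ℝ), 1]
              + (1 / √δ * TwoRows.S ε δ p) • !₂[(1 : ℝ), 0]) + R₁ p) ∧
        (∀ p ∈ TwoRows.gapV ε,
          gradient u p = (μ * (√ε / (ε + p 1 ^ 2))) • !₂[(1 : ℝ), 0] + R₂ p) ∧
        lam = H !₂[0, 1] - H !₂[0, -1] ∧
        ENNReal.ofReal |μ| ≤ C * TwoRows.LinftyNorm H (TwoRows.stripTrunc δ 4) ∧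
        TwoRows.LinftyNorm (TwoRows.S ε δ) (TwoRows.gapH ε δ) ≤ 2 ∧
        TwoRows.S ε δ !₂[1 + ε / 2, 1 + δ / 2] = 0 ∧
        TwoRows.LinftyNorm R₁ (TwoRows.gapH ε δ) + TwoRows.LinftyNorm R₂ (TwoRows.gapV ε)
          ≤ C * TwoRows.LinftyNorm H (TwoRows.stripTrunc δ 4) := by
  -- Each coordinate of each remainder is at most `10⁶ M`, the norm at most twice that, and there
  -- are two remainders.
  refine ⟨4000000, 1 / 10 ^ 12, by norm_num, ?_⟩
  intro ε δ hε hε1 hδ hδ1 H u hH hu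
  have hε2 : ε < 1 := hε1.trans (by norm_num)
  have hδ2 : δ < 1 := hδ1.trans (by norm_num)
  have hsε : 0 < √ε := Real.sqrt_pos.mpr hε
  have hsδ : 0 < √δ := Real.sqrt_pos.mpr hδ
  have hHc : Continuous H :=
    continuous_iff_continuousAt.mpr fun p => (hH.harmonic p trivial).1.continuousAt
  have hfin := TwoRows.linftyNorm_lt_top hδ2 hHc
  set M : ℝ := (TwoRows.LinftyNorm H (TwoRows.stripTrunc δ 4)).toReal with hMdef
  have hM0 : 0 ≤ M := ENNReal.toReal_nonneg
  have hML : TwoRows.LinftyNorm H (TwoRows.stripTrunc δ 4) = ENNReal.ofReal M :=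
    (ENNReal.ofReal_toReal hfin.ne).symm
  have hCM : ((4000000 : ℝ≥0) : ℝ≥0∞) * ENNReal.ofReal M = ENNReal.ofReal (4000000 * M) := by
    rw [ENNReal.ofReal_mul (by norm_num)]
    congr 1
    norm_num
  have hM : ∀ z : ℂ, |z.re| < 4 → |z.im| < (2 + δ) / 2 → |(H ∘ TwoRows.toPlane) z| ≤ M := by
    intro z h1 h2
    rw [abs_lt] at h2
    refine TwoRows.abs_le_linftyNorm hHc (TwoRows.isOpen_stripTrunc 4) hfin ⟨⟨?_, ?_⟩, ?_⟩
    · rw [TwoRows.toPlane_one_coord]; linarith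
    · rw [TwoRows.toPlane_one_coord]; linarith
    · rwa [TwoRows.toPlane_zero_coord]
  obtain ⟨cL, cR, hsol⟩ := TwoRows.exists_planeSolution hε hε2 hδ hH hu
  obtain ⟨κ, hκ, hb⟩ := hsol.bounded hε hε2 hδ hM
  have hd := hb.abs_sub_le hε hε1 hδ hsol.flux
  have hlam : |κ - (H !₂[0, 1] - H !₂[0, -1])| ≤ 12 * δ * M := by
    have := TwoRows.abs_jump_sub_le hδ
      (fun z _ => TwoRows.harmonicAt_comp_isometry TwoRows.toPlane (hH.harmonic _ trivial)) hM hκ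
    simpa only [Function.comp_apply, TwoRows.toPlane_apply] using this
  set lam : ℝ := H !₂[0, 1] - H !₂[0, -1] with hlamdef
  -- The remainders are defined by subtraction, so the two expansions are identities and only the
  -- bounds need proof.
  refine ⟨lam, (cR - cL) / √ε,
    fun p => gradient u p - lam • ((1 / (δ + (p 0 - 1 - ε / 2) ^ 2)) • !₂[(0 : ℝ), 1]
      + (1 / √δ * TwoRows.S ε δ p) • !₂[(1 : ℝ), 0]),
    fun p => gradient u p - ((cR - cL) / √ε * (√ε / (ε + p 1 ^ 2))) • !₂[(1 : ℝ), 0],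
    fun p _ => (add_sub_cancel _ _).symm, fun p _ => (add_sub_cancel _ _).symm, rfl,
    ?_, ?_, ?_, ?_⟩
  · rw [hML, hCM]
    refine ENNReal.ofReal_le_ofReal ?_
    rw [abs_div, abs_of_pos hsε, div_le_iff₀ hsε]
    nlinarith [mul_nonneg hM0 hsε.le]
  · have := TwoRows.linftyNorm_le (f := TwoRows.S ε δ) (C := 2)
      (TwoRows.measurableSet_gapH (ε := ε) (δ := δ)) fun p hp => TwoRows.abs_S_le hδ hp
    simpa using this
  · simp [TwoRows.S]
  · rw [hML, hCM, show (4000000 : ℝ) * M = 2 * (1000000 * M) + 2 * (1000000 * M) by ring,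
      ENNReal.ofReal_add (by positivity) (by positivity)]
    refine add_le_add (TwoRows.linftyNorm_le TwoRows.measurableSet_gapH fun p hp => ?_)
      (TwoRows.linftyNorm_le TwoRows.measurableSet_gapV fun p hp => ?_)
    · obtain ⟨z, rfl⟩ := TwoRows.toPlane.surjective p
      obtain ⟨h1, h2⟩ := hp
      rw [TwoRows.toPlane_zero_coord, TwoRows.toPlane_one_coord] at h1
      rw [TwoRows.toPlane_zero_coord] at h2
      obtain ⟨h3, h4⟩ := hb.gradient_horizontal hε hε1 hδ hδ1 hd hlam h1 h2
      rw [TwoRows.fderiv_comp_toPlane_one] at h3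
      rw [TwoRows.fderiv_comp_toPlane_I] at h4
      refine TwoRows.norm_le_of_coords ?_ ?_
      · convert h3 using 2
        simp [TwoRows.S]
        field_simp
        ring
      · convert h4 using 2
        simp [div_eq_mul_inv]
    · obtain ⟨z, rfl⟩ := TwoRows.toPlane.surjective p
      obtain ⟨h1, h2⟩ := hp
      rw [TwoRows.toPlane_zero_coord, TwoRows.toPlane_one_coord] at h1
      rw [TwoRows.toPlane_one_coord] at h2
      obtain ⟨h3, h4⟩ := hb.gradient_vertical hε hε1 hδ hd h1 h2
      rw [TwoRows.fderiv_comp_toPlane_one] at h3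
      rw [TwoRows.fderiv_comp_toPlane_I] at h4
      refine TwoRows.norm_le_of_coords ?_ ?_
      · convert h3 using 2
        simp
        field_simp
      · convert h4 using 2
        simp
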